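/- **Setting.** Let $X$ be a compact connected smooth manifold with boundary, $d=\dim X\ge 1$, with a boundary collar $\dot X=[0,1)_\rho\times\partial X\hookrightarrow X$ (a diffeomorphism onto an open subset, $(0,\theta)\mapsto\theta$), where $\rho$ extends to a smooth function $\rho:X\to[0,\infty)$ vanishing exactly on $\partial X$. Put $r=1/\rho$ on the interior $X^\circ$; on the collar $\partial_r=-\rho^2\partial_\rho$ with $\theta$ fixed. All function spaces below are complex-valued, unless real-valuedness is evident. A b-vector field is a smooth vector field on $X$ tangent to $\partial X$; $\operatorname{Diff}^m_{\mathrm b}(X)$ is the set of $C^\infty(X)$-linear combinations of compositions of at most $m$ b-vector fields, and $\operatorname{Diff}^m_{\mathrm b}(\dot X)$, $\operatorname{Diff}^m_{\mathrm b}([0,1)_\rho)$ are defined likewise; operators in the latter act on functions on $\dot X$ with $\theta$ held fixed. For $w\in\mathbb N$, $a,b\in\mathbb N\cup\{\infty\}$, write $A\in\rho^{w}\big(\rho^{a}\operatorname{Diff}^m_{\mathrm b}([0,1)_\rho)+\rho^{b}\operatorname{Diff}^m_{\mathrm b}(X)\big)$ if $A\in\rho^w\operatorname{Diff}^m_{\mathrm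 b}(X)$ and $A|_{\dot X}=A_1+A_2$ with $A_1\in\rho^{w+a}\operatorname{Diff}_{\mathrm b}^m([0,1)_\rho)$, $A_2\in\rho^{w+b}\operatorname{Diff}_{\mathrm b}^m(\dot X)$; similarly for functions, with $C^\infty$ in place of $\operatorname{Diff}^m_{\mathrm b}$. Here $\rho^\infty S=\bigcap_k\rho^kS$. Let $h$ be a Riemannian metric on $\partial X$, $g_0=dr^2+r^2h$, and let $g$ be a smooth Riemannian metric on $X^\circ$ such that on the collar $$g-g_0\in\rho^{1+\gimel}C^\infty([0,1)_\rho)\,dr^2+\rho^{1+\gimel_0}C^\infty(\dot X;\operatorname{Sym}^2\,{}^{\mathrm{sc}}T^*\dot X),$$ where $\gimel,\gimel_0\in\mathbb N\cup\{\infty\}$, $\gimel_0\ge1$, $\gimel\le\gimel_0$, and where ${}^{\mathrm{sc}}T^*\dot X$ is spanned by $dr$ and $r$ times the one-forms on $\partial X$. Let $\triangle_g$ be the positive semidefinite Laplace--Beltrami operator, and let $\mathfrak m\in\mathbb R$ be such that $\mathfrak m/r$ is the leading $O(1/r)$ term of the coefficient of $\partial_r^2$ in $\triangle_g$: this coefficient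 is $-1+\mathfrak m/r+o(1/r)$ as $r\to\infty$, for each $\theta\in\partial X$. For $\beth,\beth_0,\dots,\beth_4\in\mathbb N\cup\{\infty\}$ and an operator $L$, a family $\{P(\sigma)\}_{\sigma\ge0}$ of operators on $C^\infty(X^\circ)$ is called *admissible with potential part $L$ and parameters $(\beth,\beth_0,\beth_1,\beth_2,\beth_3,\beth_4)$* if $L\in\rho^3(\rho^{\beth}\operatorname{Diff}^1_{\mathrm b}([0,1)_\rho)+\rho^{\beth_0}\operatorname{Diff}^1_{\mathrm b}(X))$ and there are $\chi\in C_c^\infty(X^\circ;\mathbb R)$ with $\operatorname{supp}(1-\chi)$ a compact subset of $\dot X$, and $\sigma$-independent $Q\in\rho^2(\rho^{\beth_1}\operatorname{Diff}^1_{\mathrm b}([0,1)_\rho)+\rho^{\beth_2}\operatorname{Diff}^1_{\mathrm b}(X))$, $R\in\rho^2(\rho^{\beth_3}C^\infty([0,1)_\rho)+\rho^{\beth_4}C^\infty(X))$, such that for all $\sigma\ge0$ $$P(\sigma)=\triangle_g+2i\sigma(1-\chi)\partial_r+\frac{i\sigma(d-1)}{r}+L+\sigma Q+\sigma^2R .$$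 For an operator $O$ put $\hat O(\sigma)=e^{i\sigma r}r^{i\sigma\mathfrak m/2}\circ O\circ e^{-i\sigma r}r^{-i\sigma\mathfrak m/2}$ and $\check O(\sigma)=e^{-i\sigma r}r^{-i\sigma\mathfrak m/2}\circ O\circ e^{i\sigma r}r^{i\sigma\mathfrak m/2}$. **Proposition.** (I) Let $\{P(\sigma)\}_{\sigma\ge 0}$ be admissible with potential part $L$ and parameters $(\gimel,\gimel_0,\beth_1,\beth_2,\beth_3,\beth_4)$. Then there are $\sigma$-independent $$P_1\in\rho^{2}\big(\rho^{\min\{\gimel,\beth_1\}}\operatorname{Diff}^1_{\mathrm b}([0,1)_\rho)+\rho^{\min\{\gimel_0,\beth_2\}}\operatorname{Diff}^1_{\mathrm b}(X)\big),$$ $$P_2\in\rho\big(\rho^{\min\{\gimel,\beth_1,1+\beth_3\}}C^\infty([0,1)_\rho)+\rho^{\min\{\gimel_0,\beth_2,1+\beth_4\}}C^\infty(X)\big)$$ such that, with $P_0=\triangle_g+L$, the operator $\check P(\sigma)=e^{-i\sigma r}r^{-i\sigma\mathfrak m/2}\circ P(\sigma)\circ e^{i\sigma r}r^{i\sigma\mathfrak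 m/2}$ satisfies $\check P(\sigma)=P_0-\sigma^2+\sigma P_1+\sigma^2P_2$ on $C^\infty(X^\circ)$ for all $\sigma\ge0$. (II) Conversely, let $P_0=\triangle_g+L$ with $L\in\rho^3(\rho^{\gimel}\operatorname{Diff}^1_{\mathrm b}([0,1)_\rho)+\rho^{\gimel_0}\operatorname{Diff}^1_{\mathrm b}(X))$. Then the family $P(\sigma)=e^{i\sigma r}r^{i\sigma\mathfrak m/2}\circ(P_0-\sigma^2)\circ e^{-i\sigma r}r^{-i\sigma\mathfrak m/2}$, $\sigma\ge0$, is admissible with potential part $L$ and parameters $\beth=\gimel$, $\beth_0=\gimel_0$, $\beth_1=\gimel$, $\beth_2=\gimel_0$, $\beth_3=\max\{0,\gimel-1\}$, $\beth_4=\gimel_0-1$. -/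

import Mathlib

open Set Filter Topology Manifold
open scoped ContDiff Bundle

noncomputable section

namespace AsympConic

/-! ## Regions with boundary, weighted smooth functions, b-differential operators -/

/-- A region "with boundary" in `M`: `carrier` is the region including its boundary (coefficients are
smooth on it, up to the boundary), `inner` is its interior (operators act on functions that are
smooth there), and `bdf` is the boundary-defining function, called `ρ` in the comments. -/
structure Region (M : Type*) where
  carrier : Set M
  inner : Set M
  bdf : M → ℝ

/-- Operators on complex functions.  Only their values at interior points, on functions which are
smooth in the interior, are ever used. -/
abbrev Op (M : Type*) : Type _ := (M → ℂ) → M → ℂ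

section General

variable {E H M : Type*} [NormedAddCommGroup E] [NormedSpace ℝ E] [TopologicalSpace H]
  [TopologicalSpace M] [ChartedSpace H M]

/-- `u ∈ C^∞(D°; ℂ)`. -/
def SmoothInside (I : ModelWithCorners ℝ E H) (D : Region M) (u : M → ℂ) : Prop :=
  ContMDiffOn I 𝓘(ℝ, ℂ) ∞ u D.inner

/-- `f ∈ ρ^l C^∞(D)` for `l ∈ ℕ ∪ {∞}`, as a function on the interior of `D`;
here `ρ^∞ C^∞ = ⋂ₖ ρ^k C^∞`. -/
def MemWeightedSmooth {F : Type*} [NormedAddCommGroup F] [NormedSpace ℝ F]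
    (I : ModelWithCorners ℝ E H) (D : Region M) (l : ℕ∞) (f : M → F) : Prop :=
  ∀ k : ℕ, (k : ℕ∞) ≤ l → ∃ a : M → F,
    ContMDiffOn I 𝓘(ℝ, F) ∞ a D.carrier ∧ ∀ x ∈ D.inner, f x = D.bdf x ^ k • a x

/-- b-vector fields: smooth up to the boundary and tangent to it, that is, `V ρ ∈ ρ C^∞(D)`. -/
structure IsBVectorField (I : ModelWithCorners ℝ E H) [IsManifold I ∞ M] (D : Region M)
    (V : (x : M) → TangentSpace I x) : Prop where
  smooth : ContMDiffOn I I.tangent ∞ (fun x => (⟨x, V x⟩ : TangentBundle I M)) D.carrier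
  tangent : ∃ f : M → ℝ, ContMDiffOn I 𝓘(ℝ, ℝ) ∞ f D.carrier ∧
    ∀ x ∈ D.carrier, (mfderivWithin I 𝓘(ℝ, ℝ) D.bdf D.carrier x (V x) : ℝ) = D.bdf x * f x

/-- The derivative `V u` of a complex function along a vector field. -/
def applyField (I : ModelWithCorners ℝ E H) (V : (x : M) → TangentSpace I x) : Op M :=
  fun u x => (mfderiv I 𝓘(ℝ, ℂ) u x (V x) : ℂ)

/-- `A ∈ Diff_b^m(D)`: a linear combination, with coefficients in `C^∞(D; ℂ)`, of compositions of
at most `m` b-vector fields. -/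
def MemDiffB (I : ModelWithCorners ℝ E H) [IsManifold I ∞ M] (D : Region M) (m : ℕ)
    (A : Op M) : Prop :=
  ∃ (N : ℕ) (a : Fin N → M → ℂ) (V : Fin N → List ((x : M) → TangentSpace I x)),
    (∀ j, ContMDiffOn I 𝓘(ℝ, ℂ) ∞ (a j) D.carrier) ∧
    (∀ j, (V j).length ≤ m) ∧
    (∀ j, ∀ W ∈ V j, IsBVectorField I D W) ∧
    ∀ u, SmoothInside I D u → ∀ x ∈ D.inner,
      A u x = ∑ j, a j x * (V j).foldr (applyField I) u x

/-- `A ∈ ρ^l Diff_b^m(D)` for `l ∈ ℕ ∪ {∞}`. -/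
def MemWeightedDiffB (I : ModelWithCorners ℝ E H) [IsManifold I ∞ M] (D : Region M) (l : ℕ∞)
    (m : ℕ) (A : Op M) : Prop :=
  ∀ k : ℕ, (k : ℕ∞) ≤ l → ∃ B : Op M, MemDiffB I D m B ∧
    ∀ u, SmoothInside I D u → ∀ x ∈ D.inner, A u x = (D.bdf x : ℂ) ^ k * B u x

end General

/-- The half-open interval `[0,1)` with boundary-defining function `ρ`. -/
def radialRegion : Region ℝ := ⟨Ico 0 1, Ioo 0 1, fun s => s⟩

/-- The cylinder `[0,1) × Y` with boundary-defining function `(ρ, θ) ↦ ρ`. -/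
def cylinder (Y : Type*) : Region (ℝ × Y) := ⟨Ico 0 1 ×ˢ univ, Ioo 0 1 ×ˢ univ, Prod.fst⟩

/-! ## Manifolds with boundary and a collar -/

section Manifold

variable {n : ℕ} {X Y : Type*}
  [TopologicalSpace X] [ChartedSpace (EuclideanHalfSpace (n + 1)) X]
  [IsManifold (𝓡∂ (n + 1)) ∞ X]
  [TopologicalSpace Y] [ChartedSpace (EuclideanSpace ℝ (Fin n)) Y] [IsManifold (𝓡 n) ∞ Y]

/-- A boundary collar of the manifold with boundary `X` (of dimension `n + 1`), together with a
boundary-defining function.  The manifold `Y` is identified with `∂X` by `θ ↦ (0, θ)`; the collar is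
a diffeomorphism of `[0,1) × Y` onto an open subset of `X`. -/
structure Collar (n : ℕ) (X Y : Type*)
    [TopologicalSpace X] [ChartedSpace (EuclideanHalfSpace (n + 1)) X]
    [TopologicalSpace Y] [ChartedSpace (EuclideanSpace ℝ (Fin n)) Y]
    extends PartialEquiv (ℝ × Y) X where
  source_eq : source = Ico 0 1 ×ˢ univ
  isOpen_target : IsOpen target
  smooth : ContMDiffOn (𝓘(ℝ, ℝ).prod (𝓡 n)) (𝓡∂ (n + 1)) ∞ toFun source
  smooth_symm : ContMDiffOn (𝓡∂ (n + 1)) (𝓘(ℝ, ℝ).prod (𝓡 n)) ∞ invFun target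
  mem_boundary_iff : ∀ x : X, x ∈ (𝓡∂ (n + 1)).boundary X ↔ ∃ θ : Y, toFun (0, θ) = x
  /-- the boundary-defining function `ρ` -/
  bdf : X → ℝ
  bdf_smooth : ContMDiff (𝓡∂ (n + 1)) 𝓘(ℝ, ℝ) ∞ bdf
  bdf_nonneg : ∀ x, 0 ≤ bdf x
  bdf_eq_zero_iff : ∀ x, bdf x = 0 ↔ x ∈ (𝓡∂ (n + 1)).boundary X
  bdf_collar : ∀ s ∈ Ico (0 : ℝ) 1, ∀ θ : Y, bdf (toFun (s, θ)) = s

namespace Collar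

variable (C : Collar n X Y)

/-- `X` itself as a region with boundary. -/
def region : Region X := ⟨univ, (𝓡∂ (n + 1)).interior X, C.bdf⟩

/-- `r = 1 / ρ`. -/
def r (x : X) : ℝ := (C.bdf x)⁻¹

/-- `∂u/∂r = -ρ² ∂u/∂ρ` on the collar, with `θ` held fixed. -/
def radialDeriv : Op X := fun u x =>
  -((C.invFun x).1 : ℂ) ^ 2 * deriv (fun s : ℝ => u (C.toFun (s, (C.invFun x).2))) (C.invFun x).1

/-- `A ∈ ρ^w (ρ^a Diff_b^m([0,1)_ρ) + ρ^b Diff_b^m(X))`: the operator `A` lies in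
`ρ^w Diff_b^m(X)`, and on the collar it is the sum of an operator in `ρ^(w+a) Diff_b^m([0,1)_ρ)`,
acting with `θ` held fixed, and one in `ρ^(w+b) Diff_b^m([0,1) × Y)`. -/
def MemDiffSum (m : ℕ) (w a b : ℕ∞) (A : Op X) : Prop :=
  MemWeightedDiffB (𝓡∂ (n + 1)) C.region w m A ∧
  ∃ (A₁ : Op ℝ) (A₂ : Op (ℝ × Y)),
    MemWeightedDiffB 𝓘(ℝ, ℝ) radialRegion (w + a) m A₁ ∧
    MemWeightedDiffB (𝓘(ℝ, ℝ).prod (𝓡 n)) (cylinder Y) (w + b) m A₂ ∧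
    ∀ u, SmoothInside (𝓡∂ (n + 1)) C.region u → ∀ s ∈ Ioo (0 : ℝ) 1, ∀ θ : Y,
      A u (C.toFun (s, θ)) =
        A₁ (fun t => u (C.toFun (t, θ))) s + A₂ (fun p => u (C.toFun p)) (s, θ)

/-- `f ∈ ρ^w (ρ^a C^∞([0,1)_ρ) + ρ^b C^∞(X))`, in the same sense. -/
def MemFunSum (w a b : ℕ∞) (f : X → ℂ) : Prop :=
  MemWeightedSmooth (𝓡∂ (n + 1)) C.region w f ∧
  ∃ (f₁ : ℝ → ℂ) (f₂ : ℝ × Y → ℂ),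
    MemWeightedSmooth 𝓘(ℝ, ℝ) radialRegion (w + a) f₁ ∧
    MemWeightedSmooth (𝓘(ℝ, ℝ).prod (𝓡 n)) (cylinder Y) (w + b) f₂ ∧
    ∀ s ∈ Ioo (0 : ℝ) 1, ∀ θ : Y, f (C.toFun (s, θ)) = f₁ s + f₂ (s, θ)

end Collar

/-! ## Riemannian metrics and the Laplace--Beltrami operator -/

variable (n X) in
/-- Fields of bilinear forms on the tangent spaces of `X`. -/
abbrev BilinField : Type _ :=
  (x : X) → TangentSpace (𝓡∂ (n + 1)) x →L[ℝ] TangentSpace (𝓡∂ (n + 1)) x →L[ℝ] ℝ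

/-- `g` is a smooth Riemannian metric on the interior of `X`. -/
structure IsRiemannianInside (g : BilinField n X) : Prop where
  smooth : ContMDiffOn (𝓡∂ (n + 1))
    ((𝓡∂ (n + 1)).prod 𝓘(ℝ, EuclideanSpace ℝ (Fin (n + 1)) →L[ℝ]
      EuclideanSpace ℝ (Fin (n + 1)) →L[ℝ] ℝ)) ∞
    (fun x => Bundle.TotalSpace.mk' (EuclideanSpace ℝ (Fin (n + 1)) →L[ℝ]
      EuclideanSpace ℝ (Fin (n + 1)) →L[ℝ] ℝ)
      (E := fun x => TangentSpace (𝓡∂ (n + 1)) x →L[ℝ] TangentSpace (𝓡∂ (n + 1)) x →L[ℝ] ℝ)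
      x (g x))
    ((𝓡∂ (n + 1)).interior X)
  symm : ∀ x ∈ (𝓡∂ (n + 1)).interior X, ∀ v w, g x v w = g x w v
  pos : ∀ x ∈ (𝓡∂ (n + 1)).interior X, ∀ v, v ≠ 0 → 0 < g x v v

/-- The `i`-th partial derivative in `ℝ^(n+1)`. -/
def pd {F : Type*} [NormedAddCommGroup F] [NormedSpace ℝ F] (i : Fin (n + 1))
    (f : EuclideanSpace ℝ (Fin (n + 1)) → F) (y : EuclideanSpace ℝ (Fin (n + 1))) : F :=
  fderiv ℝ f y (EuclideanSpace.single i 1)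

/-- The `i`-th coordinate vector field of the chart at `x`, at the point with coordinates `y`. -/
def coordField (x : X) (y : EuclideanSpace ℝ (Fin (n + 1))) (i : Fin (n + 1)) :
    TangentSpace (𝓡∂ (n + 1)) ((extChartAt (𝓡∂ (n + 1)) x).symm y) :=
  mfderivWithin 𝓘(ℝ, EuclideanSpace ℝ (Fin (n + 1))) (𝓡∂ (n + 1))
    (extChartAt (𝓡∂ (n + 1)) x).symm (range (𝓡∂ (n + 1))) y
    (EuclideanSpace.single i (1 : ℝ) : EuclideanSpace ℝ (Fin (n + 1)))

/-- The matrix `g_ij` in the chart at `x`. -/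
def metricMatrix (g : BilinField n X) (x : X) (y : EuclideanSpace ℝ (Fin (n + 1))) :
    Matrix (Fin (n + 1)) (Fin (n + 1)) ℝ :=
  Matrix.of fun i j => g _ (coordField x y i) (coordField x y j)

/-- The Christoffel symbol `Γ^k_ij` in the chart at `x`. -/
def christoffel (g : BilinField n X) (x : X) (k i j : Fin (n + 1))
    (y : EuclideanSpace ℝ (Fin (n + 1))) : ℝ :=
  (1 / 2) * ∑ l, (metricMatrix g x y)⁻¹ k l *
    (pd i (fun z => metricMatrix g x z j l) y + pd j (fun z => metricMatrix g x z i l) y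
      - pd l (fun z => metricMatrix g x z i j) y)

/-- The positive semidefinite Laplace--Beltrami operator, minus the trace of the Hessian:
`△_g u = - g^ij (∂_i ∂_j u - Γ^k_ij ∂_k u)`, at an interior point `x`, in the chart at `x`. -/
def laplacian (g : BilinField n X) : Op X := fun u x =>
  let y := extChartAt (𝓡∂ (n + 1)) x x
  let U : EuclideanSpace ℝ (Fin (n + 1)) → ℂ := fun z => u ((extChartAt (𝓡∂ (n + 1)) x).symm z)
  ∑ i, ∑ j, -((((metricMatrix g x y)⁻¹ i j : ℝ) : ℂ) *
    (pd i (pd j U) y - ∑ k, (christoffel g x k i j y : ℂ) * pd k U y))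

/-! ## Asymptotically conic metrics -/

namespace Collar

variable (C : Collar n X Y)

/-- The tangent vector `a ∂_r + r⁻¹ v` of `X` at the collar point `p = (ρ, θ)`, for `a ∈ ℝ` and
`v ∈ T_θ Y`; that is the image of `(-ρ² a, ρ v)`.  These are the values of sc-vector fields. -/
def scVector (p : ℝ × Y) (v : ℝ × EuclideanSpace ℝ (Fin n)) :
    TangentSpace (𝓡∂ (n + 1)) (C.toFun p) :=
  mfderiv (𝓘(ℝ, ℝ).prod (𝓡 n)) (𝓡∂ (n + 1)) C.toFun p
    ((-(p.1 ^ 2) * v.1, p.1 • v.2) : ℝ × EuclideanSpace ℝ (Fin n))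

end Collar

variable (n Y) in
/-- Fields of bilinear forms on the tangent spaces of `ℝ × Y`.  Through
`a ∂_r + r⁻¹ v ↔ (a, v)` those which are smooth on `[0,1) × Y` are the
smooth sections of the tensor square of the sc-cotangent bundle of the cylinder. -/
abbrev ScBilinField : Type _ :=
  (p : ℝ × Y) → TangentSpace (𝓘(ℝ, ℝ).prod (𝓡 n)) p →L[ℝ]
    TangentSpace (𝓘(ℝ, ℝ).prod (𝓡 n)) p →L[ℝ] ℝ

/-- Smoothness on `[0,1) × Y`, up to the boundary. -/
def ScSmooth (κ : ScBilinField n Y) : Prop :=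
  ContMDiffOn (𝓘(ℝ, ℝ).prod (𝓡 n))
    ((𝓘(ℝ, ℝ).prod (𝓡 n)).prod 𝓘(ℝ, (ℝ × EuclideanSpace ℝ (Fin n)) →L[ℝ]
      (ℝ × EuclideanSpace ℝ (Fin n)) →L[ℝ] ℝ)) ∞
    (fun p => Bundle.TotalSpace.mk' ((ℝ × EuclideanSpace ℝ (Fin n)) →L[ℝ]
      (ℝ × EuclideanSpace ℝ (Fin n)) →L[ℝ] ℝ)
      (E := fun p : ℝ × Y => TangentSpace (𝓘(ℝ, ℝ).prod (𝓡 n)) p →L[ℝ]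
        TangentSpace (𝓘(ℝ, ℝ).prod (𝓡 n)) p →L[ℝ] ℝ)
      p (κ p))
    (cylinder Y).carrier

/-- `κ ∈ ρ^l C^∞([0,1) × Y; scT* ⊗ scT*)` for `l ∈ ℕ ∪ {∞}`. -/
def MemWeightedSc (l : ℕ∞) (κ : ScBilinField n Y) : Prop :=
  ∀ k : ℕ, (k : ℕ∞) ≤ l → ∃ κ' : ScBilinField n Y, ScSmooth κ' ∧
    ∀ p ∈ (cylinder Y).inner, κ p = p.1 ^ k • κ' p

/-- Riemannian metrics on `Y`. -/
abbrev BoundaryMetric (n : ℕ) (Y : Type*) [TopologicalSpace Y]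
    [ChartedSpace (EuclideanSpace ℝ (Fin n)) Y] [IsManifold (𝓡 n) ∞ Y] : Type _ :=
  Bundle.ContMDiffRiemannianMetric (𝓡 n) ∞ (EuclideanSpace ℝ (Fin n))
    (fun y : Y => TangentSpace (𝓡 n) y)

/-- `g - g₀ ∈ ρ^(1+a) C^∞([0,1)_ρ) dr² + ρ^(1+a₀) C^∞([0,1) × Y; Sym² scT*)` on the collar, where
`g₀ = dr² + r² h` is the exactly conic metric. -/
def IsAsympConic (C : Collar n X Y) (h : BoundaryMetric n Y) (g : BilinField n X)
    (a a₀ : ℕ∞) : Prop :=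
  ∃ (F : ℝ → ℝ) (κ : ScBilinField n Y),
    MemWeightedSmooth 𝓘(ℝ, ℝ) radialRegion (1 + a) F ∧ MemWeightedSc (1 + a₀) κ ∧
    ∀ s ∈ Ioo (0 : ℝ) 1, ∀ (θ : Y) (v w : ℝ × EuclideanSpace ℝ (Fin n)),
      g (C.toFun (s, θ)) (C.scVector (s, θ) v) (C.scVector (s, θ) w) =
        v.1 * w.1 + h.inner θ v.2 w.2 + F s * (v.1 * w.1) + κ (s, θ) v w

namespace Collar

variable (C : Collar n X Y)

/-- The coefficient of `∂_r²` in a differential operator `A` of second order without term of order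
zero, in collar coordinates: the value at `x` of `A` applied to `(r - r(x))² / 2`. -/
def coeffRR (A : Op X) (x : X) : ℂ := A (fun z => (((C.r z - C.r x) ^ 2 / 2 : ℝ) : ℂ)) x

/-- `𝔪 / r` is the leading, i.e. `O(1/r)`, term of the coefficient of `∂_r²` in `△_g` (the
coefficient of `∂_r²` in the conic Laplacian being `-1`). -/
def IsMass (g : BilinField n X) (𝔪 : ℝ) : Prop :=
  ∀ θ : Y, Tendsto (fun s : ℝ => (C.coeffRR (laplacian g) (C.toFun (s, θ)) + 1) / (s : ℂ))
    (𝓝[>] 0) (𝓝 (𝔪 : ℂ))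

/-! ## The operators -/

/-- The function `e^{iσr} r^{iσ𝔪/2}`. -/
def phase (𝔪 σ : ℝ) (x : X) : ℂ :=
  Complex.exp (Complex.I * σ * C.r x) * (C.r x : ℂ) ^ (Complex.I * σ * 𝔪 / 2)

/-- `e^{iσr} r^{iσ𝔪/2} ∘ A ∘ e^{-iσr} r^{-iσ𝔪/2}`. -/
def hatConj (𝔪 σ : ℝ) (A : Op X) : Op X := fun u x =>
  C.phase 𝔪 σ x * A (fun z => C.phase 𝔪 (-σ) z * u z) x

/-- `e^{-iσr} r^{-iσ𝔪/2} ∘ A ∘ e^{iσr} r^{iσ𝔪/2}`. -/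
def checkConj (𝔪 σ : ℝ) (A : Op X) : Op X := fun u x =>
  C.phase 𝔪 (-σ) x * A (fun z => C.phase 𝔪 σ z * u z) x

/-- Two operators agree on `C^∞(X°)`. -/
def OpEq (A B : Op X) : Prop :=
  ∀ u, SmoothInside (𝓡∂ (n + 1)) C.region u → ∀ x ∈ C.region.inner, A u x = B u x

/-- `χ ∈ C_c^∞(X°)` with `supp (1 - χ)` a compact subset of the collar (`X` is compact). -/
structure IsCutoff (χ : X → ℝ) : Prop where
  smooth : ContMDiff (𝓡∂ (n + 1)) 𝓘(ℝ, ℝ) ∞ χ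
  support_subset : tsupport χ ⊆ (𝓡∂ (n + 1)).interior X
  support_one_sub : tsupport (fun x => 1 - χ x) ⊆ C.target

/-- The family `P` is admissible with zeroth term `△_g + L` and parameters `(b, b₀, …, b₄)`:
`P(σ) = △_g + 2iσ(1-χ)∂_r + iσ(d-1)/r + L + σQ + σ²R` for `σ ≥ 0`, where `d = n + 1`. -/
def IsAdmissible (g : BilinField n X) (L : Op X) (P : ℝ → Op X) (b b₀ b₁ b₂ b₃ b₄ : ℕ∞) : Prop :=
  C.MemDiffSum 1 3 b b₀ L ∧
  ∃ (χ : X → ℝ) (Q : Op X) (R : X → ℂ),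
    C.IsCutoff χ ∧ C.MemDiffSum 1 2 b₁ b₂ Q ∧ C.MemFunSum 2 b₃ b₄ R ∧
    ∀ σ : ℝ, 0 ≤ σ → C.OpEq (P σ) fun u x =>
      laplacian g u x + 2 * Complex.I * σ * (1 - χ x) * C.radialDeriv u x
        + Complex.I * σ * n / C.r x * u x + L u x + σ * Q u x + σ ^ 2 * R x * u x

end Collar

end Manifold

end AsympConic

end

noncomputable section
namespace AsympConic

/-! ## Hessians and traces in coordinates -/

section Flat

variable {V V' : Type*} [NormedAddCommGroup V] [NormedSpace ℝ V]
  [NormedAddCommGroup V'] [NormedSpace ℝ V']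

/-! Put φ = r + (𝔪/2) log r, so that the conjugating factor is exp(iσφ) on the interior. Three
product rules determine everything. For the Laplacian, △(e^{iσφ}u) = e^{iσφ}(△u + iσ(u△φ − 2⟨∇φ,
du⟩) + σ²|dφ|²u) (`laplacian_exp_mul`). For an operator A of first order, A(e^{iσφ}u) = e^{iσφ}(Au +
iσ[A,φ]u) with [A,φ] a function (`MemWeightedDiffB.exp_mul`). On the collar, ∂_rφ = 1 + 𝔪ρ/2. With n
= d − 1, the conjugate of an admissible family is therefore P₀ − σ² + σP₁ + σ²P₂ with P₁ =
i(2(1−χ)∂_r − 2∇φ + (△φ + nρ) + [L,φ]) + Q, P₂ = 1 + |dφ|² − 2(1−χ)(1 + 𝔪ρ/2) + i[Q,φ] + R.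
Conversely, conjugating P₀ − σ² with the opposite sign gives an admissible family with Q =
−i(2(1−χ)∂_r − 2∇φ + (△φ + nρ) + [L,φ]) and R = |dφ|² − 1. What remains is to place these
coefficients in the weighted spaces.

Commutators with φ cost one power of ρ: a b-vector field W has Wρ = ρf with f smooth, hence Wφ =
−ρ⁻¹(1 + 𝔪ρ/2)f (`MemWeightedDiffB.commFun_phase`). The terms involving χ are harmless, since χ
vanishes near ∂X (`Collar.IsCutoff.mem_top`).

For |dφ|², ∇φ and △φ, the metric on the collar is compared with the model (1+F)dr² + r²h, from which
it differs by O(ρ^{1+gimel₀}) in the scattering frame (`exists_hasNormalForms`). The matrix of the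
metric in this frame is smooth and invertible up to ρ = 0. Congruence modulo ρ^k survives sums,
products, matrix inversion and derivatives along b-vector fields, so the three quantities are
congruent to those of the model (`CongOn.scLap`, `HasNormalForms.phaseNorm`,
`HasNormalForms.laplacian`, `HasNormalForms.memWeightedField`). The model quantities depend on ρ
alone, which produces the radial summands; for instance |dφ|² is (1 + 𝔪ρ/2)²/(1+F).

The mass enters through `Collar.IsMass.eq`: F = 𝔪ρ + O(ρ²). If gimel ≥ 1 then 𝔪 = 0; in either case
𝔪ρ has the decay ρ^{1+gimel} of F, and the radial memberships become algebra (`IsRadialPart`). If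
gimel = 0, the logarithmic term of φ is what cancels the ρ-term of |dφ|² − 1, so that R is still
O(ρ²) (`IsRadialPart.norm_sub_one_mem`).

The given `laplacian` uses a different chart at each point, so an invariance statement is needed
before △φ can be differentiated or computed on the collar. The Hessian is written with the gradient
vector N in place of inverse-metric Christoffel symbols. In this form it transforms tensorially
under a change of parametrization (`hessForm_pullback`), and its trace does not depend on the basis
(`traceForm_basis`). This gives `laplacian_ofReal_param`, which is applied to the collar and to
charts near an interior point. -/

/-- The Hessian of `f` at `p` with respect to the metric `G`, the gradient of `f` at `p` being `N`. -/
def hessForm (G : V → V →L[ℝ] V →L[ℝ] ℝ) (f : V → ℝ) (p N v w : V) : ℝ :=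
  fderiv ℝ (fun q => fderiv ℝ f q w) p v - (1 / 2) * (fderiv ℝ (fun q => G q w N) p v
    + fderiv ℝ (fun q => G q v N) p w - fderiv ℝ (fun q => G q v w) p N)

-- The product rule, with the two terms containing second derivatives of `τ` kept separate; these
-- are the non-tensorial ones.
set_option synthInstance.maxHeartbeats 200000 in
theorem fderiv_pullback_metric {G : V → V →L[ℝ] V →L[ℝ] ℝ} {G' : V' → V' →L[ℝ] V' →L[ℝ] ℝ}
    {τ : V → V'} {p : V} (hτ : ContDiffAt ℝ 2 τ p) (hG' : DifferentiableAt ℝ G' (τ p))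
    (hG : ∀ᶠ q in 𝓝 p, ∀ v w, G q v w = G' (τ q) (fderiv ℝ τ q v) (fderiv ℝ τ q w)) (x v w : V) :
    fderiv ℝ (fun q => G q v w) p x
      = fderiv ℝ G' (τ p) (fderiv ℝ τ p x) (fderiv ℝ τ p v) (fderiv ℝ τ p w)
        + G' (τ p) (fderiv ℝ (fderiv ℝ τ) p x v) (fderiv ℝ τ p w)
        + G' (τ p) (fderiv ℝ τ p v) (fderiv ℝ (fderiv ℝ τ) p x w) := by
  have hτ1 : DifferentiableAt ℝ τ p := hτ.differentiableAt (by norm_num)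
  have hτ2 : DifferentiableAt ℝ (fderiv ℝ τ) p :=
    (hτ.fderiv_right (m := 1) (by norm_num)).differentiableAt (by norm_num)
  have e : (fun q => G q v w) =ᶠ[𝓝 p]
      fun q => G' (τ q) (fderiv ℝ τ q v) (fderiv ℝ τ q w) := hG.mono fun q hq => hq v w
  rw [e.fderiv_eq]
  have h1 : HasFDerivAt (fun q => G' (τ q)) ((fderiv ℝ G' (τ p)).comp (fderiv ℝ τ p)) p :=
    HasFDerivAt.comp (g := G') p hG'.hasFDerivAt hτ1.hasFDerivAt
  have h2 := ((h1.clm_apply (hτ2.hasFDerivAt.clm_apply (hasFDerivAt_const v p))).clm_apply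
    (hτ2.hasFDerivAt.clm_apply (hasFDerivAt_const w p))).fderiv
  rw [h2]
  simp
  ring

/-- In the combination of three metric derivatives the second derivatives of `τ` cancel except for
2G'(D²τ(v,w), Dτ N). As Dτ N represents df', half of this is df'(D²τ(v,w)), exactly the extra term
in the second derivative of f' ∘ τ. -/
theorem hessForm_pullback {G : V → V →L[ℝ] V →L[ℝ] ℝ} {G' : V' → V' →L[ℝ] V' →L[ℝ] ℝ}
    {f : V → ℝ} {f' : V' → ℝ} {τ : V → V'} {p : V}
    (hτ : ContDiffAt ℝ 2 τ p) (hG' : DifferentiableAt ℝ G' (τ p)) (hf' : ContDiffAt ℝ 2 f' (τ p))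
    (hG : ∀ᶠ q in 𝓝 p, ∀ v w, G q v w = G' (τ q) (fderiv ℝ τ q v) (fderiv ℝ τ q w))
    (hf : f =ᶠ[𝓝 p] f' ∘ τ) (hsymm : ∀ v w, G' (τ p) v w = G' (τ p) w v) {N : V}
    (hN : ∀ z, G' (τ p) (fderiv ℝ τ p N) z = fderiv ℝ f' (τ p) z) (v w : V) :
    hessForm G f p N v w
      = hessForm G' f' (τ p) (fderiv ℝ τ p N) (fderiv ℝ τ p v) (fderiv ℝ τ p w) := by
  have hτ1 : DifferentiableAt ℝ τ p := hτ.differentiableAt (by norm_num)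
  have hτ2 : DifferentiableAt ℝ (fderiv ℝ τ) p :=
    (hτ.fderiv_right (m := 1) (by norm_num)).differentiableAt (by norm_num)
  have hf2 : DifferentiableAt ℝ (fderiv ℝ f') (τ p) :=
    (hf'.fderiv_right (m := 1) (by norm_num)).differentiableAt (by norm_num)
  have key : fderiv ℝ (fun q => fderiv ℝ f q w) p v
      = fderiv ℝ (fderiv ℝ f') (τ p) (fderiv ℝ τ p v) (fderiv ℝ τ p w)
        + fderiv ℝ f' (τ p) (fderiv ℝ (fderiv ℝ τ) p v w) := by
    have e : (fun q => fderiv ℝ f q w) =ᶠ[𝓝 p]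
        fun q => fderiv ℝ f' (τ q) (fderiv ℝ τ q w) := by
      have a1 : ∀ᶠ q in 𝓝 p, DifferentiableAt ℝ f' (τ q) :=
        hτ.continuousAt.eventually ((hf'.eventually (by simp)).mono
          fun y hy => hy.differentiableAt (by norm_num))
      have a2 : ∀ᶠ q in 𝓝 p, DifferentiableAt ℝ τ q :=
        (hτ.eventually (by simp)).mono fun y hy => hy.differentiableAt (by norm_num)
      filter_upwards [hf.eventuallyEq_nhds, a1, a2] with q hq h1 h2
      rw [hq.fderiv_eq, fderiv_comp q h1 h2]
      rfl
    rw [e.fderiv_eq]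
    have h1 : HasFDerivAt (fun q => fderiv ℝ f' (τ q))
        ((fderiv ℝ (fderiv ℝ f') (τ p)).comp (fderiv ℝ τ p)) p :=
      hf2.hasFDerivAt.comp p hτ1.hasFDerivAt
    rw [(h1.clm_apply (hτ2.hasFDerivAt.clm_apply (hasFDerivAt_const w p))).fderiv]
    simp
    ring
  have key' : fderiv ℝ (fun q => fderiv ℝ f' q (fderiv ℝ τ p w)) (τ p) (fderiv ℝ τ p v)
      = fderiv ℝ (fderiv ℝ f') (τ p) (fderiv ℝ τ p v) (fderiv ℝ τ p w) := by
    rw [(hf2.hasFDerivAt.clm_apply (hasFDerivAt_const (fderiv ℝ τ p w) (τ p))).fderiv]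
    simp
  have keyG : ∀ a b c, fderiv ℝ (fun q => G' q b c) (τ p) a = fderiv ℝ G' (τ p) a b c := by
    intro a b c
    rw [((hG'.hasFDerivAt.clm_apply (hasFDerivAt_const b (τ p))).clm_apply
      (hasFDerivAt_const c (τ p))).fderiv]
    simp
  have s2 : ∀ a b, fderiv ℝ (fderiv ℝ τ) p a b = fderiv ℝ (fderiv ℝ τ) p b a := fun a b =>
    (hτ.isSymmSndFDerivAt (by simp)).eq a b
  unfold hessForm
  rw [key, key', fderiv_pullback_metric hτ hG' hG, fderiv_pullback_metric hτ hG' hG,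
    fderiv_pullback_metric hτ hG' hG, keyG, keyG, keyG, s2 w v, s2 N v, s2 N w,
    ← hN, hsymm (fderiv ℝ (fderiv ℝ τ) p v N), hsymm (fderiv ℝ τ p N)]
  ring

/-- The Gram matrix of a family of vectors. -/
def gram {ι : Type*} (G : V →L[ℝ] V →L[ℝ] ℝ) (b : ι → V) : Matrix ι ι ℝ :=
  Matrix.of fun i j => G (b i) (b j)

/-- The trace of `B` with respect to the bilinear form `G`, in the basis `b`. -/
def traceForm {ι : Type*} [Fintype ι] [DecidableEq ι] (G : V →L[ℝ] V →L[ℝ] ℝ)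
    (B : V → V → ℝ) (b : ι → V) : ℝ :=
  ∑ i, ∑ j, (gram G b)⁻¹ i j * B (b i) (b j)

/-- A vector x in the kernel satisfies 0 = xᵀ(gram)x = G(Σ xᵢbᵢ, Σ xᵢbᵢ), against positivity and
linear independence. -/
theorem isUnit_det_gram {ι : Type*} [Fintype ι] [DecidableEq ι] {G : V →L[ℝ] V →L[ℝ] ℝ}
    (hG : ∀ v, v ≠ 0 → 0 < G v v) {b : ι → V} (hb : LinearIndependent ℝ b) :
    IsUnit (gram G b).det := by
  rw [← Matrix.isUnit_iff_isUnit_det, ← Matrix.mulVec_injective_iff_isUnit]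
  refine (injective_iff_map_eq_zero (Matrix.mulVecLin (gram G b))).2 fun x hx => ?_
  by_contra hne
  have h0 : ∑ i, x i • b i ≠ 0 := fun h => hne (funext fun i =>
    Fintype.linearIndependent_iff.1 hb x h i)
  have h1 := hG _ h0
  have h2 : G (∑ i, x i • b i) (∑ j, x j • b j) = ∑ i, x i * (gram G b).mulVec x i := by
    simp only [map_sum, map_smul, sum_apply, smul_apply, smul_eq_mul, Matrix.mulVec, dotProduct, gram, Matrix.of_apply]
    simp only [Finset.mul_sum]
    rw [Finset.sum_comm]
    refine Finset.sum_congr rfl fun i _ => Finset.sum_congr rfl fun j _ => ?_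
    ring
  rw [h2] at h1
  have h3 : (gram G b).mulVec x = 0 := hx
  simp [h3] at h1

theorem of_bilin_eq_mul {ι ι' : Type*} [Fintype ι] [Fintype ι']
    (B : V →ₗ[ℝ] V →ₗ[ℝ] ℝ) (b : ι → V) (b' : Module.Basis ι' ℝ V) :
    Matrix.of (fun i j => B (b i) (b j))
      = (b'.toMatrix b).transpose * Matrix.of (fun i j => B (b' i) (b' j)) * b'.toMatrix b := by
  ext i j
  have e : ∀ i, b i = ∑ k, b'.toMatrix b k i • b' k := fun i => by
    simp [Module.Basis.toMatrix_apply, b'.sum_repr]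
  rw [Matrix.of_apply, e i, e j]
  simp only [map_sum, map_smul, LinearMap.sum_apply, LinearMap.smul_apply, smul_eq_mul,
    Matrix.mul_apply, Matrix.transpose_apply, Matrix.of_apply, Finset.mul_sum, Finset.sum_mul]
  refine Finset.sum_congr rfl fun k _ => Finset.sum_congr rfl fun l _ => ?_
  ring

theorem traceForm_eq_trace {ι : Type*} [Fintype ι] [DecidableEq ι] (G : V →L[ℝ] V →L[ℝ] ℝ)
    (B : V → V → ℝ) (b : ι → V) :
    traceForm G B b = ((gram G b)⁻¹ * (Matrix.of fun i j => B (b i) (b j)).transpose).trace := by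
  simp [traceForm, Matrix.trace, Matrix.mul_apply]

/-- Under a change of basis both matrices transform by congruence and the inverse Gram matrix
contragrediently; the transition matrices cancel by cyclicity of the trace. No symmetry of `B` is
needed. -/
theorem traceForm_basis {ι ι' : Type*} [Fintype ι] [DecidableEq ι] [Fintype ι'] [DecidableEq ι']
    (G : V →L[ℝ] V →L[ℝ] ℝ) (B : V →ₗ[ℝ] V →ₗ[ℝ] ℝ) (b : Module.Basis ι ℝ V)
    (b' : Module.Basis ι' ℝ V) (hdet : IsUnit (gram G b').det) :
    traceForm G (fun v w => B v w) b = traceForm G (fun v w => B v w) b' := by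
  set A : Matrix ι' ι ℝ := b'.toMatrix b with hA
  set D : Matrix ι ι' ℝ := b.toMatrix b' with hD
  have hAD : A * D = 1 := b'.toMatrix_mul_toMatrix_flip b
  have hDA : D * A = 1 := b.toMatrix_mul_toMatrix_flip b'
  let G₀ : V →ₗ[ℝ] V →ₗ[ℝ] ℝ :=
    LinearMap.mk₂ ℝ (fun v w => G v w) (by simp) (by simp) (by simp) (by simp)
  have h1 : gram G b = A.transpose * gram G b' * A := of_bilin_eq_mul G₀ b b'
  have h2 : (gram G b)⁻¹ = D * (gram G b')⁻¹ * D.transpose := by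
    refine Matrix.inv_eq_right_inv ?_
    calc gram G b * (D * (gram G b')⁻¹ * D.transpose)
        = A.transpose * gram G b' * (A * D) * (gram G b')⁻¹ * D.transpose := by
          rw [h1]; simp only [Matrix.mul_assoc]
      _ = A.transpose * (gram G b' * (gram G b')⁻¹) * D.transpose := by
          rw [hAD, Matrix.mul_one]; simp only [Matrix.mul_assoc]
      _ = (D * A).transpose := by
          rw [Matrix.mul_nonsing_inv _ hdet, Matrix.mul_one, Matrix.transpose_mul]
      _ = 1 := by rw [hDA, Matrix.transpose_one]
  rw [traceForm_eq_trace, traceForm_eq_trace, h2, of_bilin_eq_mul B b b', ← hA]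
  simp only [Matrix.transpose_mul, Matrix.transpose_transpose]
  set W := (Matrix.of fun i j => B (b' i) (b' j)).transpose
  calc (D * (gram G b')⁻¹ * D.transpose * (A.transpose * (W * A))).trace
      = (D * ((gram G b')⁻¹ * (D.transpose * A.transpose) * (W * A))).trace := by
        simp only [Matrix.mul_assoc]
    _ = ((gram G b')⁻¹ * (D.transpose * A.transpose) * (W * A) * D).trace := Matrix.trace_mul_comm _ _
    _ = ((gram G b')⁻¹ * (A * D).transpose * (W * (A * D))).trace := by
        rw [Matrix.transpose_mul]; simp only [Matrix.mul_assoc]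
    _ = ((gram G b')⁻¹ * W).trace := by simp [hAD]

/-- The Hessian as a bilinear map. -/
theorem exists_bilin_hessForm {G : V → V →L[ℝ] V →L[ℝ] ℝ} {f : V → ℝ} {p : V}
    (hG : DifferentiableAt ℝ G p) (hf : ContDiffAt ℝ 2 f p) (N : V) :
    ∃ B : V →ₗ[ℝ] V →ₗ[ℝ] ℝ, ∀ v w, B v w = hessForm G f p N v w := by
  have hf2 : DifferentiableAt ℝ (fderiv ℝ f) p :=
    (hf.fderiv_right (m := 1) (by norm_num)).differentiableAt (by norm_num)
  have df : ∀ w, DifferentiableAt ℝ (fun q => fderiv ℝ f q w) p := fun w =>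
    hf2.clm_apply (differentiableAt_const w)
  have dG : ∀ v w, DifferentiableAt ℝ (fun q => G q v w) p := fun v w =>
    (hG.clm_apply (differentiableAt_const v)).clm_apply (differentiableAt_const w)
  have f1 : ∀ w w', fderiv ℝ (fun q => fderiv ℝ f q (w + w')) p
      = fderiv ℝ (fun q => fderiv ℝ f q w) p + fderiv ℝ (fun q => fderiv ℝ f q w') p := by
    intro w w'
    simp only [map_add]
    exact fderiv_fun_add (df w) (df w')
  have f2 : ∀ (c : ℝ) w, fderiv ℝ (fun q => fderiv ℝ f q (c • w)) p
      = c • fderiv ℝ (fun q => fderiv ℝ f q w) p := by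
    intro c w
    simp only [map_smul]
    exact fderiv_fun_const_smul (df w) c
  have g1 : ∀ v v' w, fderiv ℝ (fun q => G q (v + v') w) p
      = fderiv ℝ (fun q => G q v w) p + fderiv ℝ (fun q => G q v' w) p := by
    intro v v' w
    simp only [map_add, add_apply]
    exact fderiv_fun_add (dG v w) (dG v' w)
  have g2 : ∀ (c : ℝ) v w, fderiv ℝ (fun q => G q (c • v) w) p
      = c • fderiv ℝ (fun q => G q v w) p := by
    intro c v w
    simp only [map_smul, smul_apply]
    exact fderiv_fun_const_smul (dG v w) c
  have g3 : ∀ v w w', fderiv ℝ (fun q => G q v (w + w')) p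
      = fderiv ℝ (fun q => G q v w) p + fderiv ℝ (fun q => G q v w') p := by
    intro v w w'
    simp only [map_add]
    exact fderiv_fun_add (dG v w) (dG v w')
  have g4 : ∀ (c : ℝ) v w, fderiv ℝ (fun q => G q v (c • w)) p
      = c • fderiv ℝ (fun q => G q v w) p := by
    intro c v w
    simp only [map_smul]
    exact fderiv_fun_const_smul (dG v w) c
  refine ⟨LinearMap.mk₂ ℝ (fun v w => hessForm G f p N v w) ?_ ?_ ?_ ?_, fun v w => rfl⟩
  · intro v v' w
    simp only [hessForm, g1]
    simp only [map_add, add_apply]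
    ring
  · intro c v w
    simp only [hessForm, g2]
    simp only [map_smul, smul_apply, smul_eq_mul]
    ring
  · intro v w w'
    simp only [hessForm, f1, g1, g3]
    simp only [map_add, add_apply]
    ring
  · intro c v w
    simp only [hessForm, f2, g2, g4]
    simp only [map_smul, smul_apply, smul_eq_mul]
    ring

end Flat
end AsympConic

end

noncomputable section
namespace AsympConic

set_option linter.unusedSectionVars false

/-! ## The Laplacian in an arbitrary parametrization -/

section Parametrization

variable {n : ℕ} {X : Type*}
  [TopologicalSpace X] [ChartedSpace (EuclideanHalfSpace (n + 1)) X]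
  [IsManifold (𝓡∂ (n + 1)) ∞ X]
  {V : Type*} [NormedAddCommGroup V] [NormedSpace ℝ V]

/-- The values of a field of bilinear forms, as forms on the model space. -/
def bilinAt (g : BilinField n X) (x : X) :
    EuclideanSpace ℝ (Fin (n + 1)) →L[ℝ] EuclideanSpace ℝ (Fin (n + 1)) →L[ℝ] ℝ := g x

/-- The derivative of a parametrization, with values in the model space. -/
def dparam (Φ : V → X) (q : V) : V →L[ℝ] EuclideanSpace ℝ (Fin (n + 1)) :=
  mfderiv 𝓘(ℝ, V) (𝓡∂ (n + 1)) Φ q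

/-- The pullback of a field of bilinear forms under a parametrization. -/
def pullMetric (g : BilinField n X) (Φ : V → X) (q : V) : V →L[ℝ] V →L[ℝ] ℝ :=
  (bilinAt g (Φ q)).bilinearComp (dparam Φ q) (dparam Φ q)

theorem pullMetric_apply (g : BilinField n X) (Φ : V → X) (q v w : V) :
    pullMetric g Φ q v w = bilinAt g (Φ q) (dparam Φ q v) (dparam Φ q w) := rfl

theorem dparam_comp {V' : Type*} [NormedAddCommGroup V'] [NormedSpace ℝ V'] {Φ : V' → X}
    {τ : V → V'} {q : V} (hΦ : MDifferentiableAt 𝓘(ℝ, V') (𝓡∂ (n + 1)) Φ (τ q))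
    (hτ : DifferentiableAt ℝ τ q) :
    dparam (n := n) (Φ ∘ τ) q = (dparam Φ (τ q)).comp (fderiv ℝ τ q) := by
  have := mfderiv_comp q hΦ hτ.mdifferentiableAt
  rw [mfderiv_eq_fderiv] at this
  exact this

theorem dparam_congr {Φ Ψ : V → X} {q : V} (h : Φ =ᶠ[𝓝 q] Ψ) :
    dparam (n := n) Φ q = dparam Ψ q := h.mfderiv_eq

theorem pullMetric_congr (g : BilinField n X) {Φ Ψ : V → X} {q : V} (h : Φ =ᶠ[𝓝 q] Ψ) :
    pullMetric g Φ q = pullMetric g Ψ q := by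
  rw [pullMetric, pullMetric, dparam_congr h, h.self_of_nhds]

theorem pullMetric_comp (g : BilinField n X) {V' : Type*} [NormedAddCommGroup V']
    [NormedSpace ℝ V'] {Φ : V' → X}
    {τ : V → V'} {q : V} (hΦ : MDifferentiableAt 𝓘(ℝ, V') (𝓡∂ (n + 1)) Φ (τ q))
    (hτ : DifferentiableAt ℝ τ q) (v w : V) :
    pullMetric g (Φ ∘ τ) q v w
      = pullMetric g Φ (τ q) (fderiv ℝ τ q v) (fderiv ℝ τ q w) := by
  simp only [pullMetric_apply, dparam_comp hΦ hτ]
  rfl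

theorem isOpen_interior_manifold : IsOpen ((𝓡∂ (n + 1)).interior X) :=
  ModelWithCorners.isOpen_interior (n := ∞) (by simp)

end Parametrization

theorem two_le_infty : (2 : ℕ∞ω) ≤ ∞ := WithTop.coe_le_coe.2 (le_top : (2 : ℕ∞) ≤ ⊤)

/-! ### Smooth vector fields under smooth maps -/

section Pushforward

variable {EN HN N EM HM M EP HP P : Type*}
  [NormedAddCommGroup EN] [NormedSpace ℝ EN] [TopologicalSpace HN] {IN : ModelWithCorners ℝ EN HN}
  [TopologicalSpace N] [ChartedSpace HN N] [IsManifold IN ∞ N]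
  [NormedAddCommGroup EM] [NormedSpace ℝ EM] [TopologicalSpace HM] {IM : ModelWithCorners ℝ EM HM}
  [TopologicalSpace M] [ChartedSpace HM M] [IsManifold IM ∞ M]
  [NormedAddCommGroup EP] [NormedSpace ℝ EP] [TopologicalSpace HP] {IP : ModelWithCorners ℝ EP HP}
  [TopologicalSpace P] [ChartedSpace HP P]

theorem contMDiffOn_pushforward {Ψ : N → M} {S : Set N} (hΨ : ContMDiffOn IN IM ∞ Ψ S)
    (hS : UniqueMDiffOn IN S) {ψ : P → N} {U : Set P} {ν : (q : P) → TangentSpace IN (ψ q)}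
    (hν : ContMDiffOn IP IN.tangent ∞ (fun q => (⟨ψ q, ν q⟩ : TangentBundle IN N)) U)
    (hm : MapsTo ψ U S) :
    ContMDiffOn IP IM.tangent ∞ (fun q => (⟨Ψ (ψ q), mfderivWithin IN IM Ψ S (ψ q) (ν q)⟩ :
      TangentBundle IM M)) U := by
  have : IsManifold IN 1 N := IsManifold.of_le (n := ∞) (by simp)
  have : IsManifold IM 1 M := IsManifold.of_le (n := ∞) (by simp)
  exact (hΨ.contMDiffOn_tangentMapWithin (m := ∞) (by simp) hS).comp hν fun q hq => hm hq

theorem contMDiffOn_vectorSpace_section {V : Type*} [NormedAddCommGroup V] [NormedSpace ℝ V]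
    {ψ ν : P → V} {U : Set P} (hψ : ContMDiffOn IP 𝓘(ℝ, V) ∞ ψ U)
    (hν : ContMDiffOn IP 𝓘(ℝ, V) ∞ ν U) :
    ContMDiffOn IP 𝓘(ℝ, V).tangent ∞ (fun q => (⟨ψ q, ν q⟩ : TangentBundle 𝓘(ℝ, V) V)) U := by
  intro q hq
  rw [Bundle.contMDiffWithinAt_totalSpace]
  refine ⟨hψ q hq, ?_⟩
  simpa using hν q hq

end Pushforward

/-! ### Smoothness of pulled-back metrics and chart-independence of the Laplacian -/

section Parametrization

variable {n : ℕ} {X : Type*}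
  [TopologicalSpace X] [ChartedSpace (EuclideanHalfSpace (n + 1)) X]
  [IsManifold (𝓡∂ (n + 1)) ∞ X]
  {V : Type*} [NormedAddCommGroup V] [NormedSpace ℝ V]

theorem contMDiffOn_dparam {Φ : V → X} {Ω : Set V} (hΩ : IsOpen Ω)
    (hΦ : ContMDiffOn 𝓘(ℝ, V) (𝓡∂ (n + 1)) ∞ Φ Ω) {P EP HP : Type*} [NormedAddCommGroup EP]
    [NormedSpace ℝ EP] [TopologicalSpace HP] {IP : ModelWithCorners ℝ EP HP}
    [TopologicalSpace P] [ChartedSpace HP P] {ψ ν : P → V} {U : Set P}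
    (hψ : ContMDiffOn IP 𝓘(ℝ, V) ∞ ψ U) (hν : ContMDiffOn IP 𝓘(ℝ, V) ∞ ν U)
    (hm : MapsTo ψ U Ω) :
    ContMDiffOn IP (𝓡∂ (n + 1)).tangent ∞
      (fun q => (⟨Φ (ψ q), dparam Φ (ψ q) (ν q)⟩ : TangentBundle (𝓡∂ (n + 1)) X)) U := by
  refine (contMDiffOn_pushforward hΦ hΩ.uniqueMDiffOn
    (contMDiffOn_vectorSpace_section hψ hν) hm).congr fun q hq => ?_
  rw [mfderivWithin_of_isOpen hΩ (hm hq)]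
  rfl

/-- In finite dimensions it is enough to test on constant vectors v, w. Their images under dΦ are
smooth fields along Φ, and the bundle-valued smoothness of `g` then applies. -/
theorem contDiffOn_pullMetric [FiniteDimensional ℝ V] {g : BilinField n X}
    (hg : IsRiemannianInside g) {Φ : V → X} {Ω : Set V} (hΩ : IsOpen Ω)
    (hΦ : ContMDiffOn 𝓘(ℝ, V) (𝓡∂ (n + 1)) ∞ Φ Ω)
    (hint : MapsTo Φ Ω ((𝓡∂ (n + 1)).interior X)) :
    ContDiffOn ℝ ∞ (pullMetric g Φ) Ω := by
  refine contDiffOn_clm_apply.2 fun v => contDiffOn_clm_apply.2 fun w => ?_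
  have hG := hg.smooth.comp hΦ hint
  have hvec : ∀ v : V, ContMDiffOn 𝓘(ℝ, V) (𝓡∂ (n + 1)).tangent ∞
      (fun q => (⟨Φ q, dparam Φ q v⟩ : TangentBundle (𝓡∂ (n + 1)) X)) Ω := fun v =>
    contMDiffOn_dparam hΩ hΦ contMDiffOn_id contMDiffOn_const (mapsTo_id _)
  have := ContMDiffOn.clm_bundle_apply₂ (F₃ := ℝ) (E₃ := Bundle.Trivial X ℝ) hG (hvec v) (hvec w)
  rw [← contMDiffOn_iff_contDiffOn]
  intro q hq
  have h1 := this q hq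
  rw [Bundle.contMDiffWithinAt_totalSpace] at h1
  exact h1.2

/-- The inverse of the chart at an interior point. -/
theorem exists_isOpen_chart {x : X} (hx : x ∈ (𝓡∂ (n + 1)).interior X) :
    ∃ Ω : Set (EuclideanSpace ℝ (Fin (n + 1))), IsOpen Ω ∧ extChartAt (𝓡∂ (n + 1)) x x ∈ Ω ∧
      Ω ⊆ (extChartAt (𝓡∂ (n + 1)) x).target ∧
      (∀ y ∈ Ω, range (𝓡∂ (n + 1)) ∈ 𝓝 y) ∧
      MapsTo (extChartAt (𝓡∂ (n + 1)) x).symm Ω ((𝓡∂ (n + 1)).interior X) ∧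
      ContMDiffOn 𝓘(ℝ, EuclideanSpace ℝ (Fin (n + 1))) (𝓡∂ (n + 1)) ∞
        (extChartAt (𝓡∂ (n + 1)) x).symm Ω := by
  have h0 : range (𝓡∂ (n + 1)) ∈ 𝓝 (extChartAt (𝓡∂ (n + 1)) x x) := range_mem_nhds_isInteriorPoint hx
  have h1 : (extChartAt (𝓡∂ (n + 1)) x).target ∈ 𝓝 (extChartAt (𝓡∂ (n + 1)) x x) := by
    have := extChartAt_target_mem_nhdsWithin (I := 𝓡∂ (n + 1)) x
    rwa [nhdsWithin_eq_nhds.2 h0] at this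
  have h2 : (extChartAt (𝓡∂ (n + 1)) x).symm ⁻¹' ((𝓡∂ (n + 1)).interior X)
      ∈ 𝓝 (extChartAt (𝓡∂ (n + 1)) x x) := by
    refine (continuousAt_extChartAt_symm x).preimage_mem_nhds ?_
    rw [extChartAt_to_inv]
    exact isOpen_interior_manifold.mem_nhds hx
  obtain ⟨Ω, hΩ, ho, hm⟩ := mem_nhds_iff.1 (inter_mem h1 h2)
  refine ⟨Ω, ho, hm, fun y hy => (hΩ hy).1, fun y hy => ?_, fun y hy => (hΩ hy).2, ?_⟩
  · exact mem_of_superset (ho.mem_nhds hy)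
      fun z hz => extChartAt_target_subset_range x (hΩ hz).1
  · exact (contMDiffOn_extChartAt_symm x).mono fun y hy => (hΩ hy).1


theorem fderiv_ofReal_comp {f : V → ℝ} {y : V} (hf : DifferentiableAt ℝ f y) (v : V) :
    fderiv ℝ (fun z => ((f z : ℝ) : ℂ)) y v = ((fderiv ℝ f y v : ℝ) : ℂ) := by
  have := (Complex.ofRealCLM.hasFDerivAt.comp y hf.hasFDerivAt).fderiv
  have e : (fun z => ((f z : ℝ) : ℂ)) = Complex.ofRealCLM ∘ f := rfl
  rw [e, this]
  rfl

theorem pullMetric_pos {g : BilinField n X} (hg : IsRiemannianInside g) {Φ : V → X} {p : V}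
    (hp : Φ p ∈ (𝓡∂ (n + 1)).interior X) (hinj : Function.Injective (dparam (n := n) Φ p)) (v : V)
    (hv : v ≠ 0) : 0 < pullMetric g Φ p v v :=
  hg.pos _ hp _ fun h => hv (hinj (h.trans (map_zero _).symm))

theorem injective_dparam_chart {x : X} (hx : x ∈ (𝓡∂ (n + 1)).interior X) :
    Function.Injective (dparam (n := n) (extChartAt (𝓡∂ (n + 1)) x).symm
      (extChartAt (𝓡∂ (n + 1)) x x)) := by
  have h := isInvertible_mfderivWithin_extChartAt_symm (I := 𝓡∂ (n + 1))
    (mem_extChartAt_target (I := 𝓡∂ (n + 1)) x)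
  rw [mfderivWithin_of_mem_nhds (range_mem_nhds_isInteriorPoint hx)] at h
  exact h.injective

/-- The Laplacian of a real function, in the chart used in its definition. -/
theorem laplacian_ofReal_chart {g : BilinField n X} (hg : IsRiemannianInside g) {f : X → ℝ}
    (hf : ContMDiffOn (𝓡∂ (n + 1)) 𝓘(ℝ, ℝ) ∞ f ((𝓡∂ (n + 1)).interior X)) {x : X}
    (hx : x ∈ (𝓡∂ (n + 1)).interior X) {N : EuclideanSpace ℝ (Fin (n + 1))}
    (hN : ∀ z, pullMetric g (extChartAt (𝓡∂ (n + 1)) x).symm (extChartAt (𝓡∂ (n + 1)) x x) N z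
      = fderiv ℝ (f ∘ (extChartAt (𝓡∂ (n + 1)) x).symm) (extChartAt (𝓡∂ (n + 1)) x x) z) :
    laplacian g (fun z => (f z : ℂ)) x =
      ((-traceForm (pullMetric g (extChartAt (𝓡∂ (n + 1)) x).symm (extChartAt (𝓡∂ (n + 1)) x x))
        (hessForm (pullMetric g (extChartAt (𝓡∂ (n + 1)) x).symm)
          (f ∘ (extChartAt (𝓡∂ (n + 1)) x).symm) (extChartAt (𝓡∂ (n + 1)) x x) N)
        (fun i => EuclideanSpace.single i (1 : ℝ)) : ℝ) : ℂ) := by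
  obtain ⟨Ω, hΩ, hy, -, hr, hint, hsm⟩ := exists_isOpen_chart hx
  set y := extChartAt (𝓡∂ (n + 1)) x x with hydef
  set Φ : EuclideanSpace ℝ (Fin (n + 1)) → X := ⇑(extChartAt (𝓡∂ (n + 1)) x).symm with hΦ
  set G := pullMetric g Φ with hG
  set F := f ∘ Φ with hF
  have hGsm : ContDiffOn ℝ ∞ G Ω := contDiffOn_pullMetric hg hΩ hsm hint
  have hFsm : ContDiffOn ℝ ∞ F Ω := (hf.comp hsm hint).contDiffOn
  have hGd : ∀ v w, DifferentiableAt ℝ (fun z => G z v w) y := fun v w =>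
    (((hGsm.contDiffAt (hΩ.mem_nhds hy)).differentiableAt (by simp)).clm_apply
      (differentiableAt_const v)).clm_apply (differentiableAt_const w)
  have hM : ∀ z ∈ Ω, metricMatrix g x z = gram (G z) (fun i => EuclideanSpace.single i (1 : ℝ)) := by
    intro z hz
    ext i j
    simp only [metricMatrix, coordField, gram, Matrix.of_apply]
    rw [mfderivWithin_of_mem_nhds (hr z hz)]
    rfl
  have hMe : ∀ i j, (fun z => metricMatrix g x z i j) =ᶠ[𝓝 y]
      fun z => G z (EuclideanSpace.single i 1) (EuclideanSpace.single j 1) := by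
    intro i j
    filter_upwards [hΩ.mem_nhds hy] with z hz
    rw [hM z hz]
    rfl
  have hpdM : ∀ k i j, pd k (fun z => metricMatrix g x z i j) y = fderiv ℝ (fun z =>
      G z (EuclideanSpace.single i 1) (EuclideanSpace.single j 1)) y (EuclideanSpace.single k 1) := by
    intro k i j
    rw [pd, (hMe i j).fderiv_eq]
  have hpd1 : ∀ k, ∀ z ∈ Ω, pd k (fun z => ((F z : ℝ) : ℂ)) z
      = ((fderiv ℝ F z (EuclideanSpace.single k 1) : ℝ) : ℂ) := fun k z hz =>
    fderiv_ofReal_comp ((hFsm.contDiffAt (hΩ.mem_nhds hz)).differentiableAt (by simp)) _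
  have hF2 : DifferentiableAt ℝ (fderiv ℝ F) y :=
    ((hFsm.contDiffAt (hΩ.mem_nhds hy)).fderiv_right (m := 1)
      (WithTop.coe_le_coe.2 (le_top : (1 + 1 : ℕ∞) ≤ ⊤))).differentiableAt (by norm_num)
  have hpd2 : ∀ i j, pd i (pd j (fun z => ((F z : ℝ) : ℂ))) y
      = ((fderiv ℝ (fun z => fderiv ℝ F z (EuclideanSpace.single j 1)) y
        (EuclideanSpace.single i 1) : ℝ) : ℂ) := by
    intro i j
    have e : pd j (fun z => ((F z : ℝ) : ℂ)) =ᶠ[𝓝 y]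
        fun z => ((fderiv ℝ F z (EuclideanSpace.single j 1) : ℝ) : ℂ) := by
      filter_upwards [hΩ.mem_nhds hy] with z hz using hpd1 j z hz
    rw [pd, e.fderiv_eq, fderiv_ofReal_comp (hF2.clm_apply (differentiableAt_const _))]
  have hN1 : N = ∑ l, N l • EuclideanSpace.single l (1 : ℝ) := by
    ext i
    simp [Finset.sum_apply, Pi.single_apply]
  have hdet : IsUnit (gram (G y) fun i => EuclideanSpace.single i (1 : ℝ)).det := by
    have := isUnit_det_gram (pullMetric_pos hg (hint hy) (injective_dparam_chart hx))
      (EuclideanSpace.basisFun (Fin (n + 1)) ℝ).toBasis.linearIndependent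
    convert this using 3
    funext i
    simp
  set M := gram (G y) fun i => EuclideanSpace.single i (1 : ℝ) with hMdef
  -- Raising the index of df gives the gradient: this removes the inverse metric from the
  -- Christoffel symbols.
  have hNl : ∀ l, ∑ k, M⁻¹ k l * G y N (EuclideanSpace.single k 1) = N l := by
    intro l
    have h1 : ∀ k, G y N (EuclideanSpace.single k 1) = Matrix.vecMul N M k := by
      intro k
      conv_lhs => rw [hN1]
      simp [Matrix.vecMul, dotProduct, hMdef, gram]
    calc ∑ k, M⁻¹ k l * G y N (EuclideanSpace.single k 1)
        = Matrix.vecMul (Matrix.vecMul N M) M⁻¹ l := by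
          simp only [h1]
          simp only [Matrix.vecMul, dotProduct, mul_comm]
      _ = N l := by rw [Matrix.vecMul_vecMul, Matrix.mul_nonsing_inv _ hdet, Matrix.vecMul_one]
  have hdN : ∀ v w, fderiv ℝ (fun q => G q v N) y w
      = ∑ l, N l * fderiv ℝ (fun q => G q v (EuclideanSpace.single l 1)) y w := by
    intro v w
    have e : (fun q => G q v N) = fun q => ∑ l, N l * G q v (EuclideanSpace.single l 1) := by
      funext q
      conv_lhs => rw [hN1]
      simp
    rw [e, fderiv_fun_sum fun l _ => (hGd _ _).const_mul _]
    simp only [sum_apply]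
    refine Finset.sum_congr rfl fun l _ => ?_
    rw [fderiv_const_mul (hGd _ _)]
    simp
  have hdN' : ∀ v w, fderiv ℝ (fun q => G q v w) y N
      = ∑ l, N l * fderiv ℝ (fun q => G q v w) y (EuclideanSpace.single l 1) := by
    intro v w
    conv_lhs => rw [hN1]
    simp
  -- Contracted with df, the Christoffel symbols become the three derivatives of the metric with `N`
  -- in one slot, that is, the correction term in `hessForm`.
  have hchr : ∀ i j, ∑ k, christoffel g x k i j y * fderiv ℝ F y (EuclideanSpace.single k 1)
      = (1 / 2) * (fderiv ℝ (fun q => G q (EuclideanSpace.single j 1) N) y (EuclideanSpace.single i 1)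
        + fderiv ℝ (fun q => G q (EuclideanSpace.single i 1) N) y (EuclideanSpace.single j 1)
        - fderiv ℝ (fun q => G q (EuclideanSpace.single i 1) (EuclideanSpace.single j 1)) y N) := by
    intro i j
    simp only [christoffel, hpdM, hM y hy, ← hN, ← hMdef, hdN, hdN']
    simp only [← Finset.sum_add_distrib, ← Finset.sum_sub_distrib, Finset.mul_sum, Finset.sum_mul]
    rw [Finset.sum_comm]
    refine Finset.sum_congr rfl fun l _ => ?_
    conv_rhs => rw [← hNl l]
    simp only [Finset.mul_sum, Finset.sum_mul, ← Finset.sum_add_distrib,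
      ← Finset.sum_sub_distrib]
    refine Finset.sum_congr rfl fun k _ => ?_
    ring
  have hlap : laplacian g (fun z => (f z : ℂ)) x = ∑ i, ∑ j, -((((metricMatrix g x y)⁻¹ i j : ℝ) : ℂ) *
      (pd i (pd j fun z => ((F z : ℝ) : ℂ)) y
        - ∑ k, (christoffel g x k i j y : ℂ) * pd k (fun z => ((F z : ℝ) : ℂ)) y)) := rfl
  rw [hlap]
  simp only [hpd2, hpd1 _ y hy, hM y hy]
  simp only [← Complex.ofReal_mul, ← Complex.ofReal_sum, hchr, ← Complex.ofReal_sub,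
    ← Complex.ofReal_neg]
  simp only [traceForm, hessForm, Finset.sum_neg_distrib, ← hMdef]

/-- The Laplacian of a real function, in an arbitrary parametrization and an arbitrary basis. -/
theorem laplacian_ofReal_param {g : BilinField n X} (hg : IsRiemannianInside g) {f : X → ℝ}
    (hf : ContMDiffOn (𝓡∂ (n + 1)) 𝓘(ℝ, ℝ) ∞ f ((𝓡∂ (n + 1)).interior X))
    {Φ : V → X} {Ω : Set V} (hΩ : IsOpen Ω) (hΦ : ContMDiffOn 𝓘(ℝ, V) (𝓡∂ (n + 1)) ∞ Φ Ω)
    (hint : MapsTo Φ Ω ((𝓡∂ (n + 1)).interior X)) {p : V} (hp : p ∈ Ω)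
    (hbij : Function.Bijective (dparam (n := n) Φ p)) {N : V}
    (hN : ∀ z, pullMetric g Φ p N z = fderiv ℝ (f ∘ Φ) p z)
    {ι : Type*} [Fintype ι] [DecidableEq ι] (b : Module.Basis ι ℝ V) :
    laplacian g (fun z => (f z : ℂ)) (Φ p) =
      ((-traceForm (pullMetric g Φ p) (hessForm (pullMetric g Φ) (f ∘ Φ) p N) b : ℝ) : ℂ) := by
  set x := Φ p with hxdef
  have hx : x ∈ (𝓡∂ (n + 1)).interior X := hint hp
  obtain ⟨Ω₀, hΩ₀, hy, htgt, hr, hint₀, hsm⟩ := exists_isOpen_chart hx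
  set y := extChartAt (𝓡∂ (n + 1)) x x with hydef
  set Φ₀ : EuclideanSpace ℝ (Fin (n + 1)) → X := ⇑(extChartAt (𝓡∂ (n + 1)) x).symm with hΦ₀
  -- The transition map from `Φ` to the chart used in the definition at `x`. Near `p` one has Φ = Φ₀
  -- ∘ τ, so the two Hessians are related by `hessForm_pullback`.
  set τ : V → EuclideanSpace ℝ (Fin (n + 1)) := extChartAt (𝓡∂ (n + 1)) x ∘ Φ with hτdef
  have hτy : τ p = y := rfl
  have hΦp := hΦ.contMDiffAt (hΩ.mem_nhds hp)
  have hτs : ContDiffAt ℝ ∞ τ p :=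
    (ContMDiffAt.comp p (contMDiffAt_extChartAt (x := x)) hΦp).contDiffAt
  have hsrc : Φ ⁻¹' (extChartAt (𝓡∂ (n + 1)) x).source ∈ 𝓝 p :=
    hΦp.continuousAt.preimage_mem_nhds (extChartAt_source_mem_nhds x)
  have hcomp : Φ =ᶠ[𝓝 p] Φ₀ ∘ τ := by
    filter_upwards [hsrc] with q hq
    exact ((extChartAt (𝓡∂ (n + 1)) x).left_inv hq).symm
  have hτΩ : ∀ᶠ q in 𝓝 p, τ q ∈ Ω₀ := hτs.continuousAt.preimage_mem_nhds (hΩ₀.mem_nhds hy)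
  have hΦ₀d : ∀ z ∈ Ω₀, MDifferentiableAt 𝓘(ℝ, EuclideanSpace ℝ (Fin (n + 1))) (𝓡∂ (n + 1)) Φ₀ z :=
    fun z hz => (hsm.contMDiffAt (hΩ₀.mem_nhds hz)).mdifferentiableAt (by simp)
  have hτd : ∀ᶠ q in 𝓝 p, DifferentiableAt ℝ τ q :=
    ((hτs.of_le (m := 1) (by simp)).eventually (by simp)).mono
      fun q hq => hq.differentiableAt (by norm_num)
  have hpull : ∀ᶠ q in 𝓝 p, ∀ v w, pullMetric g Φ q v w
      = pullMetric g Φ₀ (τ q) (fderiv ℝ τ q v) (fderiv ℝ τ q w) := by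
    filter_upwards [hcomp.eventuallyEq_nhds, hτΩ, hτd] with q h1 h2 h3 v w
    rw [pullMetric_congr g h1, pullMetric_comp g (hΦ₀d _ h2) h3]
  have hdp : dparam (n := n) Φ p = (dparam Φ₀ y).comp (fderiv ℝ τ p) := by
    rw [dparam_congr hcomp, dparam_comp (hΦ₀d _ hy) hτd.self_of_nhds, hτy]
  have hinj₀ : Function.Injective (dparam (n := n) Φ₀ y) := injective_dparam_chart hx
  have hτbij : Function.Bijective (fderiv ℝ τ p) := by
    constructor
    · intro v w hvw
      apply hbij.1
      simp only [hdp, ContinuousLinearMap.comp_apply, hvw]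
    · intro z
      obtain ⟨v, hv⟩ := hbij.2 (dparam Φ₀ y z)
      refine ⟨v, hinj₀ ?_⟩
      rw [← hv, hdp]
      rfl
  have hFG : f ∘ Φ =ᶠ[𝓝 p] (f ∘ Φ₀) ∘ τ := by
    filter_upwards [hcomp] with q hq
    simp [hq]
  have hG₀ : ContDiffOn ℝ ∞ (pullMetric g Φ₀) Ω₀ := contDiffOn_pullMetric hg hΩ₀ hsm hint₀
  have hF₀ : ContDiffOn ℝ ∞ (f ∘ Φ₀) Ω₀ := (hf.comp hsm hint₀).contDiffOn
  have hG₀d : DifferentiableAt ℝ (pullMetric g Φ₀) y :=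
    (hG₀.contDiffAt (hΩ₀.mem_nhds hy)).differentiableAt (by simp)
  have hF₀2 : ContDiffAt ℝ 2 (f ∘ Φ₀) y :=
    (hF₀.contDiffAt (hΩ₀.mem_nhds hy)).of_le two_le_infty
  have hsymm : ∀ v w, pullMetric g Φ₀ y v w = pullMetric g Φ₀ y w v := fun v w =>
    hg.symm _ (hint₀ hy) _ _
  have hN₀ : ∀ z, pullMetric g Φ₀ y (fderiv ℝ τ p N) z = fderiv ℝ (f ∘ Φ₀) y z := by
    intro z
    obtain ⟨v, rfl⟩ := hτbij.2 z
    rw [← hτy, ← hpull.self_of_nhds, hN, hFG.fderiv_eq,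
      fderiv_comp p (by rw [hτy]; exact hF₀2.differentiableAt (by norm_num)) hτd.self_of_nhds]
    rfl
  have hhess : ∀ v w, hessForm (pullMetric g Φ) (f ∘ Φ) p N v w
      = hessForm (pullMetric g Φ₀) (f ∘ Φ₀) y (fderiv ℝ τ p N) (fderiv ℝ τ p v) (fderiv ℝ τ p w) :=
    hessForm_pullback (hτs.of_le two_le_infty) hG₀d hF₀2 hpull hFG hsymm hN₀
  rw [laplacian_ofReal_chart hg hf hx (N := fderiv ℝ τ p N) hN₀]
  congr 2
  obtain ⟨B, hB⟩ := exists_bilin_hessForm hG₀d hF₀2 (fderiv ℝ τ p N)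
  -- The basis `b` transported by dτ. Its Gram matrix for the chart metric equals that of `b` for
  -- the pulled-back metric, and `traceForm_basis` passes from it to the standard basis.
  let c : Module.Basis ι ℝ (EuclideanSpace ℝ (Fin (n + 1))) :=
    b.map (LinearEquiv.ofBijective (fderiv ℝ τ p).toLinearMap hτbij)
  have hc : ∀ i, c i = fderiv ℝ τ p (b i) := fun i => by simp [c]
  have hb₀ : (fun i => EuclideanSpace.single i (1 : ℝ))
      = ⇑(EuclideanSpace.basisFun (Fin (n + 1)) ℝ).toBasis := by
    funext i
    simp
  have h1 := traceForm_basis (pullMetric g Φ₀ y) B c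
    (EuclideanSpace.basisFun (Fin (n + 1)) ℝ).toBasis
    (isUnit_det_gram (pullMetric_pos hg (hint₀ hy) hinj₀) (Module.Basis.linearIndependent _))
  have h2 : (fun v w => B v w) = hessForm (pullMetric g Φ₀) (f ∘ Φ₀) y (fderiv ℝ τ p N) := by
    funext v w
    exact hB v w
  rw [h2, ← hb₀] at h1
  rw [← h1]
  have h3 : gram (pullMetric g Φ₀ y) c = gram (pullMetric g Φ p) b := by
    ext i j
    simp only [gram, Matrix.of_apply, hc, ← hτy]
    exact (hpull.self_of_nhds _ _).symm
  simp only [traceForm, h3, hc, hhess]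

end Parametrization
end AsympConic

end

noncomputable section
namespace AsympConic

set_option linter.unusedSectionVars false

/-! ## Smooth inverses -/

section Inverse

variable {V : Type*} [NormedAddCommGroup V] [NormedSpace ℝ V] [FiniteDimensional ℝ V]
  {D : Type*} [NormedAddCommGroup D] [NormedSpace ℝ D] {s : Set D}

theorem isInvertible_of_pos {B : V →L[ℝ] V →L[ℝ] ℝ} (hB : ∀ v, v ≠ 0 → 0 < B v v) :
    B.IsInvertible := by
  have hinj : Function.Injective B := by
    refine (injective_iff_map_eq_zero B).2 fun v hv => ?_
    by_contra h
    have := hB v h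
    simp [hv] at this
  have hdim : Module.finrank ℝ V = Module.finrank ℝ (V →L[ℝ] ℝ) := by
    rw [← LinearMap.toContinuousLinearMap.finrank_eq]
    exact (Subspace.dual_finrank_eq (K := ℝ) (V := V)).symm
  let e : V ≃ₗ[ℝ] (V →L[ℝ] ℝ) := LinearEquiv.ofInjectiveOfFinrankEq B.toLinearMap hinj hdim
  exact ⟨e.toContinuousLinearEquiv, by ext; rfl⟩

theorem apply_inverse_of_pos {B : V →L[ℝ] V →L[ℝ] ℝ} (hB : ∀ v, v ≠ 0 → 0 < B v v)
    (ℓ : V →L[ℝ] ℝ) : B (B.inverse ℓ) = ℓ :=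
  (isInvertible_of_pos hB).self_apply_inverse ℓ

theorem eq_inverse_of_pos {B : V →L[ℝ] V →L[ℝ] ℝ} (hB : ∀ v, v ≠ 0 → 0 < B v v)
    {ℓ : V →L[ℝ] ℝ} {v : V} (h : B v = ℓ) : v = B.inverse ℓ := by
  rw [← h, (isInvertible_of_pos hB).inverse_apply_self]

/-- Positivity makes `B p` injective from V to its dual, hence invertible by dimension, and
inversion of operators is smooth at invertible ones. No openness of `s` is used. -/
theorem contDiffOn_inverse_apply {B : D → V →L[ℝ] V →L[ℝ] ℝ} {ℓ : D → V →L[ℝ] ℝ}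
    (hBs : ContDiffOn ℝ ∞ B s) (hℓ : ContDiffOn ℝ ∞ ℓ s)
    (hB : ∀ p ∈ s, ∀ v, v ≠ 0 → 0 < B p v v) :
    ContDiffOn ℝ ∞ (fun p => (B p).inverse (ℓ p)) s := by
  intro p hp
  obtain ⟨e, he⟩ := isInvertible_of_pos (hB p hp)
  have h1 : ContDiffAt ℝ ∞ ContinuousLinearMap.inverse (B p) := by
    rw [← he]
    exact contDiffAt_map_inverse e
  exact (h1.comp_contDiffWithinAt p (hBs p hp)).clm_apply (hℓ p hp)

theorem contDiffOn_det {ι : Type*} [Fintype ι] [DecidableEq ι] {M : D → Matrix ι ι ℝ}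
    (hM : ∀ i j, ContDiffOn ℝ ∞ (fun p => M p i j) s) : ContDiffOn ℝ ∞ (fun p => (M p).det) s := by
  simp only [Matrix.det_apply]
  exact ContDiffOn.sum fun σ _ => (contDiffOn_prod fun i _ => hM _ _).const_smul _

theorem contDiffOn_matrix_inv {ι : Type*} [Fintype ι] [DecidableEq ι] {M : D → Matrix ι ι ℝ}
    (hM : ∀ i j, ContDiffOn ℝ ∞ (fun p => M p i j) s) (hdet : ∀ p ∈ s, IsUnit (M p).det) (i j : ι) :
    ContDiffOn ℝ ∞ (fun p => (M p)⁻¹ i j) s := by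
  have h1 : ContDiffOn ℝ ∞ (fun p => (M p).adjugate i j) s := by
    simp only [Matrix.adjugate_apply]
    refine contDiffOn_det fun k l => ?_
    by_cases h : k = j
    · subst h
      simp only [Matrix.updateRow_self]
      exact contDiffOn_const
    · simp only [Matrix.updateRow_ne h]
      exact hM k l
  have h2 := ((contDiffOn_det hM).inv fun p hp => (hdet p hp).ne_zero).mul h1
  refine h2.congr fun p hp => ?_
  simp [Matrix.inv_def, Matrix.smul_apply]

/-- The trace of a bilinear form of rank one. -/
theorem sum_inv_gram_mul {ι : Type*} [Fintype ι] [DecidableEq ι] (G : V →L[ℝ] V →L[ℝ] ℝ)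
    (b : Module.Basis ι ℝ V) (hdet : IsUnit (gram G b).det) (N : V) (l : ι) :
    ∑ k, (gram G b)⁻¹ k l * G N (b k) = b.repr N l := by
  have h1 : ∀ k, G N (b k) = Matrix.vecMul (b.repr N) (gram G b) k := by
    intro k
    conv_lhs => rw [← b.sum_repr N]
    simp only [map_sum, map_smul, sum_apply, smul_apply, smul_eq_mul, Matrix.vecMul, dotProduct,
      gram, Matrix.of_apply]
  calc ∑ k, (gram G b)⁻¹ k l * G N (b k)
      = Matrix.vecMul (Matrix.vecMul (b.repr N) (gram G b)) (gram G b)⁻¹ l := by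
        simp only [h1]
        simp only [Matrix.vecMul, dotProduct, mul_comm]
    _ = b.repr N l := by rw [Matrix.vecMul_vecMul, Matrix.mul_nonsing_inv _ hdet, Matrix.vecMul_one]

/-- The trace of the Hessian is smooth. -/
theorem contDiffOn_trace_hessForm {ι : Type*} [Fintype ι] [DecidableEq ι] {Ω : Set V}
    (hΩ : IsOpen Ω) {G : V → V →L[ℝ] V →L[ℝ] ℝ} (hG : ContDiffOn ℝ ∞ G Ω) {f : V → ℝ}
    (hf : ContDiffOn ℝ ∞ f Ω) {ν : V → V} (hν : ContDiffOn ℝ ∞ ν Ω) (b : Module.Basis ι ℝ V)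
    (hpos : ∀ p ∈ Ω, ∀ v, v ≠ 0 → 0 < G p v v) :
    ContDiffOn ℝ ∞ (fun p => traceForm (G p) (hessForm G f p (ν p)) b) Ω := by
  have hle : (∞ : ℕ∞ω) + 1 ≤ ∞ := by simp
  have hGe : ∀ v w, ContDiffOn ℝ ∞ (fun p => G p v w) Ω := fun v w =>
    (hG.clm_apply contDiffOn_const).clm_apply contDiffOn_const
  have hdG : ∀ v w, ContDiffOn ℝ ∞ (fderiv ℝ (fun q => G q v w)) Ω := fun v w =>
    (hGe v w).fderiv_of_isOpen hΩ hle
  have hdN : ∀ v w, ContDiffOn ℝ ∞ (fun p => fderiv ℝ (fun q => G q v (ν p)) p w) Ω := by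
    intro v w
    -- The vector ν(p) is frozen while the metric is differentiated. Expanding it in a basis moves
    -- the frozen coefficients outside the derivative, after which each factor is visibly smooth in
    -- p.
    have : ContDiffOn ℝ ∞ (fun p => ∑ l, b.repr (ν p) l * fderiv ℝ (fun q => G q v (b l)) p w) Ω :=
      ContDiffOn.sum fun l _ =>
        (((b.coord l).toContinuousLinearMap.contDiff.comp_contDiffOn hν)).mul
          ((hdG v (b l)).clm_apply contDiffOn_const)
    refine this.congr fun p hp => ?_
    have e : (fun q => G q v (ν p)) = fun q => ∑ l, b.repr (ν p) l * G q v (b l) := by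
      funext q
      conv_lhs => rw [← b.sum_repr (ν p)]
      simp only [map_sum, map_smul, smul_eq_mul]
    have hd : ∀ l, DifferentiableAt ℝ (fun q => G q v (b l)) p := fun l =>
      ((hGe v (b l)).contDiffAt (hΩ.mem_nhds hp)).differentiableAt (by simp)
    rw [e, fderiv_fun_sum fun l _ => (hd l).const_mul _]
    simp only [sum_apply]
    refine Finset.sum_congr rfl fun l _ => ?_
    rw [fderiv_const_mul (hd l)]
    simp
  refine ContDiffOn.sum fun i _ => ContDiffOn.sum fun j _ => ContDiffOn.mul ?_ ?_
  · exact contDiffOn_matrix_inv (fun i j => hGe _ _)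
      (fun p hp => isUnit_det_gram (hpos p hp) b.linearIndependent) i j
  · have h1 : ContDiffOn ℝ ∞ (fun p => fderiv ℝ (fun q => fderiv ℝ f q (b j)) p (b i)) Ω :=
      (((hf.fderiv_of_isOpen hΩ hle).clm_apply contDiffOn_const).fderiv_of_isOpen hΩ hle).clm_apply
        contDiffOn_const
    exact h1.sub (contDiffOn_const.mul (((hdN _ _).add (hdN _ _)).sub ((hdG _ _).clm_apply hν)))

end Inverse

/-! ## Gradients -/

section Gradient

variable {n : ℕ} {X : Type*}
  [TopologicalSpace X] [ChartedSpace (EuclideanHalfSpace (n + 1)) X]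
  [IsManifold (𝓡∂ (n + 1)) ∞ X]
  {V : Type*} [NormedAddCommGroup V] [NormedSpace ℝ V]

/-- The differential of a function, as a form on the model space. -/
def dfun {F : Type*} [NormedAddCommGroup F] [NormedSpace ℝ F] (f : X → F) (x : X) :
    EuclideanSpace ℝ (Fin (n + 1)) →L[ℝ] F :=
  mfderiv (𝓡∂ (n + 1)) 𝓘(ℝ, F) f x

theorem fderiv_comp_param {F : Type*} [NormedAddCommGroup F] [NormedSpace ℝ F] {f : X → F}
    {Φ : V → X} {p : V} (hf : MDifferentiableAt (𝓡∂ (n + 1)) 𝓘(ℝ, F) f (Φ p))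
    (hΦ : MDifferentiableAt 𝓘(ℝ, V) (𝓡∂ (n + 1)) Φ p) (v : V) :
    fderiv ℝ (f ∘ Φ) p v = dfun f (Φ p) (dparam (n := n) Φ p v) := by
  have := mfderiv_comp p hf hΦ
  rw [mfderiv_eq_fderiv] at this
  rw [this]
  rfl

/-- The gradient of a real function. -/
def gradField (g : BilinField n X) (f : X → ℝ) (x : X) : TangentSpace (𝓡∂ (n + 1)) x :=
  (bilinAt g x).inverse (dfun f x)

theorem bilinAt_pos {g : BilinField n X} (hg : IsRiemannianInside g) {x : X}
    (hx : x ∈ (𝓡∂ (n + 1)).interior X) : ∀ v, v ≠ 0 → 0 < bilinAt g x v v :=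
  fun v hv => hg.pos x hx v hv

/-- The gradient in a parametrization. -/
theorem gradField_param {g : BilinField n X} (hg : IsRiemannianInside g) {f : X → ℝ}
    {Φ : V → X} {p : V}
    (hf : MDifferentiableAt (𝓡∂ (n + 1)) 𝓘(ℝ, ℝ) f (Φ p))
    (hΦ : MDifferentiableAt 𝓘(ℝ, V) (𝓡∂ (n + 1)) Φ p)
    (hp : Φ p ∈ (𝓡∂ (n + 1)).interior X)
    (hbij : Function.Bijective (dparam (n := n) Φ p)) {N : V}
    (hN : ∀ z, pullMetric g Φ p N z = fderiv ℝ (f ∘ Φ) p z) :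
    dparam (n := n) Φ p N = gradField g f (Φ p) := by
  refine eq_inverse_of_pos (bilinAt_pos hg hp) ?_
  ext z
  obtain ⟨v, rfl⟩ := hbij.2 z
  rw [← fderiv_comp_param hf hΦ, ← hN, pullMetric_apply]

/-- All tangent spaces are definitionally the model space, so vectors over base points that are only
provably equal can be compared there. -/
theorem totalSpace_mk_congr {E H M : Type*} [NormedAddCommGroup E] [NormedSpace ℝ E]
    [TopologicalSpace H] {I : ModelWithCorners ℝ E H} [TopologicalSpace M] [ChartedSpace H M]
    {x y : M} (h : x = y) {v : TangentSpace I x} {w : TangentSpace I y}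
    (hvw : (show E from v) = (show E from w)) :
    (⟨x, v⟩ : TangentBundle I M) = ⟨y, w⟩ := by
  subst h
  exact congrArg _ hvw

theorem bijective_dparam_chart {x : X} (hx : x ∈ (𝓡∂ (n + 1)).interior X) :
    ∃ Ω : Set (EuclideanSpace ℝ (Fin (n + 1))), IsOpen Ω ∧ extChartAt (𝓡∂ (n + 1)) x x ∈ Ω ∧
      Ω ⊆ (extChartAt (𝓡∂ (n + 1)) x).target ∧
      MapsTo (extChartAt (𝓡∂ (n + 1)) x).symm Ω ((𝓡∂ (n + 1)).interior X) ∧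
      ContMDiffOn 𝓘(ℝ, EuclideanSpace ℝ (Fin (n + 1))) (𝓡∂ (n + 1)) ∞
        (extChartAt (𝓡∂ (n + 1)) x).symm Ω ∧
      ∀ y ∈ Ω, Function.Bijective (dparam (n := n) (extChartAt (𝓡∂ (n + 1)) x).symm y) := by
  obtain ⟨Ω, h1, h2, h3, h4, h5, h6⟩ := exists_isOpen_chart hx
  refine ⟨Ω, h1, h2, h3, h5, h6, fun y hy => ?_⟩
  have h := isInvertible_mfderivWithin_extChartAt_symm (I := 𝓡∂ (n + 1)) (h3 hy)
  rw [mfderivWithin_of_mem_nhds (h4 y hy)] at h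
  exact h.bijective


theorem mdifferentiableAt_of_interior {F : Type*} [NormedAddCommGroup F] [NormedSpace ℝ F]
    {f : X → F} (hf : ContMDiffOn (𝓡∂ (n + 1)) 𝓘(ℝ, F) ∞ f ((𝓡∂ (n + 1)).interior X)) {x : X}
    (hx : x ∈ (𝓡∂ (n + 1)).interior X) : MDifferentiableAt (𝓡∂ (n + 1)) 𝓘(ℝ, F) f x :=
  (hf.contMDiffAt (isOpen_interior_manifold.mem_nhds hx)).mdifferentiableAt (by simp)

/-- The gradient in the chart at an interior point. -/
theorem exists_chart_gradField {g : BilinField n X} (hg : IsRiemannianInside g) {f : X → ℝ}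
    (hf : ContMDiffOn (𝓡∂ (n + 1)) 𝓘(ℝ, ℝ) ∞ f ((𝓡∂ (n + 1)).interior X)) {x : X}
    (hx : x ∈ (𝓡∂ (n + 1)).interior X) :
    ∃ (Ω : Set (EuclideanSpace ℝ (Fin (n + 1))))
      (ν : EuclideanSpace ℝ (Fin (n + 1)) → EuclideanSpace ℝ (Fin (n + 1))),
      IsOpen Ω ∧ extChartAt (𝓡∂ (n + 1)) x x ∈ Ω ∧
      MapsTo (extChartAt (𝓡∂ (n + 1)) x).symm Ω ((𝓡∂ (n + 1)).interior X) ∧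
      ContMDiffOn 𝓘(ℝ, EuclideanSpace ℝ (Fin (n + 1))) (𝓡∂ (n + 1)) ∞
        (extChartAt (𝓡∂ (n + 1)) x).symm Ω ∧
      ContDiffOn ℝ ∞ ν Ω ∧
      (∀ y ∈ Ω, Function.Bijective (dparam (n := n) (extChartAt (𝓡∂ (n + 1)) x).symm y)) ∧
      (∀ y ∈ Ω, dparam (n := n) (extChartAt (𝓡∂ (n + 1)) x).symm y (ν y)
        = gradField g f ((extChartAt (𝓡∂ (n + 1)) x).symm y)) ∧
      ∀ y ∈ Ω, ∀ z, pullMetric g (extChartAt (𝓡∂ (n + 1)) x).symm y (ν y) z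
        = fderiv ℝ (f ∘ (extChartAt (𝓡∂ (n + 1)) x).symm) y z := by
  obtain ⟨Ω, h1, h2, h3, h5, h6, h7⟩ := bijective_dparam_chart hx
  have hpos : ∀ y ∈ Ω, ∀ v, v ≠ 0 → 0 < pullMetric g (extChartAt (𝓡∂ (n + 1)) x).symm y v v :=
    fun y hy => pullMetric_pos hg (h5 hy) (h7 y hy).1
  have hF : ContDiffOn ℝ ∞ (f ∘ (extChartAt (𝓡∂ (n + 1)) x).symm) Ω := (hf.comp h6 h5).contDiffOn
  have hN : ∀ y ∈ Ω, ∀ z, pullMetric g (extChartAt (𝓡∂ (n + 1)) x).symm y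
      ((pullMetric g (extChartAt (𝓡∂ (n + 1)) x).symm y).inverse
        (fderiv ℝ (f ∘ (extChartAt (𝓡∂ (n + 1)) x).symm) y)) z
        = fderiv ℝ (f ∘ (extChartAt (𝓡∂ (n + 1)) x).symm) y z := fun y hy z => by
    rw [apply_inverse_of_pos (hpos y hy)]
  refine ⟨Ω, fun y => (pullMetric g (extChartAt (𝓡∂ (n + 1)) x).symm y).inverse
    (fderiv ℝ (f ∘ (extChartAt (𝓡∂ (n + 1)) x).symm) y), h1, h2, h5, h6, ?_, h7, ?_, hN⟩
  · exact contDiffOn_inverse_apply (contDiffOn_pullMetric hg h1 h6 h5)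
      (hF.fderiv_of_isOpen h1 (by simp)) hpos
  · intro y hy
    exact gradField_param hg (mdifferentiableAt_of_interior hf (h5 hy))
      ((h6.contMDiffAt (h1.mem_nhds hy)).mdifferentiableAt (by simp)) (h5 hy) (h7 y hy) (hN y hy)

/-- Near an interior point the gradient is the image, under the inverse of a single chart, of the
coordinate gradient, which is smooth by inversion of the metric. -/
theorem contMDiffOn_gradField {g : BilinField n X} (hg : IsRiemannianInside g) {f : X → ℝ}
    (hf : ContMDiffOn (𝓡∂ (n + 1)) 𝓘(ℝ, ℝ) ∞ f ((𝓡∂ (n + 1)).interior X)) :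
    ContMDiffOn (𝓡∂ (n + 1)) (𝓡∂ (n + 1)).tangent ∞
      (fun x => (⟨x, gradField g f x⟩ : TangentBundle (𝓡∂ (n + 1)) X))
      ((𝓡∂ (n + 1)).interior X) := by
  intro x hx
  obtain ⟨Ω, ν, h1, h2, h3, h4, h5, -, h6, -⟩ := exists_chart_gradField hg hf hx
  set U := (extChartAt (𝓡∂ (n + 1)) x).source ∩ (extChartAt (𝓡∂ (n + 1)) x) ⁻¹' Ω with hU
  have hUo : IsOpen U := (continuousOn_extChartAt x).isOpen_inter_preimage
    (isOpen_extChartAt_source x) h1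
  have hxU : x ∈ U := ⟨mem_extChartAt_source x, h2⟩
  have hψ : ContMDiffOn (𝓡∂ (n + 1)) 𝓘(ℝ, EuclideanSpace ℝ (Fin (n + 1))) ∞
      (extChartAt (𝓡∂ (n + 1)) x) U :=
    contMDiffOn_extChartAt.mono fun z hz => by simpa using hz.1
  have key := contMDiffOn_dparam h1 h4 hψ (h5.contMDiffOn.comp hψ fun z hz => hz.2)
    fun z hz => hz.2
  refine ContMDiffAt.contMDiffWithinAt (ContMDiffOn.contMDiffAt (key.congr fun z hz => ?_)
    (hUo.mem_nhds hxU))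
  have e := (extChartAt (𝓡∂ (n + 1)) x).left_inv hz.1
  refine totalSpace_mk_congr e.symm ?_
  have h7 := h6 _ hz.2
  rw [e] at h7
  exact h7.symm

/-- The definition changes charts from point to point. By `laplacian_ofReal_param` its values near
`x` can all be computed in the chart at `x`, where the trace of the Hessian is smooth. -/
theorem contMDiffOn_laplacian {g : BilinField n X} (hg : IsRiemannianInside g) {f : X → ℝ}
    (hf : ContMDiffOn (𝓡∂ (n + 1)) 𝓘(ℝ, ℝ) ∞ f ((𝓡∂ (n + 1)).interior X)) :
    ContMDiffOn (𝓡∂ (n + 1)) 𝓘(ℝ, ℂ) ∞ (laplacian g fun z => (f z : ℂ))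
      ((𝓡∂ (n + 1)).interior X) := by
  intro x hx
  obtain ⟨Ω, ν, h1, h2, h3, h4, h5, h8, h6, h7⟩ := exists_chart_gradField hg hf hx
  set U := (extChartAt (𝓡∂ (n + 1)) x).source ∩ (extChartAt (𝓡∂ (n + 1)) x) ⁻¹' Ω with hU
  have hUo : IsOpen U := (continuousOn_extChartAt x).isOpen_inter_preimage
    (isOpen_extChartAt_source x) h1
  have hxU : x ∈ U := ⟨mem_extChartAt_source x, h2⟩
  have hψ : ContMDiffOn (𝓡∂ (n + 1)) 𝓘(ℝ, EuclideanSpace ℝ (Fin (n + 1))) ∞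
      (extChartAt (𝓡∂ (n + 1)) x) U :=
    contMDiffOn_extChartAt.mono fun z hz => by simpa using hz.1
  have hpos : ∀ y ∈ Ω, ∀ v, v ≠ 0 → 0 < pullMetric g (extChartAt (𝓡∂ (n + 1)) x).symm y v v :=
    fun y hy => pullMetric_pos hg (h3 hy) (h8 y hy).1
  have key := ((Complex.ofRealCLM.contDiff.comp_contDiffOn
    (contDiffOn_trace_hessForm h1 (contDiffOn_pullMetric hg h1 h4 h3) (hf.comp h4 h3).contDiffOn h5
      (EuclideanSpace.basisFun (Fin (n + 1)) ℝ).toBasis hpos).neg).contMDiffOn).comp hψ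
      fun z hz => hz.2
  refine ContMDiffAt.contMDiffWithinAt (ContMDiffOn.contMDiffAt (key.congr fun z hz => ?_)
    (hUo.mem_nhds hxU))
  have e := (extChartAt (𝓡∂ (n + 1)) x).left_inv hz.1
  have := laplacian_ofReal_param hg hf h1 h4 h3 hz.2 (h8 _ hz.2) (h7 _ hz.2)
    (EuclideanSpace.basisFun (Fin (n + 1)) ℝ).toBasis
  rw [e] at this
  rw [this]
  rfl

end Gradient
end AsympConic

end

noncomputable section
namespace AsympConic

set_option linter.unusedSectionVars false

/-! ## Conjugation of the Laplacian -/

section Conjugation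

variable {n : ℕ} {X : Type*}
  [TopologicalSpace X] [ChartedSpace (EuclideanHalfSpace (n + 1)) X]
  [IsManifold (𝓡∂ (n + 1)) ∞ X]

theorem pd_mul {A B : EuclideanSpace ℝ (Fin (n + 1)) → ℂ} {y : EuclideanSpace ℝ (Fin (n + 1))}
    (hA : DifferentiableAt ℝ A y) (hB : DifferentiableAt ℝ B y) (k : Fin (n + 1)) :
    pd k (fun z => A z * B z) y = pd k A y * B y + A y * pd k B y := by
  simp only [pd]
  rw [fderiv_fun_mul hA hB]
  simp only [add_apply, smul_apply, smul_eq_mul]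
  ring

theorem pd_add {A B : EuclideanSpace ℝ (Fin (n + 1)) → ℂ} {y : EuclideanSpace ℝ (Fin (n + 1))}
    (hA : DifferentiableAt ℝ A y) (hB : DifferentiableAt ℝ B y) (k : Fin (n + 1)) :
    pd k (fun z => A z + B z) y = pd k A y + pd k B y := by
  simp only [pd]
  rw [fderiv_fun_add hA hB]
  rfl

theorem pd_const_mul {A : EuclideanSpace ℝ (Fin (n + 1)) → ℂ}
    {y : EuclideanSpace ℝ (Fin (n + 1))} (hA : DifferentiableAt ℝ A y) (c : ℂ) (k : Fin (n + 1)) :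
    pd k (fun z => c * A z) y = c * pd k A y := by
  simp only [pd]
  rw [fderiv_const_mul hA]
  rfl

theorem pd_cexp {A : EuclideanSpace ℝ (Fin (n + 1)) → ℂ} {y : EuclideanSpace ℝ (Fin (n + 1))}
    (hA : DifferentiableAt ℝ A y) (c : ℂ) (k : Fin (n + 1)) :
    pd k (fun z => Complex.exp (c * A z)) y = Complex.exp (c * A y) * (c * pd k A y) := by
  simp only [pd]
  rw [(hA.hasFDerivAt.const_mul c).cexp.fderiv]
  simp

theorem metricMatrix_chart (g : BilinField n X) {x : X} (hx : x ∈ (𝓡∂ (n + 1)).interior X) :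
    metricMatrix g x (extChartAt (𝓡∂ (n + 1)) x x)
      = gram (pullMetric g (extChartAt (𝓡∂ (n + 1)) x).symm (extChartAt (𝓡∂ (n + 1)) x x))
        (EuclideanSpace.basisFun (Fin (n + 1)) ℝ).toBasis := by
  obtain ⟨Ω, -, hy, -, hr, -⟩ := exists_isOpen_chart hx
  ext i j
  simp only [metricMatrix, coordField, gram, Matrix.of_apply]
  rw [mfderivWithin_of_mem_nhds (hr _ hy)]
  simp
  rfl

/-- The pairing of a gradient with a differential, in the chart. -/
theorem sum_inv_metricMatrix {g : BilinField n X} (hg : IsRiemannianInside g) {φ : X → ℝ}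
    (hφ : ContMDiffOn (𝓡∂ (n + 1)) 𝓘(ℝ, ℝ) ∞ φ ((𝓡∂ (n + 1)).interior X)) {u : X → ℂ}
    (hu : ContMDiffOn (𝓡∂ (n + 1)) 𝓘(ℝ, ℂ) ∞ u ((𝓡∂ (n + 1)).interior X)) {x : X}
    (hx : x ∈ (𝓡∂ (n + 1)).interior X) :
    ∑ i, ∑ j, (((metricMatrix g x (extChartAt (𝓡∂ (n + 1)) x x))⁻¹ i j : ℝ) : ℂ)
      * (pd i (fun z => ((φ ((extChartAt (𝓡∂ (n + 1)) x).symm z) : ℝ) : ℂ))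
          (extChartAt (𝓡∂ (n + 1)) x x)
        * pd j (fun z => u ((extChartAt (𝓡∂ (n + 1)) x).symm z)) (extChartAt (𝓡∂ (n + 1)) x x))
      = dfun u x (gradField g φ x) := by
  obtain ⟨Ω, ν, h1, h2, h3, h4, h5, h8, h6, h7⟩ := exists_chart_gradField hg hφ hx
  set y := extChartAt (𝓡∂ (n + 1)) x x with hy
  set Φ : EuclideanSpace ℝ (Fin (n + 1)) → X := ⇑(extChartAt (𝓡∂ (n + 1)) x).symm with hΦ
  have hΦy : Φ y = x := extChartAt_to_inv x
  have hF : ContDiffOn ℝ ∞ (φ ∘ Φ) Ω := (hφ.comp h4 h3).contDiffOn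
  have hU : ContDiffOn ℝ ∞ (u ∘ Φ) Ω := (hu.comp h4 h3).contDiffOn
  have hFd : DifferentiableAt ℝ (φ ∘ Φ) y := (hF.contDiffAt (h1.mem_nhds h2)).differentiableAt (by simp)
  have hdet := isUnit_det_gram (pullMetric_pos hg (h3 h2) (h8 y h2).1)
    (EuclideanSpace.basisFun (Fin (n + 1)) ℝ).toBasis.linearIndependent
  have hi : ∀ i, pd i (fun z => ((φ (Φ z) : ℝ) : ℂ)) y
      = ((pullMetric g Φ y (ν y) ((EuclideanSpace.basisFun (Fin (n + 1)) ℝ).toBasis i) : ℝ) : ℂ) := by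
    intro i
    have := fderiv_ofReal_comp hFd (EuclideanSpace.single i 1)
    rw [h7 y h2, pd]
    simpa using this
  rw [metricMatrix_chart g hx, Finset.sum_comm]
  have hj : ∀ j, ∑ i, (((gram (pullMetric g Φ y)
      (EuclideanSpace.basisFun (Fin (n + 1)) ℝ).toBasis)⁻¹ i j : ℝ) : ℂ)
      * (pd i (fun z => ((φ (Φ z) : ℝ) : ℂ)) y * pd j (fun z => u (Φ z)) y)
      = ((ν y j : ℝ) : ℂ) * pd j (fun z => u (Φ z)) y := by
    intro j
    have := sum_inv_gram_mul (pullMetric g Φ y) (EuclideanSpace.basisFun (Fin (n + 1)) ℝ).toBasis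
      hdet (ν y) j
    simp only [← mul_assoc, ← Finset.sum_mul, hi, ← Complex.ofReal_mul, ← Complex.ofReal_sum, this]
    simp
  have hfin : dfun u x (gradField g φ x) = fderiv ℝ (u ∘ Φ) y (ν y) := by
    rw [fderiv_comp_param (mdifferentiableAt_of_interior hu (h3 h2))
      ((h4.contMDiffAt (h1.mem_nhds h2)).mdifferentiableAt (by simp)), h6 y h2]
    exact congrArg (fun z => dfun u z (gradField g φ z)) hΦy.symm
  rw [hfin]
  have hν : ν y = ∑ l, ν y l • EuclideanSpace.single l (1 : ℝ) := by
    ext i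
    simp [Finset.sum_apply, Pi.single_apply]
  conv_rhs => rw [hν]
  rw [map_sum]
  refine Finset.sum_congr rfl fun j _ => ?_
  rw [hj, map_smul, Complex.real_smul]
  rfl

theorem dfun_ofReal {φ : X → ℝ}
    (hφ : ContMDiffOn (𝓡∂ (n + 1)) 𝓘(ℝ, ℝ) ∞ φ ((𝓡∂ (n + 1)).interior X)) {x : X}
    (hx : x ∈ (𝓡∂ (n + 1)).interior X) (v : EuclideanSpace ℝ (Fin (n + 1))) :
    dfun (n := n) (fun z => (φ z : ℂ)) x v = ((dfun φ x v : ℝ) : ℂ) := by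
  have h1 := (mdifferentiableAt_of_interior hφ hx).hasMFDerivAt
  have h2 : HasMFDerivAt 𝓘(ℝ, ℝ) 𝓘(ℝ, ℂ) Complex.ofRealCLM (φ x) Complex.ofRealCLM :=
    (Complex.ofRealCLM.hasFDerivAt (x := φ x)).hasMFDerivAt
  have h3 := (h2.comp x h1).mfderiv
  unfold dfun
  rw [show (fun z => (φ z : ℂ)) = Complex.ofRealCLM ∘ φ from rfl, h3]
  rfl

/-- Both sides are evaluated in the same chart at the same point, so only the product rule is
involved and no invariance. This allows complex `u`, while invariance is proved and used for real
functions only. -/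
theorem laplacian_exp_mul {g : BilinField n X} (hg : IsRiemannianInside g) {φ : X → ℝ}
    (hφ : ContMDiffOn (𝓡∂ (n + 1)) 𝓘(ℝ, ℝ) ∞ φ ((𝓡∂ (n + 1)).interior X)) {u : X → ℂ}
    (hu : ContMDiffOn (𝓡∂ (n + 1)) 𝓘(ℝ, ℂ) ∞ u ((𝓡∂ (n + 1)).interior X)) {x : X}
    (hx : x ∈ (𝓡∂ (n + 1)).interior X) (σ : ℝ) :
    laplacian g (fun z => Complex.exp (Complex.I * σ * φ z) * u z) x
      = Complex.exp (Complex.I * σ * φ x) * (laplacian g u x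
        + Complex.I * σ * (u x * laplacian g (fun z => (φ z : ℂ)) x
          - 2 * dfun u x (gradField g φ x))
        + σ ^ 2 * (dfun φ x (gradField g φ x) : ℝ) * u x) := by
  obtain ⟨Ω, h1, h2, -, -, h3, h4⟩ := exists_isOpen_chart hx
  have hφc : ContMDiffOn (𝓡∂ (n + 1)) 𝓘(ℝ, ℂ) ∞ (fun z => (φ z : ℂ))
      ((𝓡∂ (n + 1)).interior X) :=
    Complex.ofRealCLM.contDiff.contMDiff.comp_contMDiffOn hφ
  have hS1 := sum_inv_metricMatrix hg hφ hu hx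
  have hS2 := (sum_inv_metricMatrix hg hφ hφc hx).trans (dfun_ofReal hφ hx (gradField g φ x))
  have hsymm : ∀ i j, (metricMatrix g x (extChartAt (𝓡∂ (n + 1)) x x))⁻¹ i j
      = (metricMatrix g x (extChartAt (𝓡∂ (n + 1)) x x))⁻¹ j i := by
    have : (metricMatrix g x (extChartAt (𝓡∂ (n + 1)) x x)).transpose
        = metricMatrix g x (extChartAt (𝓡∂ (n + 1)) x x) := by
      ext i j
      simp only [metricMatrix, Matrix.transpose_apply, Matrix.of_apply]
      exact hg.symm _ (h3 h2) _ _
    intro i j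
    conv_lhs => rw [← this, ← Matrix.transpose_nonsing_inv, Matrix.transpose_apply]
  have hΦy : (extChartAt (𝓡∂ (n + 1)) x).symm (extChartAt (𝓡∂ (n + 1)) x x) = x :=
    extChartAt_to_inv x
  simp only [laplacian]
  set y := extChartAt (𝓡∂ (n + 1)) x x with hy
  set Φ : EuclideanSpace ℝ (Fin (n + 1)) → X := ⇑(extChartAt (𝓡∂ (n + 1)) x).symm with hΦ
  set A : EuclideanSpace ℝ (Fin (n + 1)) → ℂ := fun z => (φ (Φ z) : ℂ) with hA
  set U : EuclideanSpace ℝ (Fin (n + 1)) → ℂ := fun z => u (Φ z) with hU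
  have hAs : ContDiffOn ℝ ∞ A Ω := (hφc.comp h4 h3).contDiffOn
  have hUs : ContDiffOn ℝ ∞ U Ω := (hu.comp h4 h3).contDiffOn
  have dd : ∀ {B : EuclideanSpace ℝ (Fin (n + 1)) → ℂ}, ContDiffOn ℝ ∞ B Ω → ∀ z ∈ Ω,
      DifferentiableAt ℝ B z := fun hB z hz =>
    (hB.contDiffAt (h1.mem_nhds hz)).differentiableAt (by simp)
  have pdd : ∀ {B : EuclideanSpace ℝ (Fin (n + 1)) → ℂ}, ContDiffOn ℝ ∞ B Ω → ∀ k,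
      DifferentiableAt ℝ (pd k B) y := fun hB k =>
    dd ((hB.fderiv_of_isOpen h1 (m := ∞) (by simp)).clm_apply contDiffOn_const) y h2
  have hexp : ∀ z ∈ Ω, DifferentiableAt ℝ (fun z => Complex.exp (Complex.I * σ * A z)) z :=
    fun z hz => ((dd hAs z hz).const_mul _).cexp
  have hW1 : ∀ k, ∀ z ∈ Ω, pd k (fun z => Complex.exp (Complex.I * σ * A z) * U z) z
      = Complex.exp (Complex.I * σ * A z) * (Complex.I * σ * (pd k A z * U z) + pd k U z) := by
    intro k z hz
    rw [pd_mul (hexp z hz) (dd hUs z hz), pd_cexp (dd hAs z hz)]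
    ring
  have hW2 : ∀ i j, pd i (pd j (fun z => Complex.exp (Complex.I * σ * A z) * U z)) y
      = Complex.exp (Complex.I * σ * A y) * (Complex.I * σ * pd i A y
          * (Complex.I * σ * (pd j A y * U y) + pd j U y)
        + (Complex.I * σ * (pd i (pd j A) y * U y + pd j A y * pd i U y) + pd i (pd j U) y)) := by
    intro i j
    have e : pd j (fun z => Complex.exp (Complex.I * σ * A z) * U z) =ᶠ[𝓝 y]
        fun z => Complex.exp (Complex.I * σ * A z)
          * (Complex.I * σ * (pd j A z * U z) + pd j U z) := by
      filter_upwards [h1.mem_nhds h2] with z hz using hW1 j z hz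
    have d1 : DifferentiableAt ℝ (fun z => pd j A z * U z) y := (pdd hAs j).mul (dd hUs y h2)
    have e1 : pd i (pd j (fun z => Complex.exp (Complex.I * σ * A z) * U z)) y
        = pd i (fun z => Complex.exp (Complex.I * σ * A z)
          * (Complex.I * σ * (pd j A z * U z) + pd j U z)) y := by
      exact congrArg (fun L : EuclideanSpace ℝ (Fin (n + 1)) →L[ℝ] ℂ =>
        L (EuclideanSpace.single i 1)) e.fderiv_eq
    have e2 : pd i (fun z => Complex.I * σ * (pd j A z * U z) + pd j U z) y
        = Complex.I * σ * (pd i (pd j A) y * U y + pd j A y * pd i U y) + pd i (pd j U) y := by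
      rw [← pd_mul (pdd hAs j) (dd hUs y h2), pd_add (d1.const_mul (Complex.I * σ)) (pdd hUs j),
        pd_const_mul d1]
    have d2 : DifferentiableAt ℝ (fun z => Complex.I * σ * (pd j A z * U z) + pd j U z) y :=
      (d1.const_mul (Complex.I * σ)).add (pdd hUs j)
    rw [e1, pd_mul (hexp y h2) d2, e2, pd_cexp (dd hAs y h2)]
    ring
  have hAy : A y = φ x := by simp only [hA, hΦy]
  have hUy : U y = u x := by simp only [hU, hΦy]
  -- The mixed first-order term occurs with both orders of the indices; the symmetry of the inverse
  -- metric identifies them, whence the factor 2.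
  have hS1' : ∑ i, ∑ j, (((metricMatrix g x y)⁻¹ i j : ℝ) : ℂ) * (pd j A y * pd i U y)
      = dfun u x (gradField g φ x) := by
    rw [← hS1, Finset.sum_comm]
    exact Finset.sum_congr rfl fun i _ => Finset.sum_congr rfl fun j _ => by rw [hsymm]
  have hterm : ∀ i j, -((((metricMatrix g x y)⁻¹ i j : ℝ) : ℂ)
      * (pd i (pd j (fun z => Complex.exp (Complex.I * σ * A z) * U z)) y
        - ∑ k, (christoffel g x k i j y : ℂ)
          * pd k (fun z => Complex.exp (Complex.I * σ * A z) * U z) y))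
      = Complex.exp (Complex.I * σ * A y)
        * (-((((metricMatrix g x y)⁻¹ i j : ℝ) : ℂ)
            * (pd i (pd j U) y - ∑ k, (christoffel g x k i j y : ℂ) * pd k U y))
          + Complex.I * σ * (U y * -((((metricMatrix g x y)⁻¹ i j : ℝ) : ℂ)
            * (pd i (pd j A) y - ∑ k, (christoffel g x k i j y : ℂ) * pd k A y))
            - ((((metricMatrix g x y)⁻¹ i j : ℝ) : ℂ) * (pd i A y * pd j U y)
              + (((metricMatrix g x y)⁻¹ i j : ℝ) : ℂ) * (pd j A y * pd i U y)))
          + σ ^ 2 * ((((metricMatrix g x y)⁻¹ i j : ℝ) : ℂ) * (pd i A y * pd j A y)) * U y) := by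
    intro i j
    have hk : ∑ k, (christoffel g x k i j y : ℂ)
          * pd k (fun z => Complex.exp (Complex.I * σ * A z) * U z) y
        = Complex.exp (Complex.I * σ * A y)
          * (Complex.I * σ * (U y * ∑ k, (christoffel g x k i j y : ℂ) * pd k A y)
            + ∑ k, (christoffel g x k i j y : ℂ) * pd k U y) := by
      simp only [Finset.mul_sum, ← Finset.sum_add_distrib]
      refine Finset.sum_congr rfl fun k _ => ?_
      rw [hW1 k y h2]
      ring
    rw [hk, hW2]
    linear_combination (-(σ : ℂ) ^ 2 * Complex.exp (Complex.I * σ * A y)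
      * (((metricMatrix g x y)⁻¹ i j : ℝ) : ℂ) * (pd i A y * pd j A y) * U y) * Complex.I_sq
  rw [Finset.sum_congr rfl fun i _ => Finset.sum_congr rfl fun j _ => hterm i j]
  simp only [← Finset.mul_sum, Finset.sum_add_distrib, Finset.sum_sub_distrib, ← Finset.sum_mul,
    hS1, hS1', hS2, hAy, hUy]
  ring

/-- The Laplacian of half the square of a function vanishing at the point. -/
theorem laplacian_sq_half {g : BilinField n X} (hg : IsRiemannianInside g) {φ : X → ℝ}
    (hφ : ContMDiffOn (𝓡∂ (n + 1)) 𝓘(ℝ, ℝ) ∞ φ ((𝓡∂ (n + 1)).interior X)) {x : X}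
    (hx : x ∈ (𝓡∂ (n + 1)).interior X) :
    laplacian g (fun z => (((φ z - φ x) ^ 2 / 2 : ℝ) : ℂ)) x
      = ((-(dfun φ x (gradField g φ x)) : ℝ) : ℂ) := by
  obtain ⟨Ω, h1, h2, -, -, h3, h4⟩ := exists_isOpen_chart hx
  have hφc : ContMDiffOn (𝓡∂ (n + 1)) 𝓘(ℝ, ℂ) ∞ (fun z => (φ z : ℂ))
      ((𝓡∂ (n + 1)).interior X) :=
    Complex.ofRealCLM.contDiff.contMDiff.comp_contMDiffOn hφ
  have hS2 := (sum_inv_metricMatrix hg hφ hφc hx).trans (dfun_ofReal hφ hx (gradField g φ x))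
  have hΦy : (extChartAt (𝓡∂ (n + 1)) x).symm (extChartAt (𝓡∂ (n + 1)) x x) = x :=
    extChartAt_to_inv x
  simp only [laplacian]
  set y := extChartAt (𝓡∂ (n + 1)) x x with hy
  set Φ : EuclideanSpace ℝ (Fin (n + 1)) → X := ⇑(extChartAt (𝓡∂ (n + 1)) x).symm with hΦ
  set A : EuclideanSpace ℝ (Fin (n + 1)) → ℂ := fun z => (φ (Φ z) : ℂ) with hA
  have hAs : ContDiffOn ℝ ∞ A Ω := (hφc.comp h4 h3).contDiffOn
  have hBs : ContDiffOn ℝ ∞ (fun z => A z - A y) Ω := hAs.sub contDiffOn_const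
  have dd : ∀ {B : EuclideanSpace ℝ (Fin (n + 1)) → ℂ}, ContDiffOn ℝ ∞ B Ω → ∀ z ∈ Ω,
      DifferentiableAt ℝ B z := fun hB z hz =>
    (hB.contDiffAt (h1.mem_nhds hz)).differentiableAt (by simp)
  have pdd : ∀ k, DifferentiableAt ℝ (pd k A) y := fun k =>
    dd ((hAs.fderiv_of_isOpen h1 (m := ∞) (by simp)).clm_apply contDiffOn_const) y h2
  have hpdB : ∀ k z, pd k (fun z => A z - A y) z = pd k A z := by
    intro k z
    simp only [pd]
    rw [fderiv_sub_const]
  have e0 : (fun z => (((φ (Φ z) - φ x) ^ 2 / 2 : ℝ) : ℂ))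
      = fun z => (1 / 2) * ((A z - A y) * (A z - A y)) := by
    funext z
    simp only [hA, hΦy]
    push_cast
    ring
  have hW1 : ∀ k, ∀ z ∈ Ω, pd k (fun z => (((φ (Φ z) - φ x) ^ 2 / 2 : ℝ) : ℂ)) z
      = (A z - A y) * pd k A z := by
    intro k z hz
    have h5 : DifferentiableAt ℝ (fun z => (A z - A y) * (A z - A y)) z :=
      (dd hBs z hz).mul (dd hBs z hz)
    rw [e0, pd_const_mul h5, pd_mul (dd hBs z hz) (dd hBs z hz), hpdB]
    ring
  have hW2 : ∀ i j, pd i (pd j (fun z => (((φ (Φ z) - φ x) ^ 2 / 2 : ℝ) : ℂ))) y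
      = pd i A y * pd j A y := by
    intro i j
    have e : pd j (fun z => (((φ (Φ z) - φ x) ^ 2 / 2 : ℝ) : ℂ)) =ᶠ[𝓝 y]
        fun z => (A z - A y) * pd j A z := by
      filter_upwards [h1.mem_nhds h2] with z hz using hW1 j z hz
    have e1 : pd i (pd j (fun z => (((φ (Φ z) - φ x) ^ 2 / 2 : ℝ) : ℂ))) y
        = pd i (fun z => (A z - A y) * pd j A z) y := by
      exact congrArg (fun L : EuclideanSpace ℝ (Fin (n + 1)) →L[ℝ] ℂ =>
        L (EuclideanSpace.single i 1)) e.fderiv_eq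
    rw [e1, pd_mul (dd hBs y h2) (pdd j), hpdB]
    ring
  simp only [hW2, hW1 _ y h2, sub_self, zero_mul, mul_zero, Finset.sum_const_zero, sub_zero,
    Finset.sum_neg_distrib, hS2]
  push_cast
  ring

end Conjugation
end AsympConic

end

noncomputable section
namespace AsympConic

set_option linter.unusedSectionVars false

/-! ## Weighted spaces on a region -/

section Weighted

variable {E H M : Type*} [NormedAddCommGroup E] [NormedSpace ℝ E] [TopologicalSpace H]
  [TopologicalSpace M] [ChartedSpace H M] {I : ModelWithCorners ℝ E H} {D : Region M}
  {F : Type*} [NormedAddCommGroup F] [NormedSpace ℝ F]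

/-- The properties of a region with boundary that the weighted calculus uses. -/
structure Region.IsRegular (I : ModelWithCorners ℝ E H) (D : Region M) : Prop where
  isOpen_inner : IsOpen D.inner
  inner_subset : D.inner ⊆ D.carrier
  bdf_pos : ∀ x ∈ D.inner, 0 < D.bdf x
  bdf_smooth : ContMDiffOn I 𝓘(ℝ, ℝ) ∞ D.bdf D.carrier

theorem MemWeightedSmooth.mono {l l' : ℕ∞} {f : M → F} (hf : MemWeightedSmooth I D l f)
    (h : l' ≤ l) : MemWeightedSmooth I D l' f := fun k hk => hf k (hk.trans h)

theorem MemWeightedSmooth.congr {l : ℕ∞} {f f' : M → F} (hf : MemWeightedSmooth I D l f)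
    (h : ∀ x ∈ D.inner, f' x = f x) : MemWeightedSmooth I D l f' := fun k hk =>
  let ⟨a, ha, e⟩ := hf k hk
  ⟨a, ha, fun x hx => (h x hx).trans (e x hx)⟩

theorem MemWeightedSmooth.zero (l : ℕ∞) : MemWeightedSmooth I D l (fun _ => (0 : F)) :=
  fun _ _ => ⟨fun _ => 0, contMDiffOn_const, by simp⟩

theorem MemWeightedSmooth.add {l : ℕ∞} {f f' : M → F} (hf : MemWeightedSmooth I D l f)
    (hf' : MemWeightedSmooth I D l f') : MemWeightedSmooth I D l (fun x => f x + f' x) := by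
  intro k hk
  obtain ⟨a, ha, e⟩ := hf k hk
  obtain ⟨a', ha', e'⟩ := hf' k hk
  exact ⟨fun x => a x + a' x, ha.add ha', fun x hx => by beta_reduce; rw [e x hx, e' x hx, smul_add]⟩

theorem MemWeightedSmooth.smul {l : ℕ∞} {f : M → F} {c : M → ℝ}
    (hc : ContMDiffOn I 𝓘(ℝ, ℝ) ∞ c D.carrier) (hf : MemWeightedSmooth I D l f) :
    MemWeightedSmooth I D l (fun x => c x • f x) := by
  intro k hk
  obtain ⟨a, ha, e⟩ := hf k hk
  exact ⟨fun x => c x • a x, hc.smul ha, fun x hx => by beta_reduce; rw [e x hx, smul_comm]⟩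

theorem MemWeightedSmooth.mul_left {l : ℕ∞} {f : M → ℝ} {c : M → ℝ}
    (hc : ContMDiffOn I 𝓘(ℝ, ℝ) ∞ c D.carrier) (hf : MemWeightedSmooth I D l f) :
    MemWeightedSmooth I D l (fun x => c x * f x) := hf.smul hc

theorem MemWeightedSmooth.const_mul {l : ℕ∞} {f : M → ℂ} (hf : MemWeightedSmooth I D l f)
    (c : ℂ) : MemWeightedSmooth I D l (fun x => c * f x) := by
  intro k hk
  obtain ⟨a, ha, e⟩ := hf k hk
  refine ⟨fun x => c * a x, ?_, fun x hx => by beta_reduce; rw [e x hx, mul_smul_comm]⟩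
  exact ((contDiff_const.mul contDiff_id).contMDiff (f := fun z : ℂ => c * z)).comp_contMDiffOn ha

theorem MemWeightedSmooth.ofReal {l : ℕ∞} {f : M → ℝ} (hf : MemWeightedSmooth I D l f) :
    MemWeightedSmooth I D l (fun x => (f x : ℂ)) := by
  intro k hk
  obtain ⟨a, ha, e⟩ := hf k hk
  refine ⟨fun x => (a x : ℂ), Complex.ofRealCLM.contDiff.contMDiff.comp_contMDiffOn ha,
    fun x hx => ?_⟩
  beta_reduce
  rw [e x hx]
  simp

theorem MemWeightedSmooth.of_contMDiffOn {f : M → F} (hf : ContMDiffOn I 𝓘(ℝ, F) ∞ f D.carrier) :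
    MemWeightedSmooth I D 0 f := by
  intro k hk
  have : k = 0 := by simpa using hk
  subst this
  exact ⟨f, hf, by simp⟩

/-- Multiplication by a power of the boundary-defining function. -/
theorem MemWeightedSmooth.pow_smul {l : ℕ∞} {f : M → F} (hD : D.IsRegular I)
    (hf : MemWeightedSmooth I D l f) (j : ℕ) :
    MemWeightedSmooth I D (j + l) (fun x => D.bdf x ^ j • f x) := by
  intro k hk
  rcases le_total k j with h | h
  · obtain ⟨a, ha, e⟩ := hf 0 (by simp)
    refine ⟨fun x => D.bdf x ^ (j - k) • a x, (hD.bdf_smooth.pow _).smul ha, fun x hx => ?_⟩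
    beta_reduce
    rw [e x hx, pow_zero, one_smul, smul_smul, ← pow_add, Nat.add_sub_cancel' h]
  · obtain ⟨i, rfl⟩ := Nat.exists_eq_add_of_le h
    have hi : (i : ℕ∞) ≤ l := by
      push_cast at hk
      exact (ENat.add_le_add_iff_left (ENat.natCast_ne_top j)).1 hk
    obtain ⟨a, ha, e⟩ := hf i hi
    exact ⟨a, ha, fun x hx => by beta_reduce; rw [e x hx, smul_smul, ← pow_add]⟩

/-- It suffices to consider large powers of the boundary-defining function. -/
theorem MemWeightedSmooth.of_le_of_pos {l : ℕ∞} {f : M → F} (hD : D.IsRegular I) (hl : 1 ≤ l)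
    (h : ∀ k : ℕ, 1 ≤ k → (k : ℕ∞) ≤ l → ∃ a : M → F,
      ContMDiffOn I 𝓘(ℝ, F) ∞ a D.carrier ∧ ∀ x ∈ D.inner, f x = D.bdf x ^ k • a x) :
    MemWeightedSmooth I D l f := by
  intro k hk
  rcases Nat.eq_zero_or_pos k with rfl | hk0
  · obtain ⟨a, ha, e⟩ := h 1 le_rfl (by exact_mod_cast hl)
    exact ⟨fun x => D.bdf x • a x, hD.bdf_smooth.smul ha, fun x hx => by beta_reduce; rw [e x hx]; simp⟩
  · exact h k hk0 hk

/-- Membership in a weighted space is a local property. -/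
theorem exists_contMDiffOn_of_local (hD : D.IsRegular I)
    (hcl : D.carrier ⊆ closure D.inner) {f : M → F} {k : ℕ}
    (h : ∀ x ∈ D.carrier, ∃ U : Set M, IsOpen U ∧ x ∈ U ∧ ∃ a : M → F,
      ContMDiffOn I 𝓘(ℝ, F) ∞ a (D.carrier ∩ U) ∧ ∀ z ∈ D.inner ∩ U, f z = D.bdf z ^ k • a z) :
    ∃ a : M → F, ContMDiffOn I 𝓘(ℝ, F) ∞ a D.carrier ∧ ∀ x ∈ D.inner, f x = D.bdf x ^ k • a x := by
  set b : M → F := fun x => (D.bdf x ^ k)⁻¹ • f x with hb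
  -- A local coefficient must be the continuous extension of ρ⁻ᵏf from the dense interior. Hence the
  -- local coefficients agree, and `extendFrom` is a global one.
  have key : ∀ {U : Set M}, IsOpen U → ∀ {a : M → F}, ContMDiffOn I 𝓘(ℝ, F) ∞ a (D.carrier ∩ U) →
      (∀ z ∈ D.inner ∩ U, f z = D.bdf z ^ k • a z) → ∀ z ∈ D.carrier ∩ U,
      extendFrom D.inner b z = a z := by
    intro U hU a ha e z hz
    refine extendFrom_eq (hcl hz.1) ?_
    have h1 : Tendsto a (𝓝[D.inner] z) (𝓝 (a z)) := by
      have h2 : U ∈ 𝓝[D.inner] z := mem_nhdsWithin_of_mem_nhds (hU.mem_nhds hz.2)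
      have h3 := (ha z hz).continuousWithinAt.mono
        (inter_subset_inter_left U hD.inner_subset)
      rw [inter_comm, ContinuousWithinAt, nhdsWithin_inter_of_mem h2] at h3
      exact h3
    refine h1.congr' ?_
    filter_upwards [inter_mem_nhdsWithin D.inner (hU.mem_nhds hz.2)] with w hw
    have := pow_ne_zero k (hD.bdf_pos w hw.1).ne'
    simp only [hb]
    rw [e w hw, smul_smul, inv_mul_cancel₀ this, one_smul]
  refine ⟨extendFrom D.inner b, fun x hx => ?_, fun x hx => ?_⟩
  · obtain ⟨U, hU, hxU, a, ha, e⟩ := h x hx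
    have h1 : ContMDiffWithinAt I 𝓘(ℝ, F) ∞ (extendFrom D.inner b) (D.carrier ∩ U) x :=
      (ha x ⟨hx, hxU⟩).congr (key hU ha e) (key hU ha e x ⟨hx, hxU⟩)
    exact (contMDiffWithinAt_inter (hU.mem_nhds hxU)).1 h1
  · obtain ⟨U, hU, hxU, a, ha, e⟩ := h x (hD.inner_subset hx)
    rw [key hU ha e x ⟨hD.inner_subset hx, hxU⟩]
    exact e x ⟨hx, hxU⟩

end Weighted

/-! ## First order operators -/

section Operators

variable {E H M : Type*} [NormedAddCommGroup E] [NormedSpace ℝ E] [TopologicalSpace H]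
  [TopologicalSpace M] [ChartedSpace H M] {I : ModelWithCorners ℝ E H} [IsManifold I ∞ M]
  {D : Region M}

theorem MemDiffB.add {m : ℕ} {A B : Op M} (hA : MemDiffB I D m A) (hB : MemDiffB I D m B) :
    MemDiffB I D m (fun u x => A u x + B u x) := by
  obtain ⟨N, a, V, h1, h2, h3, h4⟩ := hA
  obtain ⟨N', a', V', h1', h2', h3', h4'⟩ := hB
  refine ⟨N + N', Fin.append a a', Fin.append V V', fun j => ?_, fun j => ?_, fun j => ?_,
    fun u hu x hx => ?_⟩
  · refine Fin.addCases (fun i => ?_) (fun i => ?_) j <;> simp [h1, h1']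
  · refine Fin.addCases (fun i => ?_) (fun i => ?_) j <;> simp [h2, h2']
  · refine Fin.addCases (fun i => ?_) (fun i => ?_) j
    · simpa using h3 i
    · simpa using h3' i
  · beta_reduce
    rw [Fin.sum_univ_add, h4 u hu x hx, h4' u hu x hx]
    simp

theorem MemDiffB.mul_left {m : ℕ} {A : Op M} (hA : MemDiffB I D m A) {c : M → ℂ}
    (hc : ContMDiffOn I 𝓘(ℝ, ℂ) ∞ c D.carrier) : MemDiffB I D m (fun u x => c x * A u x) := by
  obtain ⟨N, a, V, h1, h2, h3, h4⟩ := hA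
  refine ⟨N, fun j x => c x * a j x, V, fun j => ?_, h2, h3, fun u hu x hx => ?_⟩
  · exact contDiff_mul.contMDiff.comp_contMDiffOn (hc.prodMk_space (h1 j))
  · beta_reduce
    rw [h4 u hu x hx, Finset.mul_sum]
    exact Finset.sum_congr rfl fun j _ => (mul_assoc _ _ _).symm

theorem MemWeightedDiffB.mono {l l' : ℕ∞} {m : ℕ} {A : Op M} (hA : MemWeightedDiffB I D l m A)
    (h : l' ≤ l) : MemWeightedDiffB I D l' m A := fun k hk => hA k (hk.trans h)

theorem MemWeightedDiffB.add {l : ℕ∞} {m : ℕ} {A A' : Op M} (hA : MemWeightedDiffB I D l m A)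
    (hA' : MemWeightedDiffB I D l m A') : MemWeightedDiffB I D l m (fun u x => A u x + A' u x) := by
  intro k hk
  obtain ⟨B, hB, e⟩ := hA k hk
  obtain ⟨B', hB', e'⟩ := hA' k hk
  exact ⟨_, hB.add hB', fun u hu x hx => by beta_reduce; rw [e u hu x hx, e' u hu x hx, mul_add]⟩

theorem MemWeightedDiffB.const_mul {l : ℕ∞} {m : ℕ} {A : Op M} (hA : MemWeightedDiffB I D l m A)
    (c : ℂ) : MemWeightedDiffB I D l m (fun u x => c * A u x) := by
  intro k hk
  obtain ⟨B, hB, e⟩ := hA k hk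
  exact ⟨_, hB.mul_left (contMDiffOn_const (c := c)), fun u hu x hx => by
    beta_reduce
    rw [e u hu x hx, mul_left_comm]⟩

/-- Multiplication operators. -/
theorem MemWeightedSmooth.memWeightedDiffB {l : ℕ∞} {f : M → ℂ} (hf : MemWeightedSmooth I D l f)
    (m : ℕ) : MemWeightedDiffB I D l m (fun u x => f x * u x) := by
  intro k hk
  obtain ⟨a, ha, e⟩ := hf k hk
  refine ⟨fun u x => a x * u x, ⟨1, fun _ => a, fun _ => [], fun _ => ha, by simp, by simp,
    by simp⟩, fun u hu x hx => ?_⟩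
  beta_reduce
  rw [e x hx, Complex.real_smul, mul_assoc]
  push_cast
  rfl

/-- `V ∈ ρ^l V_b(D)`, as a vector field on the interior of `D`. -/
def MemWeightedField (I : ModelWithCorners ℝ E H) [IsManifold I ∞ M] (D : Region M) (l : ℕ∞)
    (V : (x : M) → TangentSpace I x) : Prop :=
  ∀ k : ℕ, (k : ℕ∞) ≤ l → ∃ W : (x : M) → TangentSpace I x, IsBVectorField I D W ∧
    ∀ x ∈ D.inner, V x = D.bdf x ^ k • W x

theorem MemWeightedField.memWeightedDiffB {l : ℕ∞} {V : (x : M) → TangentSpace I x}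
    (hV : MemWeightedField I D l V) : MemWeightedDiffB I D l 1 (applyField I V) := by
  intro k hk
  obtain ⟨W, hW, e⟩ := hV k hk
  refine ⟨applyField I W, ⟨1, fun _ _ => 1, fun _ => [W], fun _ => contMDiffOn_const, by simp,
    by simpa using hW, by simp⟩, fun u hu x hx => ?_⟩
  simp only [applyField]
  rw [e x hx]
  have := map_smul (mfderiv I 𝓘(ℝ, ℂ) u x) (D.bdf x ^ k) (W x)
  refine this.trans ?_
  exact (Complex.real_smul).trans (by push_cast; rfl)


/-- The derivative of a complex function, with values in the dual of the model space. -/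
def dval (I : ModelWithCorners ℝ E H) (u : M → ℂ) (x : M) : E →L[ℝ] ℂ := mfderiv I 𝓘(ℝ, ℂ) u x

theorem SmoothInside.mdifferentiableAt (hD : D.IsRegular I) {u : M → ℂ} (hu : SmoothInside I D u)
    {x : M} (hx : x ∈ D.inner) : MDifferentiableAt I 𝓘(ℝ, ℂ) u x :=
  (ContMDiffOn.contMDiffAt hu (hD.isOpen_inner.mem_nhds hx)).mdifferentiableAt (by simp)

theorem dval_mul {u v : M → ℂ} {x : M} (hu : MDifferentiableAt I 𝓘(ℝ, ℂ) u x)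
    (hv : MDifferentiableAt I 𝓘(ℝ, ℂ) v x) :
    dval I (fun z => u z * v z) x = u x • dval I v x + v x • dval I u x := by
  have h1 := hu.hasMFDerivAt.mul hv.hasMFDerivAt
  exact h1.mfderiv

theorem dval_const (c : ℂ) (x : M) : dval I (fun _ : M => c) x = 0 := mfderiv_const

theorem dval_exp {u : M → ℂ} {x : M} (hu : MDifferentiableAt I 𝓘(ℝ, ℂ) u x) (c : ℂ) :
    dval I (fun z => Complex.exp (c * u z)) x
      = (c * Complex.exp (c * u x)) • dval I u x := by
  have h0 : HasFDerivAt (fun w : ℂ => Complex.exp (c * w))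
      ((c * Complex.exp (c * u x)) • (ContinuousLinearMap.id ℝ ℂ)) (u x) := by
    refine (((hasFDerivAt_id (𝕜 := ℝ) (u x)).const_mul c).cexp).congr_fderiv ?_
    rw [smul_smul, mul_comm]
    rfl
  have h1 := h0.hasMFDerivAt.comp x hu.hasMFDerivAt
  refine (h1.mfderiv).trans ?_
  ext v
  rfl

/-- A first order operator at an interior point. -/
theorem MemDiffB.exists_pointwise {A : Op M} (hA : MemDiffB I D 1 A) {x : M} (hx : x ∈ D.inner) :
    ∃ (c : ℂ) (T : (E →L[ℝ] ℂ) →ₗ[ℂ] ℂ), ∀ u, SmoothInside I D u →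
      A u x = c * u x + T (dval I u x) := by
  obtain ⟨N, a, V, h1, h2, h3, h4⟩ := hA
  have h5 : ∀ j, ∃ (c : ℂ) (T : (E →L[ℝ] ℂ) →ₗ[ℂ] ℂ), ∀ u : M → ℂ,
      a j x * (V j).foldr (applyField I) u x = c * u x + T (dval I u x) := by
    intro j
    match hVj : V j with
    | [] => exact ⟨a j x, 0, fun u => by simp⟩
    | [W] =>
      refine ⟨0, a j x • (show (E →L[ℝ] ℂ) →ₗ[ℂ] ℂ from
        { toFun := fun L => L (W x), map_add' := fun _ _ => rfl, map_smul' := fun _ _ => rfl }),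
        fun u => ?_⟩
      rw [zero_mul, zero_add]
      rfl
    | _ :: _ :: _ =>
      have := h2 j
      rw [hVj] at this
      simp at this
  choose c T hT using h5
  refine ⟨∑ j, c j, ∑ j, T j, fun u hu => ?_⟩
  rw [h4 u hu x hx, Finset.sum_congr rfl fun j _ => hT j u, Finset.sum_add_distrib, Finset.sum_mul]
  simp

theorem MemWeightedDiffB.exists_pointwise {l : ℕ∞} {A : Op M} (hA : MemWeightedDiffB I D l 1 A)
    {x : M} (hx : x ∈ D.inner) :
    ∃ (c : ℂ) (T : (E →L[ℝ] ℂ) →ₗ[ℂ] ℂ), ∀ u, SmoothInside I D u →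
      A u x = c * u x + T (dval I u x) := by
  obtain ⟨B, hB, e⟩ := hA 0 (by simp)
  obtain ⟨c, T, h⟩ := hB.exists_pointwise hx
  exact ⟨c, T, fun u hu => by rw [e u hu x hx, pow_zero, one_mul, h u hu]⟩

/-- An `Op` may see the values of its argument outside the interior. The pointwise form c·u(x) +
T(du(x)) shows that an operator of first order does not. -/
theorem MemWeightedDiffB.congr_arg (hD : D.IsRegular I) {l : ℕ∞} {A : Op M}
    (hA : MemWeightedDiffB I D l 1 A) {u v : M → ℂ} (hu : SmoothInside I D u)
    (huv : ∀ x ∈ D.inner, v x = u x) {x : M} (hx : x ∈ D.inner) : A v x = A u x := by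
  obtain ⟨c, T, h⟩ := hA.exists_pointwise hx
  have e : dval I v x = dval I u x := by
    have : v =ᶠ[𝓝 x] u := by
      filter_upwards [hD.isOpen_inner.mem_nhds hx] with z hz using huv z hz
    exact this.mfderiv_eq
  rw [h u hu, h v (ContMDiffOn.congr hu huv), e, huv x hx]

/-- The commutator of an operator of first order with a function. -/
def commFun (A : Op M) (f : M → ℂ) (x : M) : ℂ := A f x - f x * A (fun _ => 1) x

theorem smoothInside_const (c : ℂ) : SmoothInside I D (fun _ : M => c) := contMDiffOn_const

theorem SmoothInside.mul {u v : M → ℂ} (hu : SmoothInside I D u) (hv : SmoothInside I D v) :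
    SmoothInside I D (fun x => u x * v x) :=
  (contDiff_mul (𝕜 := ℝ) (𝔸 := ℂ)).contMDiff.comp_contMDiffOn (ContMDiffOn.prodMk_space hu hv)

theorem SmoothInside.exp_mul {f : M → ℂ} (hf : SmoothInside I D f) (c : ℂ) :
    SmoothInside I D (fun x => Complex.exp (c * f x)) := by
  have h : ContDiff ℝ ∞ (fun z : ℂ => Complex.exp (c * z)) :=
    (contDiff_const.mul contDiff_id).cexp
  exact h.contMDiff.comp_contMDiffOn hf

/-- At a point the operator is b + T∘d; the chain rule produces c·T(df), and T(df) is `commFun A f`,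
because A 1 = b. -/
theorem MemWeightedDiffB.exp_mul (hD : D.IsRegular I) {l : ℕ∞} {A : Op M}
    (hA : MemWeightedDiffB I D l 1 A) {f u : M → ℂ} (hf : SmoothInside I D f)
    (hu : SmoothInside I D u) (c : ℂ) {x : M} (hx : x ∈ D.inner) :
    A (fun z => Complex.exp (c * f z) * u z) x
      = Complex.exp (c * f x) * (A u x + c * commFun A f x * u x) := by
  obtain ⟨b, T, h⟩ := hA.exists_pointwise hx
  have he := hf.exp_mul c
  rw [commFun, h _ (he.mul hu), h u hu, h f hf, h _ (smoothInside_const 1),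
    dval_mul (he.mdifferentiableAt hD hx) (hu.mdifferentiableAt hD hx),
    dval_exp (hf.mdifferentiableAt hD hx), dval_const]
  simp only [map_add, map_smul, smul_eq_mul, map_zero]
  ring

/-- The phase `r + (𝔪/2) log r`, as a function of `ρ = 1/r`. -/
def phaseFn (m t : ℝ) : ℝ := t⁻¹ - m / 2 * Real.log t

theorem hasDerivAt_phaseFn (m : ℝ) {t : ℝ} (ht : t ≠ 0) :
    HasDerivAt (phaseFn m) (-(t ^ 2)⁻¹ - m / 2 * t⁻¹) t :=
  (hasDerivAt_inv ht).sub ((Real.hasDerivAt_log ht).const_mul _)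

theorem contDiffAt_phaseFn (m : ℝ) {t : ℝ} (ht : t ≠ 0) : ContDiffAt ℝ ∞ (phaseFn m) t :=
  (contDiffAt_inv ℝ ht).sub (contDiffAt_const.mul (Real.contDiffAt_log.2 ht))

theorem Region.IsRegular.contMDiffOn_phase (hD : D.IsRegular I) (m : ℝ) :
    ContMDiffOn I 𝓘(ℝ, ℝ) ∞ (fun x => phaseFn m (D.bdf x)) D.inner := fun x hx =>
  (contDiffAt_phaseFn m (hD.bdf_pos x hx).ne').contMDiffAt.comp_contMDiffWithinAt x
    (hD.bdf_smooth.mono hD.inner_subset x hx)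

theorem Region.IsRegular.smoothInside_phase (hD : D.IsRegular I) (m : ℝ) :
    SmoothInside I D (fun x => (phaseFn m (D.bdf x) : ℂ)) :=
  Complex.ofRealCLM.contDiff.contMDiff.comp_contMDiffOn (hD.contMDiffOn_phase m)

/-- The derivative of the phase along a b-vector field. -/
theorem applyField_phase (hD : D.IsRegular I) (m : ℝ) {W : (x : M) → TangentSpace I x} {f : M → ℝ}
    (hf : ∀ x ∈ D.carrier,
      (mfderivWithin I 𝓘(ℝ, ℝ) D.bdf D.carrier x (W x) : ℝ) = D.bdf x * f x)
    {x : M} (hx : x ∈ D.inner) :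
    (D.bdf x : ℂ) * applyField I W (fun x => (phaseFn m (D.bdf x) : ℂ)) x
      = ((-(1 + m / 2 * D.bdf x) * f x : ℝ) : ℂ) := by
  have hpos := hD.bdf_pos x hx
  have hc : D.carrier ∈ 𝓝 x := mem_of_superset (hD.isOpen_inner.mem_nhds hx) hD.inner_subset
  have h1 : HasMFDerivAt I 𝓘(ℝ, ℝ) D.bdf x (mfderiv I 𝓘(ℝ, ℝ) D.bdf x) :=
    ((hD.bdf_smooth.contMDiffAt hc).mdifferentiableAt (by simp)).hasMFDerivAt
  have h2 : HasFDerivAt (fun t : ℝ => (phaseFn m t : ℂ))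
      (Complex.ofRealCLM.comp (ContinuousLinearMap.toSpanSingleton ℝ
        (-(D.bdf x ^ 2)⁻¹ - m / 2 * (D.bdf x)⁻¹))) (D.bdf x) :=
    Complex.ofRealCLM.hasFDerivAt.comp _ (hasDerivAt_phaseFn m hpos.ne').hasFDerivAt
  have h3 := (h2.hasMFDerivAt.comp x h1).mfderiv
  have h4 : applyField I W (fun x => (phaseFn m (D.bdf x) : ℂ)) x
      = (((show ℝ from mfderiv I 𝓘(ℝ, ℝ) D.bdf x (W x))
        * (-(D.bdf x ^ 2)⁻¹ - m / 2 * (D.bdf x)⁻¹) : ℝ) : ℂ) := by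
    unfold applyField
    exact congrArg (fun L : E →L[ℝ] ℂ => L (W x)) h3
  have h5 := hf x (hD.inner_subset hx)
  rw [mfderivWithin_of_mem_nhds hc] at h5
  have h6 : (show ℝ from mfderiv I 𝓘(ℝ, ℝ) D.bdf x (W x)) = D.bdf x * f x := h5
  rw [h4, h6, ← Complex.ofReal_mul]
  congr 1
  field_simp
  ring

/-- The commutator with the phase loses one order of decay. -/
theorem MemWeightedDiffB.commFun_phase (hD : D.IsRegular I) {l : ℕ∞} {A : Op M}
    (hA : MemWeightedDiffB I D (1 + l) 1 A) (m : ℝ) :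
    MemWeightedSmooth I D l (commFun A fun x => (phaseFn m (D.bdf x) : ℂ)) := by
  intro k hk
  -- The weight 1 + k rather than k: the spare factor ρ absorbs the ρ⁻¹ that appears when a b-vector
  -- field differentiates the phase.
  obtain ⟨B, ⟨N, a, V, h1, h2, h3, h4⟩, e⟩ := hA (1 + k) (by push_cast; gcongr)
  have h5 : ∀ j, ∃ b : M → ℂ, ContMDiffOn I 𝓘(ℝ, ℂ) ∞ b D.carrier ∧ ∀ x ∈ D.inner,
      (D.bdf x : ℂ) * ((V j).foldr (applyField I) (fun x => (phaseFn m (D.bdf x) : ℂ)) x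
        - (phaseFn m (D.bdf x) : ℂ) * (V j).foldr (applyField I) (fun _ => 1) x) = b x := by
    intro j
    -- A word of length 0 commutes with the phase. For one b-field W with Wρ = ρf,
    -- `applyField_phase` gives a coefficient that is smooth up to the boundary. Longer words are
    -- excluded by the order.
    match hVj : V j with
    | [] => exact ⟨0, contMDiffOn_const, fun x hx => by simp⟩
    | [W] =>
      obtain ⟨f, hf, hf'⟩ := (h3 j W (by simp [hVj])).tangent
      refine ⟨fun x => ((-(1 + m / 2 * D.bdf x) * f x : ℝ) : ℂ), ?_, fun x hx => ?_⟩
      · refine Complex.ofRealCLM.contDiff.contMDiff.comp_contMDiffOn ?_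
        have h6 : ContDiff ℝ ∞ (fun q : ℝ × ℝ => -(1 + m / 2 * q.1) * q.2) := by fun_prop
        exact h6.contMDiff.comp_contMDiffOn (hD.bdf_smooth.prodMk_space hf)
      · beta_reduce
        rw [← applyField_phase hD m hf' hx]
        have h7 : applyField I W (fun _ => 1) x = 0 :=
          congrArg (fun L : E →L[ℝ] ℂ => L (W x)) (dval_const (I := I) 1 x)
        simp only [List.foldr_cons, List.foldr_nil, h7, mul_zero, sub_zero]
    | _ :: _ :: _ =>
      have := h2 j
      rw [hVj] at this
      simp at this
  choose b hb hb' using h5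
  refine ⟨fun x => ∑ j, a j x * b j x, ?_, fun x hx => ?_⟩
  · refine contMDiffOn_finsetSum fun j _ => ?_
    exact (contDiff_mul (𝕜 := ℝ) (𝔸 := ℂ)).contMDiff.comp_contMDiffOn ((h1 j).prodMk_space (hb j))
  · beta_reduce
    rw [commFun, e _ (hD.smoothInside_phase m) x hx, e _ (smoothInside_const 1) x hx,
      h4 _ (hD.smoothInside_phase m) x hx, h4 _ (smoothInside_const 1) x hx, mul_left_comm,
      ← mul_sub, Finset.mul_sum, ← Finset.sum_sub_distrib, Complex.real_smul, Complex.ofReal_pow,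
      Finset.mul_sum (s := Finset.univ), Finset.mul_sum (s := Finset.univ)]
    refine Finset.sum_congr rfl fun j _ => ?_
    rw [← hb' j x hx]
    ring

end Operators
end AsympConic

end

noncomputable section
namespace AsympConic

set_option linter.unusedSectionVars false

/-! ## Gluing on a manifold with a collar -/

theorem radialRegion_isRegular : radialRegion.IsRegular 𝓘(ℝ, ℝ) where
  isOpen_inner := isOpen_Ioo
  inner_subset := Ioo_subset_Ico_self
  bdf_pos := fun _ hx => hx.1
  bdf_smooth := contMDiffOn_id

section Glue

variable {n : ℕ} {X Y : Type*}
  [TopologicalSpace X] [ChartedSpace (EuclideanHalfSpace (n + 1)) X]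
  [IsManifold (𝓡∂ (n + 1)) ∞ X]
  [TopologicalSpace Y] [ChartedSpace (EuclideanSpace ℝ (Fin n)) Y] [IsManifold (𝓡 n) ∞ Y]

variable (n Y) in
theorem cylinder_isRegular : (cylinder Y).IsRegular (𝓘(ℝ, ℝ).prod (𝓡 n)) where
  isOpen_inner := isOpen_Ioo.prod isOpen_univ
  inner_subset := prod_mono Ioo_subset_Ico_self Subset.rfl
  bdf_pos := fun _ hx => hx.1.1
  bdf_smooth := contMDiffOn_fst

theorem cylinder_subset_closure : (cylinder Y).carrier ⊆ closure (cylinder Y).inner := by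
  simp only [cylinder, closure_prod_eq, closure_univ, closure_Ioo (zero_ne_one (α := ℝ))]
  exact prod_mono Ico_subset_Icc_self Subset.rfl

variable (n Y) in
theorem uniqueMDiffOn_cylinder :
    UniqueMDiffOn (𝓘(ℝ, ℝ).prod (𝓡 n)) (Ico (0 : ℝ) 1 ×ˢ (univ : Set Y)) :=
  UniqueMDiffOn.prod (uniqueMDiffOn_iff_uniqueDiffOn.2 (uniqueDiffOn_Ico 0 1)) (uniqueMDiffOn_univ)

namespace Collar

variable (C : Collar n X Y)

theorem mem_source {s : ℝ} (hs : s ∈ Ico (0 : ℝ) 1) (θ : Y) : (s, θ) ∈ C.source := by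
  rw [C.source_eq]; exact ⟨hs, mem_univ _⟩

theorem bdf_pos_iff {x : X} : 0 < C.bdf x ↔ x ∈ (𝓡∂ (n + 1)).interior X := by
  rw [(C.bdf_nonneg x).lt_iff_ne', Ne, C.bdf_eq_zero_iff, ← ModelWithCorners.compl_interior,
    mem_compl_iff, not_not]

theorem region_isRegular : C.region.IsRegular (𝓡∂ (n + 1)) where
  isOpen_inner := isOpen_interior_manifold
  inner_subset := subset_univ _
  bdf_pos := fun _ hx => C.bdf_pos_iff.2 hx
  bdf_smooth := C.bdf_smooth.contMDiffOn

theorem toFun_mem_interior {s : ℝ} (hs : s ∈ Ioo (0 : ℝ) 1) (θ : Y) :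
    C.toFun (s, θ) ∈ (𝓡∂ (n + 1)).interior X := by
  rw [← C.bdf_pos_iff, C.bdf_collar s ⟨hs.1.le, hs.2⟩]; exact hs.1

theorem toFun_mem_target {s : ℝ} (hs : s ∈ Ico (0 : ℝ) 1) (θ : Y) : C.toFun (s, θ) ∈ C.target :=
  C.map_source' (C.mem_source hs θ)

theorem invFun_mem {x : X} (hx : x ∈ C.target) : C.invFun x ∈ Ico (0 : ℝ) 1 ×ˢ (univ : Set Y) := by
  rw [← C.source_eq]; exact C.map_target' hx

theorem bdf_eq_fst {x : X} (hx : x ∈ C.target) : C.bdf x = (C.invFun x).1 := by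
  have h := C.bdf_collar _ (C.invFun_mem hx).1 (C.invFun x).2
  rwa [Prod.mk.eta, C.right_inv' hx] at h

theorem invFun_mem_inner {x : X} (hx : x ∈ C.target) (hx' : x ∈ (𝓡∂ (n + 1)).interior X) :
    C.invFun x ∈ Ioo (0 : ℝ) 1 ×ˢ (univ : Set Y) := by
  have h := C.invFun_mem hx
  refine ⟨⟨?_, h.1.2⟩, h.2⟩
  rw [← C.bdf_eq_fst hx]
  exact C.bdf_pos_iff.2 hx'

theorem mem_target_or_interior (x : X) : x ∈ C.target ∨ x ∈ (𝓡∂ (n + 1)).interior X := by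
  by_cases h : x ∈ (𝓡∂ (n + 1)).interior X
  · exact Or.inr h
  · left
    rw [← mem_compl_iff, ModelWithCorners.compl_interior, C.mem_boundary_iff] at h
    obtain ⟨θ, rfl⟩ := h
    exact C.toFun_mem_target ⟨le_rfl, one_pos⟩ θ

theorem interior_eq_iUnion {x : X} (hx : x ∈ C.target) (hx' : x ∈ (𝓡∂ (n + 1)).interior X) :
    ∃ s ∈ Ioo (0 : ℝ) 1, ∃ θ : Y, C.toFun (s, θ) = x :=
  ⟨_, (C.invFun_mem_inner hx hx').1, (C.invFun x).2, C.right_inv' hx⟩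

theorem contMDiffOn_toFun : ContMDiffOn (𝓘(ℝ, ℝ).prod (𝓡 n)) (𝓡∂ (n + 1)) ∞ C.toFun
    (Ico (0 : ℝ) 1 ×ˢ (univ : Set Y)) := by
  have h := C.smooth; rwa [C.source_eq] at h

theorem mdifferentiableAt_toFun {s : ℝ} (hs : s ∈ Ioo (0 : ℝ) 1) (θ : Y) :
    MDifferentiableAt (𝓘(ℝ, ℝ).prod (𝓡 n)) (𝓡∂ (n + 1)) C.toFun (s, θ) := by
  have h : Ico (0 : ℝ) 1 ×ˢ (univ : Set Y) ∈ 𝓝 (s, θ) :=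
    prod_mem_nhds (Ico_mem_nhds hs.1 hs.2) univ_mem
  exact (C.contMDiffOn_toFun.contMDiffAt h).mdifferentiableAt (by simp)

variable {C}

/-- A function which is smooth in the interior and a sum on the collar. -/
theorem memFunSum_of_collar {w a b : ℕ∞} {f : X → ℂ}
    (hf : ContMDiffOn (𝓡∂ (n + 1)) 𝓘(ℝ, ℂ) ∞ f ((𝓡∂ (n + 1)).interior X))
    {f₁ : ℝ → ℂ} {f₂ : ℝ × Y → ℂ}
    (h₁ : MemWeightedSmooth 𝓘(ℝ, ℝ) radialRegion (w + a) f₁)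
    (h₂ : MemWeightedSmooth (𝓘(ℝ, ℝ).prod (𝓡 n)) (cylinder Y) (w + b) f₂)
    (e : ∀ s ∈ Ioo (0 : ℝ) 1, ∀ θ : Y, f (C.toFun (s, θ)) = f₁ s + f₂ (s, θ)) :
    C.MemFunSum w a b f := by
  refine ⟨fun k hk => ?_, f₁, f₂, h₁, h₂, e⟩
  obtain ⟨a₁, ha₁, e₁⟩ := h₁ k (hk.trans le_self_add)
  obtain ⟨a₂, ha₂, e₂⟩ := h₂ k (hk.trans le_self_add)
  classical
  -- The quotient ρ⁻ᵏf extended over the boundary by its collar expansion. The two formulas agree on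
  -- the overlap, and the open sets `C.target` and the interior cover X.
  set A : X → ℂ := fun x => if x ∈ C.target then a₁ (C.invFun x).1 + a₂ (C.invFun x)
    else (C.bdf x ^ k)⁻¹ • f x with hA
  have hAt : ∀ x ∈ C.target, A x = a₁ (C.invFun x).1 + a₂ (C.invFun x) := fun x hx => by
    simp [hA, hx]
  have hAi : ∀ x ∈ (𝓡∂ (n + 1)).interior X, A x = (C.bdf x ^ k)⁻¹ • f x := by
    intro x hx
    by_cases hxt : x ∈ C.target
    · obtain ⟨s, hs, θ, rfl⟩ := C.interior_eq_iUnion hxt hx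
      have hinv : C.invFun (C.toFun (s, θ)) = (s, θ) :=
        C.left_inv' (C.mem_source ⟨hs.1.le, hs.2⟩ θ)
      have h1 := e₁ s hs
      have h2 := e₂ (s, θ) ⟨hs, mem_univ _⟩
      rw [hAt _ hxt, hinv, e s hs θ, h1, h2, C.bdf_collar s ⟨hs.1.le, hs.2⟩]
      have : s ^ k ≠ 0 := pow_ne_zero k hs.1.ne'
      simp only [radialRegion, cylinder]
      rw [← smul_add, smul_smul, inv_mul_cancel₀ this, one_smul]
    · simp [hA, hxt]
  refine ⟨A, fun x _ => ContMDiffAt.contMDiffWithinAt ?_, fun x hx => ?_⟩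
  · rcases C.mem_target_or_interior x with hx | hx
    · have h1 : ContMDiffOn (𝓡∂ (n + 1)) 𝓘(ℝ, ℂ) ∞
          (fun x => a₁ (C.invFun x).1 + a₂ (C.invFun x)) C.target := by
        refine ContMDiffOn.add ?_ ?_
        · exact ha₁.comp (contMDiff_fst.comp_contMDiffOn C.smooth_symm)
            fun x hx => (C.invFun_mem hx).1
        · exact ha₂.comp C.smooth_symm fun x hx => C.invFun_mem hx
      exact (h1.congr hAt).contMDiffAt (C.isOpen_target.mem_nhds hx)
    · have h1 : ContMDiffOn (𝓡∂ (n + 1)) 𝓘(ℝ, ℂ) ∞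
          (fun x => (C.bdf x ^ k)⁻¹ • f x) ((𝓡∂ (n + 1)).interior X) := by
        suffices h : ContMDiffOn (𝓡∂ (n + 1)) 𝓘(ℝ, ℝ) ∞ (fun x => (C.bdf x ^ k)⁻¹)
            ((𝓡∂ (n + 1)).interior X) from h.smul hf
        intro z hz
        have hz0 : C.bdf z ^ k ≠ 0 := pow_ne_zero k (C.bdf_pos_iff.2 hz).ne'
        have h2 := ((C.bdf_smooth.pow k).contMDiffAt (x := z)).contMDiffWithinAt
          (s := (𝓡∂ (n + 1)).interior X)
        exact (contDiffAt_inv ℝ hz0).contMDiffAt.comp_contMDiffWithinAt z h2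
      exact (h1.congr hAi).contMDiffAt (isOpen_interior_manifold.mem_nhds hx)
  · rw [hAi x hx, smul_smul]
    have : C.bdf x ^ k ≠ 0 := pow_ne_zero k (C.bdf_pos_iff.2 hx).ne'
    simp only [region]
    rw [mul_inv_cancel₀ this, one_smul]

theorem MemFunSum.mono {w a b a' b' : ℕ∞} {f : X → ℂ} (hf : C.MemFunSum w a b f) (ha : a' ≤ a)
    (hb : b' ≤ b) : C.MemFunSum w a' b' f := by
  obtain ⟨h, f₁, f₂, h₁, h₂, e⟩ := hf
  exact ⟨h, f₁, f₂, h₁.mono (by gcongr), h₂.mono (by gcongr), e⟩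

theorem MemFunSum.add {w a b : ℕ∞} {f f' : X → ℂ} (hf : C.MemFunSum w a b f)
    (hf' : C.MemFunSum w a b f') : C.MemFunSum w a b (fun x => f x + f' x) := by
  obtain ⟨h, f₁, f₂, h₁, h₂, e⟩ := hf
  obtain ⟨h', f₁', f₂', h₁', h₂', e'⟩ := hf'
  refine ⟨h.add h', _, _, h₁.add h₁', h₂.add h₂', fun s hs θ => ?_⟩
  beta_reduce
  rw [e s hs, e' s hs]
  ring

theorem MemFunSum.const_mul {w a b : ℕ∞} {f : X → ℂ} (hf : C.MemFunSum w a b f) (c : ℂ) :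
    C.MemFunSum w a b (fun x => c * f x) := by
  obtain ⟨h, f₁, f₂, h₁, h₂, e⟩ := hf
  refine ⟨h.const_mul c, _, _, h₁.const_mul c, h₂.const_mul c, fun s hs θ => ?_⟩
  beta_reduce
  rw [e s hs, mul_add]

theorem MemFunSum.memDiffSum {w a b : ℕ∞} {f : X → ℂ} (hf : C.MemFunSum w a b f) (m : ℕ) :
    C.MemDiffSum m w a b (fun u x => f x * u x) := by
  obtain ⟨h, f₁, f₂, h₁, h₂, e⟩ := hf
  refine ⟨h.memWeightedDiffB m, _, _, h₁.memWeightedDiffB m, h₂.memWeightedDiffB m,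
    fun u _ s hs θ => ?_⟩
  beta_reduce
  rw [e s hs, add_mul]

theorem MemDiffSum.mono {m : ℕ} {w a b a' b' : ℕ∞} {A : Op X} (hA : C.MemDiffSum m w a b A)
    (ha : a' ≤ a) (hb : b' ≤ b) : C.MemDiffSum m w a' b' A := by
  obtain ⟨h, f₁, f₂, h₁, h₂, e⟩ := hA
  exact ⟨h, f₁, f₂, h₁.mono (by gcongr), h₂.mono (by gcongr), e⟩

theorem MemDiffSum.add {m : ℕ} {w a b : ℕ∞} {A A' : Op X} (hA : C.MemDiffSum m w a b A)
    (hA' : C.MemDiffSum m w a b A') : C.MemDiffSum m w a b (fun u x => A u x + A' u x) := by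
  obtain ⟨h, f₁, f₂, h₁, h₂, e⟩ := hA
  obtain ⟨h', f₁', f₂', h₁', h₂', e'⟩ := hA'
  refine ⟨h.add h', _, _, h₁.add h₁', h₂.add h₂', fun u hu s hs θ => ?_⟩
  beta_reduce
  rw [e u hu s hs, e' u hu s hs]
  ring

theorem MemDiffSum.const_mul {m : ℕ} {w a b : ℕ∞} {A : Op X} (hA : C.MemDiffSum m w a b A)
    (c : ℂ) : C.MemDiffSum m w a b (fun u x => c * A u x) := by
  obtain ⟨h, f₁, f₂, h₁, h₂, e⟩ := hA
  refine ⟨h.const_mul c, _, _, h₁.const_mul c, h₂.const_mul c, fun u hu s hs θ => ?_⟩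
  beta_reduce
  rw [e u hu s hs, mul_add]

theorem SmoothInside.comp_toFun {u : X → ℂ} (hu : SmoothInside (𝓡∂ (n + 1)) C.region u) :
    SmoothInside (𝓘(ℝ, ℝ).prod (𝓡 n)) (cylinder Y) (fun p => u (C.toFun p)) :=
  ContMDiffOn.comp (t := (𝓡∂ (n + 1)).interior X) hu
    (C.contMDiffOn_toFun.mono (prod_mono Ioo_subset_Ico_self Subset.rfl))
    fun p hp => C.toFun_mem_interior hp.1 p.2

theorem SmoothInside.comp_toFun_radial {u : X → ℂ}
    (hu : SmoothInside (𝓡∂ (n + 1)) C.region u) (θ : Y) :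
    SmoothInside 𝓘(ℝ, ℝ) radialRegion (fun t => u (C.toFun (t, θ))) :=
  ContMDiffOn.comp (t := (cylinder Y).inner) (SmoothInside.comp_toFun hu)
    (contMDiffOn_id.prodMk contMDiffOn_const) fun _ ht => ⟨ht, mem_univ _⟩

/-- The commutator of an operator of first order with the phase. -/
theorem MemDiffSum.commFun_phase {w a b : ℕ∞} {A : Op X} (hA : C.MemDiffSum 1 (1 + w) a b A)
    (m : ℝ) : C.MemFunSum w a b (commFun A fun x => (phaseFn m (C.bdf x) : ℂ)) := by
  obtain ⟨h, A₁, A₂, h₁, h₂, e⟩ := hA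
  rw [add_assoc] at h₁ h₂
  have k := C.region_isRegular.smoothInside_phase m
  refine ⟨h.commFun_phase C.region_isRegular m, _, _,
    h₁.commFun_phase radialRegion_isRegular m, h₂.commFun_phase (cylinder_isRegular n Y) m,
    fun s hs θ => ?_⟩
  have e1 := e _ k s hs θ
  have e2 := e _ (smoothInside_const 1) s hs θ
  -- In the collar the phase of X is the phase of each of the two model regions, but only for 0 < t
  -- < 1; `congr_arg` disregards the other values.
  have e3 : A₁ (fun t => (phaseFn m (C.region.bdf (C.toFun (t, θ))) : ℂ)) s
      = A₁ (fun t => (phaseFn m (radialRegion.bdf t) : ℂ)) s :=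
    h₁.congr_arg radialRegion_isRegular (radialRegion_isRegular.smoothInside_phase m)
      (fun t ht => by
        have : C.region.bdf (C.toFun (t, θ)) = t := C.bdf_collar t ⟨ht.1.le, ht.2⟩ θ
        rw [this]; rfl) hs
  have e4 : A₂ (fun p => (phaseFn m (C.region.bdf (C.toFun p)) : ℂ)) (s, θ)
      = A₂ (fun p => (phaseFn m ((cylinder Y).bdf p) : ℂ)) (s, θ) :=
    h₂.congr_arg (cylinder_isRegular n Y) ((cylinder_isRegular n Y).smoothInside_phase m)
      (fun t ht => by
        have : C.region.bdf (C.toFun t) = t.1 := C.bdf_collar t.1 ⟨ht.1.1.le, ht.1.2⟩ t.2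
        rw [this]; rfl) ⟨hs, mem_univ _⟩
  beta_reduce at e1
  rw [e3, e4] at e1
  have e5 : C.bdf (C.toFun (s, θ)) = s := C.bdf_collar s ⟨hs.1.le, hs.2⟩ θ
  have e1' : A (fun x => (phaseFn m (C.bdf x) : ℂ)) (C.toFun (s, θ)) = _ := e1
  rw [commFun, commFun, commFun, e1', e2, e5]
  simp only [radialRegion, cylinder]
  ring

end Collar

end Glue
end AsympConic

end

noncomputable section
namespace AsympConic

set_option linter.unusedSectionVars false

/-! ## Vector fields on a manifold with a collar -/

theorem contMDiffOn_of_vectorSpace_section {EP HP P V : Type*}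
    [NormedAddCommGroup EP] [NormedSpace ℝ EP] [TopologicalSpace HP]
    {IP : ModelWithCorners ℝ EP HP} [TopologicalSpace P] [ChartedSpace HP P]
    [NormedAddCommGroup V] [NormedSpace ℝ V]
    {ψ ν : P → V} {U : Set P} (h : ContMDiffOn IP 𝓘(ℝ, V).tangent ∞
      (fun q => (⟨ψ q, ν q⟩ : TangentBundle 𝓘(ℝ, V) V)) U) :
    ContMDiffOn IP 𝓘(ℝ, V) ∞ ν U := by
  intro q hq
  have h1 := h q hq
  rw [Bundle.contMDiffWithinAt_totalSpace] at h1
  simpa using h1.2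

/-- The derivative of a smooth function along a smooth field. -/
theorem contMDiffOn_mfderiv_apply {E H M : Type*} [NormedAddCommGroup E] [NormedSpace ℝ E]
    [TopologicalSpace H] [TopologicalSpace M] [ChartedSpace H M] {I : ModelWithCorners ℝ E H}
    [IsManifold I ∞ M] {S : Set M} (hS : IsOpen S) {f : M → ℝ} (hf : ContMDiffOn I 𝓘(ℝ, ℝ) ∞ f S)
    {V : (x : M) → TangentSpace I x}
    (hV : ContMDiffOn I I.tangent ∞ (fun x => (⟨x, V x⟩ : TangentBundle I M)) S) :
    ContMDiffOn I 𝓘(ℝ, ℝ) ∞ (fun x => (mfderiv I 𝓘(ℝ, ℝ) f x (V x) : ℝ)) S := by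
  have h1 := contMDiffOn_of_vectorSpace_section (V := ℝ)
    (contMDiffOn_pushforward (ψ := fun x => x) hf hS.uniqueMDiffOn hV (mapsTo_id S))
  refine h1.congr fun x hx => ?_
  rw [mfderivWithin_of_isOpen hS hx]

theorem IsBVectorField.add {E H M : Type*} [NormedAddCommGroup E] [NormedSpace ℝ E]
    [TopologicalSpace H] [TopologicalSpace M] [ChartedSpace H M] {I : ModelWithCorners ℝ E H}
    [IsManifold I ∞ M] {D : Region M} {V W : (x : M) → TangentSpace I x}
    (hV : IsBVectorField I D V) (hW : IsBVectorField I D W) :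
    IsBVectorField I D (fun x => V x + W x) := by
  obtain ⟨f, hf, e⟩ := hV.tangent
  obtain ⟨f', hf', e'⟩ := hW.tangent
  refine ⟨ContMDiffOn.add_section hV.smooth hW.smooth, _, hf.add hf', fun x hx => ?_⟩
  refine (map_add (mfderivWithin I 𝓘(ℝ, ℝ) D.bdf D.carrier x) (V x) (W x)).trans ?_
  refine (congrArg₂ (· + ·) (e x hx) (e' x hx)).trans ?_
  exact (mul_add (D.bdf x) (f x) (f' x)).symm

/-- α∂_ρ is a b-vector field only after one factor ρ has been spent: ρ^{1+k}a ∂_ρ = ρ^k·a·(ρ∂_ρ). -/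
theorem memWeightedField_radial {l : ℕ∞} {α : ℝ → ℝ}
    (h : MemWeightedSmooth 𝓘(ℝ, ℝ) radialRegion (1 + l) α) :
    MemWeightedField 𝓘(ℝ, ℝ) radialRegion l α := by
  intro k hk
  obtain ⟨a, ha, e⟩ := h (1 + k) (by push_cast; gcongr)
  refine ⟨fun s => s * a s, ⟨?_, a, ha, fun s hs => ?_⟩, fun s hs => ?_⟩
  · exact contMDiffOn_vectorSpace_section contMDiffOn_id (contMDiffOn_id.mul ha)
  · have : mfderivWithin 𝓘(ℝ, ℝ) 𝓘(ℝ, ℝ) radialRegion.bdf radialRegion.carrier s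
        = ContinuousLinearMap.id ℝ ℝ :=
      mfderivWithin_id ((uniqueMDiffOn_iff_uniqueDiffOn.2 (uniqueDiffOn_Ico 0 1)) s hs)
    exact congrArg (fun L : ℝ →L[ℝ] ℝ => L (s * a s)) this
  · refine (e s hs).trans ?_
    change s ^ (1 + k) * a s = s ^ k * (s * a s)
    ring

section Glue

variable {n : ℕ} {X Y : Type*}
  [TopologicalSpace X] [ChartedSpace (EuclideanHalfSpace (n + 1)) X]
  [IsManifold (𝓡∂ (n + 1)) ∞ X]
  [TopologicalSpace Y] [ChartedSpace (EuclideanSpace ℝ (Fin n)) Y] [IsManifold (𝓡 n) ∞ Y]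

variable (n Y) in
/-- The field `α ∂_ρ` on the cylinder. -/
def radialLift (α : ℝ → ℝ) (p : ℝ × Y) : TangentSpace (𝓘(ℝ, ℝ).prod (𝓡 n)) p :=
  ((α p.1, 0) : ℝ × EuclideanSpace ℝ (Fin n))

theorem contMDiffOn_radialLift {α : ℝ → ℝ} {S : Set ℝ} (hα : ContMDiffOn 𝓘(ℝ, ℝ) 𝓘(ℝ, ℝ) ∞ α S) :
    ContMDiffOn (𝓘(ℝ, ℝ).prod (𝓡 n)) (𝓘(ℝ, ℝ).prod (𝓡 n)).tangent ∞
      (fun p => (⟨p, radialLift n Y α p⟩ : TangentBundle (𝓘(ℝ, ℝ).prod (𝓡 n)) (ℝ × Y)))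
      (S ×ˢ univ) := by
  have h1 : ContMDiffOn (𝓘(ℝ, ℝ).prod (𝓡 n)) 𝓘(ℝ, ℝ).tangent ∞
      (fun p : ℝ × Y => (⟨p.1, α p.1⟩ : TangentBundle 𝓘(ℝ, ℝ) ℝ)) (S ×ˢ univ) :=
    contMDiffOn_vectorSpace_section contMDiffOn_fst (hα.comp contMDiffOn_fst fun p hp => hp.1)
  have h2 : ContMDiffOn (𝓘(ℝ, ℝ).prod (𝓡 n)) (𝓡 n).tangent ∞
      (fun p : ℝ × Y => (⟨p.2, 0⟩ : TangentBundle (𝓡 n) Y)) (S ×ˢ univ) :=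
    (Bundle.contMDiff_zeroSection ℝ (TangentSpace (𝓡 n) : Y → Type _)).comp_contMDiffOn
      contMDiffOn_snd
  exact (contMDiff_equivTangentBundleProd_symm (𝕜 := ℝ)).comp_contMDiffOn (h1.prodMk h2)

theorem mfderivWithin_bdf_cylinder {p : ℝ × Y} (hp : p ∈ (cylinder Y).carrier)
    (v : TangentSpace (𝓘(ℝ, ℝ).prod (𝓡 n)) p) :
    (mfderivWithin (𝓘(ℝ, ℝ).prod (𝓡 n)) 𝓘(ℝ, ℝ) (cylinder Y).bdf (cylinder Y).carrier p v : ℝ)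
      = (show ℝ × EuclideanSpace ℝ (Fin n) from v).1 := by
  have h := mfderivWithin_fst (I := 𝓘(ℝ, ℝ)) (I' := 𝓡 n) (uniqueMDiffOn_cylinder n Y p hp)
  exact congrArg (fun L : (ℝ × EuclideanSpace ℝ (Fin n)) →L[ℝ] ℝ => L v) h

theorem memWeightedField_radialLift {l : ℕ∞} {α : ℝ → ℝ}
    (h : MemWeightedSmooth 𝓘(ℝ, ℝ) radialRegion (1 + l) α) :
    MemWeightedField (𝓘(ℝ, ℝ).prod (𝓡 n)) (cylinder Y) l (radialLift n Y α) := by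
  intro k hk
  obtain ⟨a, ha, e⟩ := h (1 + k) (by push_cast; gcongr)
  refine ⟨radialLift n Y (fun s => s * a s), ⟨?_, fun p => a p.1, ?_, fun p hp => ?_⟩,
    fun p hp => ?_⟩
  · exact contMDiffOn_radialLift (contMDiffOn_id.mul ha)
  · exact ha.comp contMDiffOn_fst fun p hp => hp.1
  · exact mfderivWithin_bdf_cylinder hp _
  · refine Prod.ext ?_ (smul_zero _).symm
    refine (e p.1 hp.1).trans ?_
    change p.1 ^ (1 + k) * a p.1 = p.1 ^ k * (p.1 * a p.1)
    ring

namespace Collar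

variable (C : Collar n X Y)

/-- The field on the target of the collar that corresponds to a field on the cylinder. -/
def push (V : (p : ℝ × Y) → TangentSpace (𝓘(ℝ, ℝ).prod (𝓡 n)) p) (x : X) :
    TangentSpace (𝓡∂ (n + 1)) x :=
  (show EuclideanSpace ℝ (Fin (n + 1)) from
    mfderivWithin (𝓘(ℝ, ℝ).prod (𝓡 n)) (𝓡∂ (n + 1)) C.toFun (Ico (0 : ℝ) 1 ×ˢ (univ : Set Y))
      (C.invFun x) (V (C.invFun x)))

theorem contMDiffOn_push {V : (p : ℝ × Y) → TangentSpace (𝓘(ℝ, ℝ).prod (𝓡 n)) p}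
    {S : Set (ℝ × Y)} {U : Set X} (hU : U ⊆ C.target) (hUS : MapsTo C.invFun U S)
    (hV : ContMDiffOn (𝓘(ℝ, ℝ).prod (𝓡 n)) (𝓘(ℝ, ℝ).prod (𝓡 n)).tangent ∞
      (fun p => (⟨p, V p⟩ : TangentBundle (𝓘(ℝ, ℝ).prod (𝓡 n)) (ℝ × Y))) S) :
    ContMDiffOn (𝓡∂ (n + 1)) (𝓡∂ (n + 1)).tangent ∞
      (fun x => (⟨x, C.push V x⟩ : TangentBundle (𝓡∂ (n + 1)) X)) U := by
  have h1 := contMDiffOn_pushforward (ψ := C.invFun) (U := U) C.contMDiffOn_toFun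
    (uniqueMDiffOn_cylinder n Y) (hV.comp (C.smooth_symm.mono hU) hUS)
    (fun x hx => C.invFun_mem (hU hx))
  exact h1.congr fun x hx => totalSpace_mk_congr (C.right_inv' (hU hx)).symm rfl

theorem push_toFun {s : ℝ} (hs : s ∈ Ioo (0 : ℝ) 1) (θ : Y)
    (V : (p : ℝ × Y) → TangentSpace (𝓘(ℝ, ℝ).prod (𝓡 n)) p) :
    C.push V (C.toFun (s, θ))
      = mfderiv (𝓘(ℝ, ℝ).prod (𝓡 n)) (𝓡∂ (n + 1)) C.toFun (s, θ) (V (s, θ)) := by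
  have hinv : C.invFun (C.toFun (s, θ)) = (s, θ) :=
    C.left_inv' (C.mem_source ⟨hs.1.le, hs.2⟩ θ)
  have h : Ico (0 : ℝ) 1 ×ˢ (univ : Set Y) ∈ 𝓝 (s, θ) :=
    prod_mem_nhds (Ico_mem_nhds hs.1 hs.2) univ_mem
  -- The base point is generalized before substitution, since the derivative and the vector both
  -- have types depending on it.
  have key : ∀ p, p = (s, θ) → (show EuclideanSpace ℝ (Fin (n + 1)) from
      mfderivWithin (𝓘(ℝ, ℝ).prod (𝓡 n)) (𝓡∂ (n + 1)) C.toFun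
        (Ico (0 : ℝ) 1 ×ˢ (univ : Set Y)) p (V p))
      = (show EuclideanSpace ℝ (Fin (n + 1)) from
        mfderiv (𝓘(ℝ, ℝ).prod (𝓡 n)) (𝓡∂ (n + 1)) C.toFun (s, θ) (V (s, θ))) := by
    rintro _ rfl
    rw [mfderivWithin_of_mem_nhds h]
  exact key _ hinv

/-- The chain rule for ρ ∘ collar, which is the first projection on the half-open cylinder. The
derivative is taken within the cylinder so that the boundary ρ = 0 is included. -/
theorem mfderiv_bdf_push {x : X} (hx : x ∈ C.target)
    (V : (p : ℝ × Y) → TangentSpace (𝓘(ℝ, ℝ).prod (𝓡 n)) p) :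
    (mfderiv (𝓡∂ (n + 1)) 𝓘(ℝ, ℝ) C.bdf x (C.push V x) : ℝ)
      = (show ℝ × EuclideanSpace ℝ (Fin n) from V (C.invFun x)).1 := by
  obtain ⟨p, hp, rfl⟩ : ∃ p ∈ Ico (0 : ℝ) 1 ×ˢ (univ : Set Y), C.toFun p = x :=
    ⟨_, C.invFun_mem hx, C.right_inv' hx⟩
  have hinv : C.invFun (C.toFun p) = p := C.left_inv' (C.mem_source hp.1 p.2)
  have h1 : mfderivWithin (𝓘(ℝ, ℝ).prod (𝓡 n)) 𝓘(ℝ, ℝ) (C.bdf ∘ C.toFun)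
      (Ico (0 : ℝ) 1 ×ˢ (univ : Set Y)) p
      = (mfderiv (𝓡∂ (n + 1)) 𝓘(ℝ, ℝ) C.bdf (C.toFun p)).comp
        (mfderivWithin (𝓘(ℝ, ℝ).prod (𝓡 n)) (𝓡∂ (n + 1)) C.toFun
          (Ico (0 : ℝ) 1 ×ˢ (univ : Set Y)) p) :=
    mfderiv_comp_mfderivWithin p ((C.bdf_smooth _).mdifferentiableAt (by simp))
      ((C.contMDiffOn_toFun p hp).mdifferentiableWithinAt (by simp))
      (uniqueMDiffOn_cylinder n Y p hp)
  have h2 : mfderivWithin (𝓘(ℝ, ℝ).prod (𝓡 n)) 𝓘(ℝ, ℝ) (C.bdf ∘ C.toFun)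
      (Ico (0 : ℝ) 1 ×ˢ (univ : Set Y)) p
      = mfderivWithin (𝓘(ℝ, ℝ).prod (𝓡 n)) 𝓘(ℝ, ℝ) (cylinder Y).bdf
      (cylinder Y).carrier p :=
    mfderivWithin_congr (fun q hq => C.bdf_collar q.1 hq.1 q.2) (C.bdf_collar p.1 hp.1 p.2)
  have h3 := mfderivWithin_bdf_cylinder (n := n) (p := p) hp (V p)
  rw [← h2] at h3
  have h4 : (mfderiv (𝓡∂ (n + 1)) 𝓘(ℝ, ℝ) C.bdf (C.toFun p)
      (mfderivWithin (𝓘(ℝ, ℝ).prod (𝓡 n)) (𝓡∂ (n + 1)) C.toFun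
          (Ico (0 : ℝ) 1 ×ˢ (univ : Set Y)) p (V p)) : ℝ)
      = (show ℝ × EuclideanSpace ℝ (Fin n) from V p).1 :=
    (congrArg (fun L : (ℝ × EuclideanSpace ℝ (Fin n)) →L[ℝ] ℝ => L (V p)) h1).symm.trans h3
  have key : ∀ q, q = p → (show EuclideanSpace ℝ (Fin (n + 1)) from
      mfderivWithin (𝓘(ℝ, ℝ).prod (𝓡 n)) (𝓡∂ (n + 1)) C.toFun
        (Ico (0 : ℝ) 1 ×ˢ (univ : Set Y)) q (V q))
      = (show EuclideanSpace ℝ (Fin (n + 1)) from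
        mfderivWithin (𝓘(ℝ, ℝ).prod (𝓡 n)) (𝓡∂ (n + 1)) C.toFun
        (Ico (0 : ℝ) 1 ×ˢ (univ : Set Y)) p (V p)) := by
    rintro _ rfl; rfl
  have key2 : ∀ q, q = p → (show ℝ × EuclideanSpace ℝ (Fin n) from V q).1
      = (show ℝ × EuclideanSpace ℝ (Fin n) from V p).1 := by
    rintro _ rfl; rfl
  rw [key2 _ hinv]
  refine Eq.trans ?_ h4
  exact congrArg (show EuclideanSpace ℝ (Fin (n + 1)) → ℝ from
    mfderiv (𝓡∂ (n + 1)) 𝓘(ℝ, ℝ) C.bdf (C.toFun p)) (key _ hinv)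

variable {C}

/-- A field which is smooth in the interior and weighted on the collar. -/
theorem memWeightedField_of_collar {l : ℕ∞} {W : (x : X) → TangentSpace (𝓡∂ (n + 1)) x}
    (hW : ContMDiffOn (𝓡∂ (n + 1)) (𝓡∂ (n + 1)).tangent ∞
      (fun x => (⟨x, W x⟩ : TangentBundle (𝓡∂ (n + 1)) X)) ((𝓡∂ (n + 1)).interior X))
    {V : (p : ℝ × Y) → TangentSpace (𝓘(ℝ, ℝ).prod (𝓡 n)) p}
    (hV : MemWeightedField (𝓘(ℝ, ℝ).prod (𝓡 n)) (cylinder Y) l V)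
    (e : ∀ x ∈ C.target, x ∈ (𝓡∂ (n + 1)).interior X → W x = C.push V x) :
    MemWeightedField (𝓡∂ (n + 1)) C.region l W := by
  intro k hk
  obtain ⟨V', hV', eV⟩ := hV k hk
  obtain ⟨f, hf, ef⟩ := hV'.tangent
  classical
  set A : (x : X) → TangentSpace (𝓡∂ (n + 1)) x := fun x =>
    if x ∈ C.target then C.push V' x else (C.bdf x ^ k)⁻¹ • W x with hA
  have hAt : ∀ x ∈ C.target, A x = C.push V' x := fun x hx => by simp [hA, hx]
  have hAi : ∀ x ∈ (𝓡∂ (n + 1)).interior X, A x = (C.bdf x ^ k)⁻¹ • W x := by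
    intro x hx
    by_cases hxt : x ∈ C.target
    · rw [hAt x hxt, e x hxt hx]
      have h1 := eV (C.invFun x) (C.invFun_mem_inner hxt hx)
      have hb : C.bdf x = (C.invFun x).1 := C.bdf_eq_fst hxt
      have hb0 : C.bdf x ^ k ≠ 0 := pow_ne_zero k (C.bdf_pos_iff.2 hx).ne'
      have h2 : C.push V x = C.bdf x ^ k • C.push V' x := by
        unfold push
        rw [h1, hb]
        exact map_smul (mfderivWithin (𝓘(ℝ, ℝ).prod (𝓡 n)) (𝓡∂ (n + 1)) C.toFun
          (Ico (0 : ℝ) 1 ×ˢ (univ : Set Y)) (C.invFun x)) _ _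
      rw [h2, smul_smul, inv_mul_cancel₀ hb0, one_smul]
    · simp [hA, hxt]
  -- The tangency coefficient. Off the collar ρ is positive and one may divide by it; near the
  -- boundary the coefficient is the one on the cylinder.
  set F : X → ℝ := fun x => if x ∈ C.target then f (C.invFun x) else
    (C.bdf x)⁻¹ * (show ℝ from mfderiv (𝓡∂ (n + 1)) 𝓘(ℝ, ℝ) C.bdf x (A x)) with hF
  have hFt : ∀ x ∈ C.target, F x = f (C.invFun x) := fun x hx => by simp [hF, hx]
  have hFe : ∀ x, (show ℝ from mfderiv (𝓡∂ (n + 1)) 𝓘(ℝ, ℝ) C.bdf x (A x)) = C.bdf x * F x := by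
    intro x
    by_cases hx : x ∈ C.target
    · rw [hAt x hx, hFt x hx]
      refine (C.mfderiv_bdf_push hx V').trans ?_
      rw [C.bdf_eq_fst hx]
      exact (mfderivWithin_bdf_cylinder (C.invFun_mem hx) _).symm.trans (ef _ (C.invFun_mem hx))
    · have hb0 : C.bdf x ≠ 0 :=
        (C.bdf_pos_iff.2 ((C.mem_target_or_interior x).resolve_left hx)).ne'
      simp only [hF, hx, if_false]
      exact (mul_inv_cancel_left₀ hb0 _).symm
  have hAs : ContMDiffOn (𝓡∂ (n + 1)) (𝓡∂ (n + 1)).tangent ∞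
      (fun x => (⟨x, A x⟩ : TangentBundle (𝓡∂ (n + 1)) X)) ((𝓡∂ (n + 1)).interior X) := by
    have h1 : ContMDiffOn (𝓡∂ (n + 1)) 𝓘(ℝ, ℝ) ∞
        (fun x => (C.bdf x ^ k)⁻¹) ((𝓡∂ (n + 1)).interior X) := by
      intro z hz
      have hz0 : C.bdf z ^ k ≠ 0 := pow_ne_zero k (C.bdf_pos_iff.2 hz).ne'
      have h2 := ((C.bdf_smooth.pow k).contMDiffAt (x := z)).contMDiffWithinAt
        (s := (𝓡∂ (n + 1)).interior X)
      exact (contDiffAt_inv ℝ hz0).contMDiffAt.comp_contMDiffWithinAt z h2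
    refine (ContMDiffOn.smul_section h1 hW).congr fun x hx => ?_
    rw [hAi x hx]
    rfl
  refine ⟨A, ⟨fun x _ => ContMDiffAt.contMDiffWithinAt ?_, F, fun x _ =>
    ContMDiffAt.contMDiffWithinAt ?_, fun x _ => ?_⟩, fun x hx => ?_⟩
  · rcases C.mem_target_or_interior x with hx | hx
    · refine ((C.contMDiffOn_push Subset.rfl (fun x hx => C.invFun_mem hx)
        hV'.smooth).congr fun z hz => ?_).contMDiffAt (C.isOpen_target.mem_nhds hx)
      rw [hAt z hz]
    · exact hAs.contMDiffAt (isOpen_interior_manifold.mem_nhds hx)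
  · rcases C.mem_target_or_interior x with hx | hx
    · exact ((hf.comp C.smooth_symm fun x hx => C.invFun_mem hx).congr hFt).contMDiffAt
        (C.isOpen_target.mem_nhds hx)
    · have h1 := contMDiffOn_mfderiv_apply isOpen_interior_manifold C.bdf_smooth.contMDiffOn hAs
      have h2 : ContMDiffOn (𝓡∂ (n + 1)) 𝓘(ℝ, ℝ) ∞
          (fun x => (C.bdf x)⁻¹) ((𝓡∂ (n + 1)).interior X) := fun z hz =>
        (contDiffAt_inv ℝ (C.bdf_pos_iff.2 hz).ne').contMDiffAt.comp_contMDiffWithinAt z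
          (C.bdf_smooth.contMDiffAt (x := z)).contMDiffWithinAt
      refine ((h2.mul h1).congr fun z hz => ?_).contMDiffAt (isOpen_interior_manifold.mem_nhds hx)
      have := hFe z
      refine (eq_inv_mul_iff_mul_eq₀ (C.bdf_pos_iff.2 hz).ne').2 this.symm
  · have : mfderivWithin (𝓡∂ (n + 1)) 𝓘(ℝ, ℝ) C.region.bdf C.region.carrier x
        = mfderiv (𝓡∂ (n + 1)) 𝓘(ℝ, ℝ) C.bdf x :=
      congrFun (mfderivWithin_univ (f := C.bdf)) x
    rw [this]
    exact hFe x
  · have hb0 : C.bdf x ^ k ≠ 0 := pow_ne_zero k (C.bdf_pos_iff.2 hx).ne'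
    rw [hAi x hx]
    simp only [region]
    rw [smul_smul, mul_inv_cancel₀ hb0, one_smul]

theorem applyField_push {V : (p : ℝ × Y) → TangentSpace (𝓘(ℝ, ℝ).prod (𝓡 n)) p} {u : X → ℂ}
    (hu : SmoothInside (𝓡∂ (n + 1)) C.region u) {s : ℝ} (hs : s ∈ Ioo (0 : ℝ) 1) (θ : Y) :
    applyField (𝓡∂ (n + 1)) (C.push V) u (C.toFun (s, θ))
      = applyField (𝓘(ℝ, ℝ).prod (𝓡 n)) V (fun p => u (C.toFun p)) (s, θ) := by
  have h1 : mfderiv (𝓘(ℝ, ℝ).prod (𝓡 n)) 𝓘(ℝ, ℂ) (u ∘ C.toFun) (s, θ)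
      = (mfderiv (𝓡∂ (n + 1)) 𝓘(ℝ, ℂ) u (C.toFun (s, θ))).comp
        (mfderiv (𝓘(ℝ, ℝ).prod (𝓡 n)) (𝓡∂ (n + 1)) C.toFun (s, θ)) :=
    mfderiv_comp (s, θ) (hu.mdifferentiableAt C.region_isRegular (C.toFun_mem_interior hs θ))
      (C.mdifferentiableAt_toFun hs θ)
  unfold applyField
  rw [C.push_toFun hs θ V]
  exact (congrArg (fun L : (ℝ × EuclideanSpace ℝ (Fin n)) →L[ℝ] ℂ => L (V (s, θ))) h1).symm

theorem applyField_radialLift {α : ℝ → ℝ} {v : ℝ × Y → ℂ}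
    (hv : SmoothInside (𝓘(ℝ, ℝ).prod (𝓡 n)) (cylinder Y) v) {s : ℝ} (hs : s ∈ Ioo (0 : ℝ) 1)
    (θ : Y) :
    applyField (𝓘(ℝ, ℝ).prod (𝓡 n)) (radialLift n Y α) v (s, θ)
      = (α s : ℂ) * deriv (fun t => v (t, θ)) s := by
  have h2 : HasMFDerivAt 𝓘(ℝ, ℝ) (𝓘(ℝ, ℝ).prod (𝓡 n)) (fun t : ℝ => ((t, θ) : ℝ × Y)) s
      ((ContinuousLinearMap.id ℝ ℝ).prod (0 : ℝ →L[ℝ] EuclideanSpace ℝ (Fin n))) :=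
    (hasMFDerivAt_id s).prodMk (hasMFDerivAt_const θ s)
  have h1 := (hv.mdifferentiableAt (cylinder_isRegular n Y)
    (x := (s, θ)) ⟨hs, mem_univ _⟩).hasMFDerivAt
  have h3' : HasFDerivAt (fun t => v (t, θ))
      ((show (ℝ × EuclideanSpace ℝ (Fin n)) →L[ℝ] ℂ from
        mfderiv (𝓘(ℝ, ℝ).prod (𝓡 n)) 𝓘(ℝ, ℂ) v (s, θ)).comp
        ((ContinuousLinearMap.id ℝ ℝ).prod (0 : ℝ →L[ℝ] EuclideanSpace ℝ (Fin n)))) s :=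
    (h1.comp s h2).hasFDerivAt
  have h3 := h3'.hasDerivAt.deriv
  have h4 : deriv (fun t => v (t, θ)) s
      = (show (ℝ × EuclideanSpace ℝ (Fin n)) →L[ℝ] ℂ from
        mfderiv (𝓘(ℝ, ℝ).prod (𝓡 n)) 𝓘(ℝ, ℂ) v (s, θ)) (1, 0) := h3
  rw [h4, ← Complex.real_smul, ← map_smul]
  unfold applyField radialLift
  refine congrArg (show (ℝ × EuclideanSpace ℝ (Fin n)) → ℂ from
    mfderiv (𝓘(ℝ, ℝ).prod (𝓡 n)) 𝓘(ℝ, ℂ) v (s, θ)) ?_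
  simp

theorem applyField_real {α : ℝ → ℝ} {v : ℝ → ℂ} (s : ℝ) :
    applyField 𝓘(ℝ, ℝ) α v s = (α s : ℂ) * deriv v s := by
  unfold applyField
  rw [mfderiv_eq_fderiv, ← Complex.real_smul]
  change fderiv ℝ v s (α s) = _
  rw [← fderiv_apply_one_eq_deriv, ← map_smul, smul_eq_mul, mul_one]

/-- The operator of a field which is smooth in the interior and a sum on the collar. -/
theorem memDiffSum_applyField {w a b : ℕ∞} {W : (x : X) → TangentSpace (𝓡∂ (n + 1)) x}
    (hW : ContMDiffOn (𝓡∂ (n + 1)) (𝓡∂ (n + 1)).tangent ∞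
      (fun x => (⟨x, W x⟩ : TangentBundle (𝓡∂ (n + 1)) X)) ((𝓡∂ (n + 1)).interior X))
    {α : ℝ → ℝ} (hα : MemWeightedSmooth 𝓘(ℝ, ℝ) radialRegion (1 + (w + a)) α)
    {η : (p : ℝ × Y) → TangentSpace (𝓘(ℝ, ℝ).prod (𝓡 n)) p}
    (hη : MemWeightedField (𝓘(ℝ, ℝ).prod (𝓡 n)) (cylinder Y) (w + b) η)
    (e : ∀ x ∈ C.target, x ∈ (𝓡∂ (n + 1)).interior X →
      W x = C.push (fun p => radialLift n Y α p + η p) x) :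
    C.MemDiffSum 1 w a b (applyField (𝓡∂ (n + 1)) W) := by
  refine ⟨(memWeightedField_of_collar hW ?_ e).memWeightedDiffB, applyField 𝓘(ℝ, ℝ) α,
    applyField (𝓘(ℝ, ℝ).prod (𝓡 n)) η, (memWeightedField_radial hα).memWeightedDiffB,
    hη.memWeightedDiffB, fun u hu s hs θ => ?_⟩
  · intro k hk
    obtain ⟨V₁, hV₁, e₁⟩ := memWeightedField_radialLift (n := n) (Y := Y) hα k
      (hk.trans le_self_add)
    obtain ⟨V₂, hV₂, e₂⟩ := hη k (hk.trans le_self_add)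
    exact ⟨_, hV₁.add hV₂, fun p hp => by beta_reduce; rw [e₁ p hp, e₂ p hp, smul_add]⟩
  · have h1 : applyField (𝓡∂ (n + 1)) W u (C.toFun (s, θ))
        = applyField (𝓡∂ (n + 1)) (C.push fun p => radialLift n Y α p + η p) u
          (C.toFun (s, θ)) := by
      unfold applyField
      rw [e _ (C.toFun_mem_target ⟨hs.1.le, hs.2⟩ θ) (C.toFun_mem_interior hs θ)]
    rw [h1, applyField_push hu hs θ, applyField_real,
      ← applyField_radialLift (SmoothInside.comp_toFun hu) hs θ]
    unfold applyField
    exact map_add (mfderiv (𝓘(ℝ, ℝ).prod (𝓡 n)) 𝓘(ℝ, ℂ) (fun p => u (C.toFun p)) (s, θ)) _ _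

end Collar

end Glue
end AsympConic

end

noncomputable section
namespace AsympConic

set_option linter.unusedSectionVars false

/-! ## The Laplacian of the phase in scattering coordinates -/

section ScCoordinates

variable {n : ℕ}

/-- The index `Sum.inl ()` is the radial direction. -/
abbrev ScIdx (n : ℕ) : Type := Unit ⊕ Fin n

/-- The coordinate space `[0,1)_ρ × ℝⁿ`. -/
abbrev ScSpace (n : ℕ) : Type := ℝ × EuclideanSpace ℝ (Fin n)

variable (n) in
def scBasis : Module.Basis (ScIdx n) ℝ (ScSpace n) :=
  (Module.Basis.singleton Unit ℝ).prod (EuclideanSpace.basisFun (Fin n) ℝ).toBasis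

theorem scBasis_inl (i : Unit) : scBasis n (Sum.inl i) = (1, 0) := by
  simp [scBasis, Module.Basis.prod_apply]

theorem scBasis_inr (j : Fin n) : scBasis n (Sum.inr j) = (0, EuclideanSpace.single j 1) := by
  simp [scBasis, Module.Basis.prod_apply]

/-- The coefficient of the radial direction. -/
def radCoeff : ScIdx n → ℝ := Sum.elim (fun _ => 1) (fun _ => 0)

/-- The weight of `a ∂_r + r⁻¹ v` under `ρ ∂_ρ`. -/
def scWeight : ScIdx n → ℝ := Sum.elim (fun _ => 2) (fun _ => 1)

/-- `ρ⁻¹` times the scattering frame: the frame of b-vector fields. -/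
def bDir (s : ℝ) : ScIdx n → ScSpace n :=
  Sum.elim (fun _ => (-s, 0)) (fun j => (0, EuclideanSpace.single j 1))

theorem bDir_fst (s : ℝ) (i : ScIdx n) : (bDir s i).1 = -(s * radCoeff i) := by
  rcases i with i | i <;> simp [bDir, radCoeff]

/-- `ρ⁻¹` times the derivative of `G(∂_j, ∂_l)` along `∂_i`, where `∂_i` are coordinate fields and
`G` is evaluated in the scattering frame. -/
def scDer (S : Set (ScSpace n)) (M : ScSpace n → Matrix (ScIdx n) (ScIdx n) ℝ) (p : ScSpace n)
    (i j l : ScIdx n) : ℝ :=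
  fderivWithin ℝ (fun q => M q j l) S p (bDir p.1 i)
    + radCoeff i * (scWeight j + scWeight l) * M p j l

/-- `ρ⁻¹` times the Laplacian of the phase, in terms of the metric `M` in the scattering frame and
of the coefficients `ν` of the gradient of the phase. -/
def scLap (m : ℝ) (S : Set (ScSpace n)) (M : ScSpace n → Matrix (ScIdx n) (ScIdx n) ℝ)
    (ν : ScSpace n → ScIdx n → ℝ) (p : ScSpace n) : ℝ :=
  -∑ i, ∑ j, (M p)⁻¹ i j * ((2 + m / 2 * p.1) * (radCoeff i * radCoeff j)
    - (1 / 2) * ∑ l, ν p l * (scDer S M p i j l + scDer S M p j i l - scDer S M p l i j))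

/-- Congruence of smooth functions modulo `ρ^k`. -/
def CongOn (k : ℕ) (S : Set (ScSpace n)) (f g : ScSpace n → ℝ) : Prop :=
  ContDiffOn ℝ ∞ f S ∧ ContDiffOn ℝ ∞ g S ∧
    ∃ b : ScSpace n → ℝ, ContDiffOn ℝ ∞ b S ∧ ∀ p ∈ S, f p = g p + p.1 ^ k * b p

variable {k : ℕ} {S : Set (ScSpace n)} {f f' g g' : ScSpace n → ℝ}

theorem CongOn.refl (hf : ContDiffOn ℝ ∞ f S) : CongOn k S f f :=
  ⟨hf, hf, 0, contDiffOn_const, by simp⟩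

theorem CongOn.add (h : CongOn k S f g) (h' : CongOn k S f' g') :
    CongOn k S (fun p => f p + f' p) (fun p => g p + g' p) := by
  obtain ⟨h1, h2, b, hb, e⟩ := h
  obtain ⟨h1', h2', b', hb', e'⟩ := h'
  refine ⟨h1.add h1', h2.add h2', _, hb.add hb', fun p hp => ?_⟩
  beta_reduce
  rw [e p hp, e' p hp]
  ring

theorem CongOn.mul (h : CongOn k S f g) (h' : CongOn k S f' g') :
    CongOn k S (fun p => f p * f' p) (fun p => g p * g' p) := by
  obtain ⟨h1, h2, b, hb, e⟩ := h
  obtain ⟨h1', h2', b', hb', e'⟩ := h'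
  refine ⟨h1.mul h1', h2.mul h2', fun p => b p * f' p + g p * b' p,
    (hb.mul h1').add (h2.mul hb'), fun p hp => ?_⟩
  beta_reduce
  rw [e p hp, e' p hp]
  ring

theorem CongOn.const_mul (h : CongOn k S f g) (c : ℝ) :
    CongOn k S (fun p => c * f p) (fun p => c * g p) := (CongOn.refl contDiffOn_const).mul h

theorem CongOn.neg (h : CongOn k S f g) : CongOn k S (fun p => -f p) (fun p => -g p) := by
  simpa using h.const_mul (-1)

theorem CongOn.sub (h : CongOn k S f g) (h' : CongOn k S f' g') :
    CongOn k S (fun p => f p - f' p) (fun p => g p - g' p) := by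
  simpa only [sub_eq_add_neg] using h.add h'.neg

theorem CongOn.sum {κ : Type*} (s : Finset κ) {F G : κ → ScSpace n → ℝ}
    (h : ∀ i, CongOn k S (F i) (G i)) :
    CongOn k S (fun p => ∑ i ∈ s, F i p) (fun p => ∑ i ∈ s, G i p) := by
  classical
  induction s using Finset.induction_on with
  | empty => simpa using CongOn.refl (k := k) (S := S) (f := fun _ => 0) contDiffOn_const
  | insert a s ha ih => simpa only [Finset.sum_insert ha] using (h a).add ih

theorem contDiff_bDir (i : ScIdx n) : ContDiff ℝ ∞ (fun p : ScSpace n => bDir p.1 i) := by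
  rcases i with i | i
  · exact contDiff_fst.neg.prodMk contDiff_const
  · exact contDiff_const

theorem contDiffOn_fderivWithin_bDir (hS : UniqueDiffOn ℝ S) (hf : ContDiffOn ℝ ∞ f S)
    (i : ScIdx n) : ContDiffOn ℝ ∞ (fun p => fderivWithin ℝ f S p (bDir p.1 i)) S :=
  (hf.fderivWithin hS (m := ∞) (by simp)).clm_apply (contDiff_bDir i).contDiffOn

/-- The directions are tangent to ρ = 0: differentiating ρᵏ along `bDir p.1 i` gives −k·radCoeff
i·ρᵏ, so no power is lost. An ordinary ρ-derivative would lose one. -/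
theorem CongOn.fderivWithin (hS : UniqueDiffOn ℝ S) (h : CongOn k S f g) (i : ScIdx n) :
    CongOn k S (fun p => fderivWithin ℝ f S p (bDir p.1 i))
      (fun p => _root_.fderivWithin ℝ g S p (bDir p.1 i)) := by
  obtain ⟨h1, h2, b, hb, e⟩ := h
  refine ⟨contDiffOn_fderivWithin_bDir hS h1 i, contDiffOn_fderivWithin_bDir hS h2 i,
    fun p => _root_.fderivWithin ℝ b S p (bDir p.1 i) - k * radCoeff i * b p, ?_, fun p hp => ?_⟩
  · exact (contDiffOn_fderivWithin_bDir hS hb i).sub (contDiffOn_const.mul hb)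
  · have hg := (h2.differentiableOn (by simp) p hp).hasFDerivWithinAt
    have hb' := (hb.differentiableOn (by simp) p hp).hasFDerivWithinAt
    have hs : HasFDerivWithinAt (fun q : ScSpace n => q.1 ^ k)
        ((k * p.1 ^ (k - 1)) • ContinuousLinearMap.fst ℝ ℝ (EuclideanSpace ℝ (Fin n))) S p := by
      have := (hasDerivAt_pow k p.1).hasFDerivAt.comp p
        (hasFDerivAt_fst (𝕜 := ℝ) (p := p))
      refine (this.congr_fderiv ?_).hasFDerivWithinAt
      ext <;> simp [mul_comm]
    have h3 := ((hg.add (hs.mul hb')).congr (f₁ := f) e (e p hp)).fderivWithin (hS p hp)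
    beta_reduce
    rw [h3]
    simp only [add_apply, smul_apply, ContinuousLinearMap.coe_fst', bDir_fst, smul_eq_mul]
    rcases k with _ | k
    · simp
    · simp only [Nat.add_sub_cancel]
      ring

/-- From M⁻¹(M − M')M'⁻¹ = M'⁻¹ − M⁻¹: the factor ρᵏ of M − M' is inherited by the difference of the
inverses. -/
theorem CongOn.matrix_inv {M M' : ScSpace n → Matrix (ScIdx n) (ScIdx n) ℝ}
    (h : ∀ i j, CongOn k S (fun p => M p i j) (fun p => M' p i j))
    (hM : ∀ p ∈ S, IsUnit (M p).det) (hM' : ∀ p ∈ S, IsUnit (M' p).det) (i j : ScIdx n) :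
    CongOn k S (fun p => (M p)⁻¹ i j) (fun p => (M' p)⁻¹ i j) := by
  have h1 := contDiffOn_matrix_inv (fun i j => (h i j).1) hM
  have h2 := contDiffOn_matrix_inv (fun i j => (h i j).2.1) hM'
  choose b hb e using fun i j => (h i j).2.2
  refine ⟨h1 i j, h2 i j, fun p => -∑ a, ∑ c, (M p)⁻¹ i a * b a c p * (M' p)⁻¹ c j, ?_,
    fun p hp => ?_⟩
  · refine ContDiffOn.neg (ContDiffOn.sum fun a _ => ContDiffOn.sum fun c _ => ?_)
    exact ((h1 i a).mul (hb a c)).mul (h2 c j)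
  · have h3 : M p = M' p + p.1 ^ k • Matrix.of (fun a c => b a c p) := by
      ext a c
      simpa using e a c p hp
    have h4 : (M p)⁻¹ * (M p - M' p) * (M' p)⁻¹ = (M' p)⁻¹ - (M p)⁻¹ := by
      rw [Matrix.mul_sub, Matrix.sub_mul, Matrix.nonsing_inv_mul _ (hM p hp), Matrix.mul_assoc,
        Matrix.mul_nonsing_inv _ (hM' p hp), one_mul, mul_one]
    have h5 := congrFun (congrFun h4 i) j
    have h6 : M p - M' p = p.1 ^ k • Matrix.of (fun a c => b a c p) := by
      rw [h3, add_sub_cancel_left]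
    rw [h6, Matrix.mul_smul, Matrix.smul_mul] at h5
    simp only [Matrix.smul_apply, Matrix.sub_apply, smul_eq_mul, Matrix.mul_apply,
      Matrix.of_apply, Finset.sum_mul] at h5
    rw [Finset.sum_comm] at h5
    beta_reduce
    linarith

theorem CongOn.scDer (hS : UniqueDiffOn ℝ S) {M M' : ScSpace n → Matrix (ScIdx n) (ScIdx n) ℝ}
    (h : ∀ i j, CongOn k S (fun p => M p i j) (fun p => M' p i j)) (i j l : ScIdx n) :
    CongOn k S (fun p => scDer S M p i j l) (fun p => AsympConic.scDer S M' p i j l) :=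
  ((h j l).fderivWithin hS i).add ((h j l).const_mul _)

/-- The purpose of this calculus: `scLap` is built from the metric by inversion, b-derivatives, sums
and products only. A perturbation of order ρᵏ of the metric therefore changes it by order ρᵏ, with
all coefficients smooth up to ρ = 0. -/
theorem CongOn.scLap (hS : UniqueDiffOn ℝ S) {M M' : ScSpace n → Matrix (ScIdx n) (ScIdx n) ℝ}
    (h : ∀ i j, CongOn k S (fun p => M p i j) (fun p => M' p i j))
    (hM : ∀ p ∈ S, IsUnit (M p).det) (hM' : ∀ p ∈ S, IsUnit (M' p).det)
    {ν ν' : ScSpace n → ScIdx n → ℝ}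
    (hν : ∀ l, CongOn k S (fun p => ν p l) (fun p => ν' p l)) (m : ℝ) :
    CongOn k S (scLap m S M ν) (AsympConic.scLap m S M' ν') := by
  refine CongOn.neg (CongOn.sum _ fun i => CongOn.sum _ fun j =>
    (CongOn.matrix_inv h hM hM' i j).mul (CongOn.sub (CongOn.refl ?_)
      (CongOn.const_mul (CongOn.sum _ fun l => (hν l).mul ?_) _)))
  · have : ContDiff ℝ ∞ (fun p : ScSpace n => (2 + m / 2 * p.1) * (radCoeff i * radCoeff j)) := by
      fun_prop
    exact this.contDiffOn
  · exact ((CongOn.scDer hS h i j l).add (CongOn.scDer hS h j i l)).sub (CongOn.scDer hS h l i j)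

/-- The metric `(1 + F) dr² + h` in the scattering frame. -/
def modelMatrix (F : ℝ → ℝ) (H : EuclideanSpace ℝ (Fin n) → Matrix (Fin n) (Fin n) ℝ)
    (p : ScSpace n) : Matrix (ScIdx n) (ScIdx n) ℝ :=
  Matrix.fromBlocks (Matrix.of fun _ _ => 1 + F p.1) 0 0 (H p.2)

theorem modelMatrix_inv {F : ℝ → ℝ} {H : EuclideanSpace ℝ (Fin n) → Matrix (Fin n) (Fin n) ℝ}
    {p : ScSpace n} (hF : 1 + F p.1 ≠ 0) (hH : IsUnit (H p.2).det) :
    (modelMatrix F H p)⁻¹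
      = Matrix.fromBlocks (Matrix.of fun _ _ => (1 + F p.1)⁻¹) 0 0 (H p.2)⁻¹ := by
  refine Matrix.inv_eq_left_inv ?_
  rw [modelMatrix, Matrix.fromBlocks_multiply, Matrix.nonsing_inv_mul _ hH]
  simp only [Matrix.mul_zero, Matrix.zero_mul, add_zero, zero_add]
  rw [← Matrix.fromBlocks_one]
  congr 1
  ext i j
  simp [Matrix.mul_apply, inv_mul_cancel₀ hF]

theorem isUnit_det_modelMatrix {F : ℝ → ℝ}
    {H : EuclideanSpace ℝ (Fin n) → Matrix (Fin n) (Fin n) ℝ}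
    {p : ScSpace n} (hF : 1 + F p.1 ≠ 0) (hH : IsUnit (H p.2).det) :
    IsUnit (modelMatrix F H p).det := by
  rw [modelMatrix, Matrix.det_fromBlocks_zero₂₁]
  simpa [hF] using hH

/-- The coefficients of the gradient of the phase, for a metric with matrix `M`. -/
def gradCoeff (m : ℝ) (M : ScSpace n → Matrix (ScIdx n) (ScIdx n) ℝ) (p : ScSpace n)
    (l : ScIdx n) : ℝ := (1 + m / 2 * p.1) * (M p)⁻¹ l (Sum.inl ())

theorem gradCoeff_modelMatrix (m : ℝ) {F : ℝ → ℝ}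
    {H : EuclideanSpace ℝ (Fin n) → Matrix (Fin n) (Fin n) ℝ}
    {p : ScSpace n} (hF : 1 + F p.1 ≠ 0) (hH : IsUnit (H p.2).det) (l : ScIdx n) :
    gradCoeff m (modelMatrix F H) p l = (1 + m / 2 * p.1) / (1 + F p.1) * radCoeff l := by
  rw [gradCoeff, modelMatrix_inv hF hH]
  rcases l with l | l <;> simp [radCoeff, div_eq_mul_inv]

theorem CongOn.gradCoeff {M M' : ScSpace n → Matrix (ScIdx n) (ScIdx n) ℝ}
    (h : ∀ i j, CongOn k S (fun p => M p i j) (fun p => M' p i j))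
    (hM : ∀ p ∈ S, IsUnit (M p).det) (hM' : ∀ p ∈ S, IsUnit (M' p).det) (m : ℝ) (l : ScIdx n) :
    CongOn k S (fun p => gradCoeff m M p l) (fun p => AsympConic.gradCoeff m M' p l) := by
  refine (CongOn.refl ?_).mul (CongOn.matrix_inv h hM hM' l _)
  have : ContDiff ℝ ∞ (fun p : ScSpace n => 1 + m / 2 * p.1) := by fun_prop
  exact this.contDiffOn

/-- The Laplacian of the phase for the metric `(1 + F) dr² + r² h`. -/
theorem scLap_modelMatrix (m : ℝ) {F : ℝ → ℝ} (hF : ContDiffOn ℝ ∞ F (Ico 0 1))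
    {T : Set (EuclideanSpace ℝ (Fin n))} (hT : IsOpen T)
    {H : EuclideanSpace ℝ (Fin n) → Matrix (Fin n) (Fin n) ℝ}
    (hH : ∀ i j, ContDiffOn ℝ ∞ (fun y => H y i j) T)
    {p : ScSpace n} (hp : p ∈ Ico (0 : ℝ) 1 ×ˢ T) (hF0 : 1 + F p.1 ≠ 0)
    (hH0 : IsUnit (H p.2).det) (hsym : ∀ i j, H p.2 i j = H p.2 j i) :
    scLap m (Ico 0 1 ×ˢ T) (modelMatrix F H) (gradCoeff m (modelMatrix F H)) p
      = m / 2 * p.1 / (1 + F p.1)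
        - 1 / 2 * p.1 * derivWithin F (Ico 0 1) p.1 * (1 + m / 2 * p.1) / (1 + F p.1) ^ 2
        - n * ((1 + m / 2 * p.1) / (1 + F p.1)) := by
  have hS : UniqueDiffOn ℝ (Ico (0 : ℝ) 1 ×ˢ T) := (uniqueDiffOn_Ico 0 1).prod hT.uniqueDiffOn
  have d1 : ∀ i, fderivWithin ℝ (fun q => modelMatrix F H q (Sum.inl ()) (Sum.inl ()))
      (Ico 0 1 ×ˢ T) p (bDir p.1 i) = -(p.1 * radCoeff i) * derivWithin F (Ico 0 1) p.1 := by
    intro i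
    have h1 : HasFDerivWithinAt F
        (ContinuousLinearMap.toSpanSingleton ℝ (derivWithin F (Ico 0 1) p.1)) (Ico 0 1) p.1 :=
      (hF.differentiableOn (by simp) p.1 hp.1).hasDerivWithinAt.hasFDerivWithinAt
    have h2 := (h1.comp p (hasFDerivWithinAt_fst (s := Ico (0 : ℝ) 1 ×ˢ T))
      fun q hq => hq.1).const_add (1 : ℝ)
    have h3 := h2.fderivWithin (hS p hp)
    have h4 : (fun q : ScSpace n => modelMatrix F H q (Sum.inl ()) (Sum.inl ()))
        = fun q => 1 + (F ∘ Prod.fst) q := rfl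
    rw [h4, h3]
    simp [bDir_fst]
  have d2 : ∀ i j, fderivWithin ℝ (fun q => modelMatrix F H q (Sum.inr i) (Sum.inr j))
      (Ico 0 1 ×ˢ T) p (bDir p.1 (Sum.inl ())) = 0 := by
    intro i j
    have h1 := ((hH i j).differentiableOn (by simp) p.2 hp.2).hasFDerivWithinAt
    have h2 := h1.comp p (hasFDerivWithinAt_snd (s := Ico (0 : ℝ) 1 ×ˢ T)) fun q hq => hq.2
    have h3 := h2.fderivWithin (hS p hp)
    have h4 : (fun q : ScSpace n => modelMatrix F H q (Sum.inr i) (Sum.inr j))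
        = (fun y => H y i j) ∘ Prod.snd := rfl
    rw [h4, h3]
    simp [bDir]
  have hsum : ∑ i, ∑ j, (H p.2)⁻¹ i j * H p.2 i j = (n : ℝ) := by
    have h1 := congrArg Matrix.trace (Matrix.nonsing_inv_mul _ hH0)
    rw [Matrix.trace_one, Fintype.card_fin] at h1
    simp only [Matrix.trace, Matrix.diag_apply, Matrix.mul_apply] at h1
    rw [← h1]
    exact Finset.sum_congr rfl fun i _ => Finset.sum_congr rfl fun j _ => by rw [hsym]
  -- The gradient for the block-diagonal model is radial, so only the radial index contributes.
  have hq : ∀ i j, ∑ l, gradCoeff m (modelMatrix F H) p l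
      * (scDer (Ico 0 1 ×ˢ T) (modelMatrix F H) p i j l
        + scDer (Ico 0 1 ×ˢ T) (modelMatrix F H) p j i l
        - scDer (Ico 0 1 ×ˢ T) (modelMatrix F H) p l i j)
      = (1 + m / 2 * p.1) / (1 + F p.1) * (scDer (Ico 0 1 ×ˢ T) (modelMatrix F H) p i j (Sum.inl ())
        + scDer (Ico 0 1 ×ˢ T) (modelMatrix F H) p j i (Sum.inl ())
        - scDer (Ico 0 1 ×ˢ T) (modelMatrix F H) p (Sum.inl ()) i j) := by
    intro i j
    rw [Fintype.sum_sum_type]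
    simp [gradCoeff_modelMatrix m hF0 hH0, radCoeff]
  have hrr : ∀ i j, scDer (Ico 0 1 ×ˢ T) (modelMatrix F H) p (Sum.inr i) (Sum.inr j) (Sum.inl ())
      = 0 := by
    intro i j
    have h4 : (fun q : ScSpace n => modelMatrix F H q (Sum.inr j) (Sum.inl ())) = fun _ => 0 := rfl
    rw [scDer, h4]
    simp [radCoeff]
  -- The two angular weights contribute 1 + 1: this is ∂_r(r²h) = 2rh. Its trace yields n, the
  -- source of the term −n/r in △φ.
  have h0r : ∀ i j, scDer (Ico 0 1 ×ˢ T) (modelMatrix F H) p (Sum.inl ()) (Sum.inr i) (Sum.inr j)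
      = 2 * H p.2 i j := by
    intro i j
    rw [scDer, d2]
    simp [radCoeff, scWeight, modelMatrix]
    norm_num
  have h00 : scDer (Ico 0 1 ×ˢ T) (modelMatrix F H) p (Sum.inl ()) (Sum.inl ()) (Sum.inl ())
      = -p.1 * derivWithin F (Ico 0 1) p.1 + 4 * (1 + F p.1) := by
    rw [scDer, d1]
    simp [radCoeff, scWeight, modelMatrix]
    norm_num
  have hsum' : ∑ i, ∑ j, (H p.2)⁻¹ i j * (2⁻¹ * ((1 + m / 2 * p.1) / (1 + F p.1)
      * (2 * H p.2 i j))) = n * ((1 + m / 2 * p.1) / (1 + F p.1)) := by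
    rw [← hsum, Finset.sum_mul]
    refine Finset.sum_congr rfl fun i _ => ?_
    rw [Finset.sum_mul]
    exact Finset.sum_congr rfl fun j _ => by ring
  rw [scLap]
  simp only [hq, modelMatrix_inv hF0 hH0, Fintype.sum_sum_type, Finset.univ_unique,
    Finset.sum_singleton, Matrix.fromBlocks_apply₁₁, Matrix.fromBlocks_apply₁₂,
    Matrix.fromBlocks_apply₂₁, Matrix.fromBlocks_apply₂₂, Matrix.zero_apply, zero_mul,
    Finset.sum_const_zero, add_zero, zero_add, Matrix.of_apply, PUnit.default_eq_unit, hrr, h0r,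
    h00]
  simp only [radCoeff, Sum.elim_inl, Sum.elim_inr, mul_zero, mul_one, zero_sub, one_div, mul_neg,
    neg_neg, hsum']
  field_simp
  ring

end ScCoordinates
end AsympConic

end

noncomputable section
namespace AsympConic

set_option linter.unusedSectionVars false

/-! ### Derivatives of the metric and of the phase along the scattering frame -/

section ScFrame

variable {n : ℕ}

/-- The scattering frame `∂_r, r⁻¹ ∂_j`. -/
def scFrame (s : ℝ) : ScIdx n → ScSpace n :=
  Sum.elim (fun _ => (-(s ^ 2), 0)) (fun j => (0, s • EuclideanSpace.single j 1))

theorem scFrame_eq (s : ℝ) (i : ScIdx n) : scFrame s i = s • bDir s i := by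
  rcases i with i | i <;> simp [scFrame, bDir, sq]

theorem scFrame_fst (s : ℝ) (i : ScIdx n) : (scFrame s i).1 = -(s ^ 2 * radCoeff i) := by
  rcases i with i | i <;> simp [scFrame, radCoeff]

theorem exists_scFrame_basis {s : ℝ} (hs : s ≠ 0) :
    ∃ b : Module.Basis (ScIdx n) ℝ (ScSpace n), ⇑b = scFrame s := by
  have hw : ∀ i : ScIdx n, IsUnit (Sum.elim (fun _ => -(s ^ 2)) (fun _ => s) i : ℝ) := by
    rintro (i | i) <;> simp [hs]
  refine ⟨(scBasis n).isUnitSMul hw, ?_⟩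
  ext1 i
  rw [Module.Basis.isUnitSMul_apply]
  rcases i with i | i
  · rw [scBasis_inl]; simp [scFrame]
  · rw [scBasis_inr]; simp [scFrame]

/-- The frame vectors are homogeneous in ρ of degree `scWeight`, and ∂_r = −ρ²∂_ρ maps ρ^w to
−wρ^{w+1}; the angular directions do not differentiate them. -/
theorem hasFDerivAt_scFrame (p : ScSpace n) (i : ScIdx n) :
    ∃ L : ScSpace n →L[ℝ] ScSpace n, HasFDerivAt (fun q : ScSpace n => scFrame q.1 i) L p ∧
      ∀ j, L (scFrame p.1 j) = (-(p.1 * radCoeff j * scWeight i)) • scFrame p.1 i := by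
  have h1 : HasFDerivAt (fun q : ScSpace n => q.1)
      (ContinuousLinearMap.fst ℝ ℝ (EuclideanSpace ℝ (Fin n))) p := hasFDerivAt_fst
  rcases i with i | i
  · refine ⟨_, ((h1.pow 2).neg).prodMk (hasFDerivAt_const _ _), fun j => ?_⟩
    refine Prod.ext ?_ ?_
    · simp [scFrame_fst, scWeight, radCoeff]
      ring
    · simp [scFrame]
  · refine ⟨_, (hasFDerivAt_const _ _).prodMk (h1.smul_const _), fun j => ?_⟩
    refine Prod.ext ?_ ?_
    · simp [scFrame]
    · simp [scFrame_fst, scWeight]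
      simp only [scFrame, Sum.elim_inr]
      module

variable {G : ScSpace n → ScSpace n →L[ℝ] ScSpace n →L[ℝ] ℝ} {S : Set (ScSpace n)}
  {M : ScSpace n → Matrix (ScIdx n) (ScIdx n) ℝ} {p : ScSpace n}

/-- Derivatives of a metric along the scattering frame. -/
theorem fderiv_scFrame (hG : DifferentiableAt ℝ G p) (hS : S ∈ 𝓝 p)
    (hM : ∀ᶠ q in 𝓝 p, ∀ i j, M q i j = G q (scFrame q.1 i) (scFrame q.1 j)) (i j l : ScIdx n) :
    fderiv ℝ (fun q => G q (scFrame p.1 j) (scFrame p.1 l)) p (scFrame p.1 i)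
      = p.1 * scDer S M p i j l := by
  obtain ⟨Lj, hj, ej⟩ := hasFDerivAt_scFrame p j
  obtain ⟨Ll, hl, el⟩ := hasFDerivAt_scFrame p l
  have h1 := (hG.hasFDerivAt.clm_apply hj).clm_apply hl
  have e1 : (fun q => M q j l) =ᶠ[𝓝 p] fun q => G q (scFrame q.1 j) (scFrame q.1 l) :=
    hM.mono fun q hq => hq j l
  have h2 : fderivWithin ℝ (fun q => M q j l) S p = _ :=
    (fderivWithin_of_mem_nhds hS).trans (e1.fderiv_eq.trans h1.fderiv)
  have h3 : fderiv ℝ (fun q => G q (scFrame p.1 j) (scFrame p.1 l)) p (scFrame p.1 i)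
      = fderiv ℝ G p (scFrame p.1 i) (scFrame p.1 j) (scFrame p.1 l) := by
    have := ((hG.hasFDerivAt.clm_apply (hasFDerivAt_const (scFrame p.1 j) p)).clm_apply
      (hasFDerivAt_const (scFrame p.1 l) p)).fderiv
    rw [this]
    simp
  have h4 : p.1 * fderivWithin ℝ (fun q => M q j l) S p (bDir p.1 i)
      = fderivWithin ℝ (fun q => M q j l) S p (scFrame p.1 i) := by
    rw [scFrame_eq, map_smul, smul_eq_mul]
  rw [scDer, mul_add, h4, h2, h3, hM.self_of_nhds j l]
  simp [ej, el]
  ring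

theorem fderiv_phaseFn_fst (m : ℝ) (hp : p.1 ≠ 0) (v : ScSpace n) :
    fderiv ℝ (fun q : ScSpace n => phaseFn m q.1) p v
      = (-(p.1 ^ 2)⁻¹ - m / 2 * p.1⁻¹) * v.1 := by
  have h := ((hasDerivAt_phaseFn m hp).hasFDerivAt.comp p
    (hasFDerivAt_fst (𝕜 := ℝ) (p := p))).fderiv
  have e : (fun q : ScSpace n => phaseFn m q.1) = phaseFn m ∘ Prod.fst := rfl
  rw [e, h]
  simp [mul_comm]

theorem fderiv_phaseFn_scFrame (m : ℝ) (hp : p.1 ≠ 0) (i : ScIdx n) :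
    fderiv ℝ (fun q : ScSpace n => phaseFn m q.1) p (scFrame p.1 i)
      = (1 + m / 2 * p.1) * radCoeff i := by
  rw [fderiv_phaseFn_fst m hp, scFrame_fst]
  field_simp
  ring

theorem fderiv_fderiv_phaseFn (m : ℝ) (hp : p.1 ≠ 0) (i j : ScIdx n) :
    fderiv ℝ (fun q => fderiv ℝ (fun q : ScSpace n => phaseFn m q.1) q (scFrame p.1 j)) p
      (scFrame p.1 i) = p.1 * ((2 + m / 2 * p.1) * (radCoeff i * radCoeff j)) := by
  have e : (fun q : ScSpace n => fderiv ℝ (fun q : ScSpace n => phaseFn m q.1) q (scFrame p.1 j))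
      =ᶠ[𝓝 p] (fun t : ℝ => (-(t ^ 2)⁻¹ - m / 2 * t⁻¹) * (scFrame p.1 j).1) ∘ Prod.fst := by
    filter_upwards [continuous_fst.continuousAt.eventually_ne hp] with q hq
    exact fderiv_phaseFn_fst m hq _
  have h1 : HasDerivAt (fun t : ℝ => (-(t ^ 2)⁻¹ - m / 2 * t⁻¹) * (scFrame p.1 j).1)
      ((-(-(2 * p.1) / (p.1 ^ 2) ^ 2) - m / 2 * (-(p.1 ^ 2)⁻¹)) * (scFrame p.1 j).1) p.1 := by
    have h2 := ((hasDerivAt_pow 2 p.1).inv (pow_ne_zero 2 hp)).neg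
    refine HasDerivAt.mul_const (HasDerivAt.sub ?_ ((hasDerivAt_inv hp).const_mul _)) _
    exact h2.congr_deriv (by simp)
  have h3 := (h1.hasFDerivAt.comp p (hasFDerivAt_fst (𝕜 := ℝ) (p := p))).fderiv
  rw [e.fderiv_eq, h3]
  simp [scFrame_fst]
  field_simp

/-- In the scattering frame dφ is (1 + 𝔪ρ/2)dr, a multiple of the first covector, so the gradient is
that multiple of the radial column of M⁻¹. It suffices to test on the frame, which is a basis
because ρ ≠ 0. -/
theorem gradCoeff_spec (m : ℝ) (hp : p.1 ≠ 0) (hdet : IsUnit (M p).det)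
    (hM : ∀ i j, M p i j = G p (scFrame p.1 i) (scFrame p.1 j))
    (hsym : ∀ i j, M p i j = M p j i) (z : ScSpace n) :
    G p (∑ l, gradCoeff m M p l • scFrame p.1 l) z
      = fderiv ℝ (fun q : ScSpace n => phaseFn m q.1) p z := by
  obtain ⟨b, hb⟩ := exists_scFrame_basis (n := n) hp
  have key : (G p (∑ l, gradCoeff m M p l • scFrame p.1 l) : ScSpace n →ₗ[ℝ] ℝ)
      = (fderiv ℝ (fun q : ScSpace n => phaseFn m q.1) p : ScSpace n →ₗ[ℝ] ℝ) := by
    refine b.ext fun i => ?_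
    rw [hb]
    simp only [ContinuousLinearMap.coe_coe]
    rw [fderiv_phaseFn_scFrame m hp, map_sum, sum_apply]
    have h1 : ∀ l, (G p (gradCoeff m M p l • scFrame p.1 l)) (scFrame p.1 i)
        = (1 + m / 2 * p.1) * (M p i l * (M p)⁻¹ l (Sum.inl ())) := by
      intro l
      rw [map_smul, smul_apply, ← hM, gradCoeff, hsym, smul_eq_mul]
      ring
    rw [Finset.sum_congr rfl fun l _ => h1 l, ← Finset.mul_sum, ← Matrix.mul_apply,
      Matrix.mul_nonsing_inv _ hdet]
    rcases i with i | i <;> simp [radCoeff]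
  exact congrArg (fun L : ScSpace n →ₗ[ℝ] ℝ => L z) key

/-- Every derivative along the scattering frame is ρ times one along a b-direction, and the second
derivatives of the phase also carry a factor ρ. Hence the whole trace is ρ times an expression that
makes sense at ρ = 0. -/
theorem traceForm_phase (m : ℝ) (hp : p.1 ≠ 0) (hG : DifferentiableAt ℝ G p) (hS : S ∈ 𝓝 p)
    (hM : ∀ᶠ q in 𝓝 p, ∀ i j, M q i j = G q (scFrame q.1 i) (scFrame q.1 j))
    {b : ScIdx n → ScSpace n} (hb : b = scFrame p.1) :
    -traceForm (G p) (hessForm G (fun q : ScSpace n => phaseFn m q.1) p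
      (∑ l, gradCoeff m M p l • scFrame p.1 l)) b
      = p.1 * scLap m S M (gradCoeff m M) p := by
  subst hb
  have hgram : gram (G p) (scFrame p.1) = M p := by
    ext i j
    rw [gram, Matrix.of_apply, hM.self_of_nhds]
  have hd : ∀ v w : ScSpace n, DifferentiableAt ℝ (fun q => G q v w) p := fun v w =>
    (hG.clm_apply (differentiableAt_const v)).clm_apply (differentiableAt_const w)
  have h1 : ∀ i j, fderiv ℝ (fun q => G q (scFrame p.1 j)
      (∑ l, gradCoeff m M p l • scFrame p.1 l)) p (scFrame p.1 i)
      = p.1 * ∑ l, gradCoeff m M p l * scDer S M p i j l := by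
    intro i j
    have e : (fun q => G q (scFrame p.1 j) (∑ l, gradCoeff m M p l • scFrame p.1 l))
        = fun q => ∑ l, gradCoeff m M p l * G q (scFrame p.1 j) (scFrame p.1 l) := by
      ext q
      rw [map_sum]
      simp only [map_smul, smul_eq_mul]
    rw [e, fderiv_fun_sum fun l _ => (hd _ _).const_mul _, sum_apply, Finset.mul_sum]
    refine Finset.sum_congr rfl fun l _ => ?_
    rw [fderiv_const_mul (hd _ _), smul_apply, fderiv_scFrame hG hS hM, smul_eq_mul]
    ring
  have h2 : ∀ i j, fderiv ℝ (fun q => G q (scFrame p.1 i) (scFrame p.1 j)) p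
      (∑ l, gradCoeff m M p l • scFrame p.1 l)
      = p.1 * ∑ l, gradCoeff m M p l * scDer S M p l i j := by
    intro i j
    rw [map_sum, Finset.mul_sum]
    refine Finset.sum_congr rfl fun l _ => ?_
    rw [map_smul, fderiv_scFrame hG hS hM, smul_eq_mul]
    ring
  rw [traceForm, hgram, scLap, mul_neg, Finset.mul_sum]
  congr 1
  refine Finset.sum_congr rfl fun i _ => ?_
  rw [Finset.mul_sum]
  refine Finset.sum_congr rfl fun j _ => ?_
  rw [hessForm, fderiv_fderiv_phaseFn m hp, h1, h1, h2]
  simp only [mul_sub, mul_add, Finset.sum_sub_distrib, Finset.sum_add_distrib]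
  ring

end ScFrame
end AsympConic

end

noncomputable section
namespace AsympConic

set_option linter.unusedSectionVars false

/-! ## Charts of the cylinder -/

/-- Smoothness of the components of a field of bilinear forms. -/
theorem contDiffOn_bilin_pushforward {E H M V : Type*} [NormedAddCommGroup E] [NormedSpace ℝ E]
    [TopologicalSpace H] {I : ModelWithCorners ℝ E H} [TopologicalSpace M] [ChartedSpace H M]
    [IsManifold I ∞ M] [NormedAddCommGroup V] [NormedSpace ℝ V]
    {β : (x : M) → TangentSpace I x →L[ℝ] TangentSpace I x →L[ℝ] ℝ} {S : Set M}
    (hβ : ContMDiffOn I (I.prod 𝓘(ℝ, E →L[ℝ] E →L[ℝ] ℝ)) ∞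
      (fun x => Bundle.TotalSpace.mk' (E →L[ℝ] E →L[ℝ] ℝ)
        (E := fun x : M => TangentSpace I x →L[ℝ] TangentSpace I x →L[ℝ] ℝ) x (β x)) S)
    {Ψ : V → M} {Ω : Set V} (hΨ : ContMDiffOn 𝓘(ℝ, V) I ∞ Ψ Ω) (hΩ : UniqueDiffOn ℝ Ω)
    (hm : MapsTo Ψ Ω S) (v w : V) :
    ContDiffOn ℝ ∞ (fun q => β (Ψ q) (mfderivWithin 𝓘(ℝ, V) I Ψ Ω q v)
      (mfderivWithin 𝓘(ℝ, V) I Ψ Ω q w)) Ω := by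
  have hG := hβ.comp hΨ hm
  have hvec : ∀ v : V, ContMDiffOn 𝓘(ℝ, V) I.tangent ∞
      (fun q => (⟨Ψ q, mfderivWithin 𝓘(ℝ, V) I Ψ Ω q v⟩ : TangentBundle I M)) Ω := fun v =>
    contMDiffOn_pushforward (ψ := fun q => q) hΨ hΩ.uniqueMDiffOn
      (contMDiffOn_vectorSpace_section contMDiffOn_id contMDiffOn_const) (mapsTo_id _)
  have := ContMDiffOn.clm_bundle_apply₂ (F₃ := ℝ) (E₃ := Bundle.Trivial M ℝ) hG (hvec v) (hvec w)
  rw [← contMDiffOn_iff_contDiffOn]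
  intro q hq
  have h1 := this q hq
  rw [Bundle.contMDiffWithinAt_totalSpace] at h1
  exact h1.2

section Chart

variable {n : ℕ} {X Y : Type*}
  [TopologicalSpace X] [ChartedSpace (EuclideanHalfSpace (n + 1)) X]
  [IsManifold (𝓡∂ (n + 1)) ∞ X]
  [TopologicalSpace Y] [ChartedSpace (EuclideanSpace ℝ (Fin n)) Y] [IsManifold (𝓡 n) ∞ Y]

/-- The range of the chart of `Y` at `θ₀`. -/
def chartDom (n : ℕ) {Y : Type*} [TopologicalSpace Y]
    [ChartedSpace (EuclideanSpace ℝ (Fin n)) Y] (θ₀ : Y) : Set (EuclideanSpace ℝ (Fin n)) :=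
  (extChartAt (𝓡 n) θ₀).target

theorem isOpen_chartDom (θ₀ : Y) : IsOpen (chartDom n θ₀) := isOpen_extChartAt_target θ₀

/-- The derivative of the inverse of the chart of `Y` at `θ₀`. -/
def chartDer (n : ℕ) {Y : Type*} [TopologicalSpace Y] [ChartedSpace (EuclideanSpace ℝ (Fin n)) Y]
    (θ₀ : Y) (y : EuclideanSpace ℝ (Fin n)) :
    EuclideanSpace ℝ (Fin n) →L[ℝ] EuclideanSpace ℝ (Fin n) :=
  mfderivWithin 𝓘(ℝ, EuclideanSpace ℝ (Fin n)) (𝓡 n) (extChartAt (𝓡 n) θ₀).symm (chartDom n θ₀) y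

theorem bijective_chartDer {θ₀ : Y} {y : EuclideanSpace ℝ (Fin n)} (hy : y ∈ chartDom n θ₀) :
    Function.Bijective (chartDer n θ₀ y) := by
  have : IsManifold (𝓡 n) 1 Y := IsManifold.of_le (n := ∞) (by simp)
  have h := isInvertible_mfderivWithin_extChartAt_symm (I := 𝓡 n) hy
  have e : chartDer n θ₀ y = mfderivWithin 𝓘(ℝ, EuclideanSpace ℝ (Fin n)) (𝓡 n)
      (extChartAt (𝓡 n) θ₀).symm (range (𝓡 n)) y := by
    unfold chartDer
    rw [mfderivWithin_of_isOpen (isOpen_chartDom θ₀) hy, ModelWithCorners.Boundaryless.range_eq_univ,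
      mfderivWithin_univ]
  rw [e]
  exact h.bijective

/-- The inverse of the chart of the cylinder. -/
def cylChart (n : ℕ) {Y : Type*} [TopologicalSpace Y] [ChartedSpace (EuclideanSpace ℝ (Fin n)) Y]
    (θ₀ : Y) (p : ScSpace n) : ℝ × Y :=
  (p.1, (extChartAt (𝓡 n) θ₀).symm p.2)

/-- The domain of the chart of the cylinder. -/
def cylDom (n : ℕ) {Y : Type*} [TopologicalSpace Y] [ChartedSpace (EuclideanSpace ℝ (Fin n)) Y]
    (θ₀ : Y) : Set (ScSpace n) :=
  Ico (0 : ℝ) 1 ×ˢ chartDom n θ₀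

theorem uniqueDiffOn_cylDom (θ₀ : Y) : UniqueDiffOn ℝ (cylDom n θ₀) :=
  (uniqueDiffOn_Ico 0 1).prod (isOpen_chartDom θ₀).uniqueDiffOn

theorem cylDom_mem_nhds {θ₀ : Y} {p : ScSpace n} (hp : p ∈ Ioo (0 : ℝ) 1 ×ˢ chartDom n θ₀) :
    cylDom n θ₀ ∈ 𝓝 p :=
  prod_mem_nhds (Ico_mem_nhds hp.1.1 hp.1.2) ((isOpen_chartDom θ₀).mem_nhds hp.2)

theorem contMDiffOn_chartSymm (θ₀ : Y) : ContMDiffOn 𝓘(ℝ, EuclideanSpace ℝ (Fin n)) (𝓡 n) ∞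
    (extChartAt (𝓡 n) θ₀).symm (chartDom n θ₀) := contMDiffOn_extChartAt_symm θ₀

theorem contMDiffOn_cylChart (θ₀ : Y) : ContMDiffOn 𝓘(ℝ, ScSpace n) (𝓘(ℝ, ℝ).prod (𝓡 n)) ∞
    (cylChart n θ₀) (cylDom n θ₀) :=
  (contDiff_fst.contMDiff.contMDiffOn).prodMk
    ((contMDiffOn_chartSymm θ₀).comp contDiff_snd.contMDiff.contMDiffOn fun _ hp => hp.2)

theorem cylChart_mem {θ₀ : Y} {p : ScSpace n} (hp : p ∈ cylDom n θ₀) :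
    cylChart n θ₀ p ∈ (cylinder Y).carrier := ⟨hp.1, mem_univ _⟩

/-- The derivative of the inverse of the chart of the cylinder. -/
def cylDer (n : ℕ) {Y : Type*} [TopologicalSpace Y] [ChartedSpace (EuclideanSpace ℝ (Fin n)) Y]
    (θ₀ : Y) (p : ScSpace n) : ScSpace n →L[ℝ] ScSpace n :=
  (ContinuousLinearMap.id ℝ ℝ).prodMap (chartDer n θ₀ p.2)

theorem cylDer_apply (θ₀ : Y) (p v : ScSpace n) :
    cylDer n θ₀ p v = (v.1, chartDer n θ₀ p.2 v.2) := rfl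

theorem bijective_cylDer {θ₀ : Y} {p : ScSpace n} (hp : p.2 ∈ chartDom n θ₀) :
    Function.Bijective (cylDer n θ₀ p) := by
  have h := Function.Bijective.prodMap (Function.bijective_id (α := ℝ)) (bijective_chartDer hp)
  exact h

theorem hasMFDerivWithinAt_cylChart {θ₀ : Y} {p : ScSpace n} (hp : p ∈ cylDom n θ₀) :
    HasMFDerivWithinAt 𝓘(ℝ, ScSpace n) (𝓘(ℝ, ℝ).prod (𝓡 n)) (cylChart n θ₀) (cylDom n θ₀) p
      (cylDer n θ₀ p) := by
  have h1 : HasMFDerivWithinAt 𝓘(ℝ, ScSpace n) 𝓘(ℝ, ℝ) (fun q : ScSpace n => q.1)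
      (cylDom n θ₀) p (ContinuousLinearMap.fst ℝ ℝ (EuclideanSpace ℝ (Fin n))) :=
    hasFDerivAt_fst.hasFDerivWithinAt.hasMFDerivWithinAt
  have h2 : HasMFDerivWithinAt 𝓘(ℝ, ScSpace n) 𝓘(ℝ, EuclideanSpace ℝ (Fin n))
      (fun q : ScSpace n => q.2) (cylDom n θ₀) p
      (ContinuousLinearMap.snd ℝ ℝ (EuclideanSpace ℝ (Fin n))) :=
    hasFDerivAt_snd.hasFDerivWithinAt.hasMFDerivWithinAt
  have h3 := ((contMDiffOn_chartSymm θ₀ p.2 hp.2).mdifferentiableWithinAt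
    (by simp)).hasMFDerivWithinAt
  have h4 := HasMFDerivWithinAt.comp p h3 h2 fun q hq => hq.2
  exact h1.prodMk h4

theorem mfderivWithin_cylChart {θ₀ : Y} {p : ScSpace n} (hp : p ∈ cylDom n θ₀) :
    mfderivWithin 𝓘(ℝ, ScSpace n) (𝓘(ℝ, ℝ).prod (𝓡 n)) (cylChart n θ₀) (cylDom n θ₀) p
      = cylDer n θ₀ p :=
  (hasMFDerivWithinAt_cylChart hp).mfderivWithin (uniqueDiffOn_cylDom θ₀ p hp).uniqueMDiffWithinAt

/-- The coefficients of the boundary metric. -/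
def bdryMatrix (h : BoundaryMetric n Y) (θ₀ : Y) (y : EuclideanSpace ℝ (Fin n)) :
    Matrix (Fin n) (Fin n) ℝ :=
  Matrix.of fun i j => h.inner ((extChartAt (𝓡 n) θ₀).symm y)
    (chartDer n θ₀ y (EuclideanSpace.single i 1)) (chartDer n θ₀ y (EuclideanSpace.single j 1))

theorem contDiffOn_bdryMatrix (h : BoundaryMetric n Y) (θ₀ : Y) (i j : Fin n) :
    ContDiffOn ℝ ∞ (fun y => bdryMatrix h θ₀ y i j) (chartDom n θ₀) :=
  contDiffOn_bilin_pushforward (β := h.inner) h.contMDiff.contMDiffOn (contMDiffOn_chartSymm θ₀)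
    (isOpen_chartDom θ₀).uniqueDiffOn (mapsTo_univ _ _) _ _

theorem bdryMatrix_symm (h : BoundaryMetric n Y) (θ₀ : Y) (y : EuclideanSpace ℝ (Fin n))
    (i j : Fin n) : bdryMatrix h θ₀ y i j = bdryMatrix h θ₀ y j i := h.symm _ _ _

/-- The value of the boundary metric, as a bilinear form on the model space. -/
def bdryForm (h : BoundaryMetric n Y) (θ : Y) :
    EuclideanSpace ℝ (Fin n) →L[ℝ] EuclideanSpace ℝ (Fin n) →L[ℝ] ℝ := h.inner θ

theorem isUnit_det_bdryMatrix (h : BoundaryMetric n Y) {θ₀ : Y} {y : EuclideanSpace ℝ (Fin n)}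
    (hy : y ∈ chartDom n θ₀) : IsUnit (bdryMatrix h θ₀ y).det := by
  set G : EuclideanSpace ℝ (Fin n) →L[ℝ] EuclideanSpace ℝ (Fin n) →L[ℝ] ℝ :=
    (bdryForm h ((extChartAt (𝓡 n) θ₀).symm y)).bilinearComp (chartDer n θ₀ y)
      (chartDer n θ₀ y) with hG
  have h1 : bdryMatrix h θ₀ y = gram G (EuclideanSpace.basisFun (Fin n) ℝ).toBasis := by
    have hb : ∀ i, (EuclideanSpace.basisFun (Fin n) ℝ).toBasis i = EuclideanSpace.single i 1 :=
      fun i => by simp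
    ext i j
    rw [gram, Matrix.of_apply, hb, hb]
    rfl
  rw [h1]
  refine isUnit_det_gram (fun v hv => ?_) (Module.Basis.linearIndependent _)
  exact h.pos _ _ fun h0 => hv ((bijective_chartDer hy).1 (h0.trans (map_zero _).symm))

/-- The value of a field of bilinear forms, as a bilinear form on the model space. -/
def scForm (κ : ScBilinField n Y) (p : ℝ × Y) : ScSpace n →L[ℝ] ScSpace n →L[ℝ] ℝ := κ p

theorem contDiffOn_scForm {κ : ScBilinField n Y} (hκ : ScSmooth κ) (θ₀ : Y) (v w : ScSpace n) :
    ContDiffOn ℝ ∞ (fun p => scForm κ (cylChart n θ₀ p) (cylDer n θ₀ p v) (cylDer n θ₀ p w))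
      (cylDom n θ₀) := by
  refine (contDiffOn_bilin_pushforward hκ (contMDiffOn_cylChart θ₀) (uniqueDiffOn_cylDom θ₀)
    (fun p hp => cylChart_mem hp) v w).congr fun p hp => ?_
  have h := mfderivWithin_cylChart hp
  have hv := congrArg (fun L : ScSpace n →L[ℝ] ScSpace n => L v) h
  have hw := congrArg (fun L : ScSpace n →L[ℝ] ScSpace n => L w) h
  exact (congrArg₂ (fun a b : ScSpace n => scForm κ (cylChart n θ₀ p) a b) hv hw).symm

/-- A normal form of the metric on the collar, with radial part `(1 + F) dr²`, and modulo `ρ^k`. -/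
structure IsNormalForm (C : Collar n X Y) (h : BoundaryMetric n Y) (g : BilinField n X)
    (F : ℝ → ℝ) (k : ℕ) (κ : ScBilinField n Y) (c : ℝ → ℝ) : Prop where
  smooth_radial : ContDiffOn ℝ ∞ F (Ico 0 1)
  radial_zero : F 0 = 0
  radial_pos : ∀ s ∈ Ico (0 : ℝ) 1, 0 < 1 + F s
  pos : 1 ≤ k
  smooth : ScSmooth κ
  smooth_coeff : ContDiffOn ℝ ∞ c (Ico 0 1)
  eq : ∀ s ∈ Ioo (0 : ℝ) 1, ∀ (θ : Y) (v w : ScSpace n),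
    bilinAt g (C.toFun (s, θ)) (C.scVector (s, θ) v) (C.scVector (s, θ) w) =
      (1 + F s) * (v.1 * w.1) + bdryForm h θ v.2 w.2
        + s ^ k * (scForm κ (s, θ) v w + c s * (v.1 * w.1))

/-- `dr²`. -/
def radForm (n : ℕ) : ScSpace n →L[ℝ] ScSpace n →L[ℝ] ℝ :=
  (ContinuousLinearMap.fst ℝ ℝ (EuclideanSpace ℝ (Fin n))).smulRight
    (ContinuousLinearMap.fst ℝ ℝ (EuclideanSpace ℝ (Fin n)))

theorem radForm_apply (v w : ScSpace n) : radForm n v w = v.1 * w.1 := by simp [radForm]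

/-- The metric in normal form. -/
def normalForm (h : BoundaryMetric n Y) (F : ℝ → ℝ) (k : ℕ) (κ : ScBilinField n Y) (c : ℝ → ℝ)
    (p : ℝ × Y) : ScSpace n →L[ℝ] ScSpace n →L[ℝ] ℝ :=
  (1 + F p.1) • radForm n
    + (bdryForm h p.2).bilinearComp (ContinuousLinearMap.snd ℝ ℝ (EuclideanSpace ℝ (Fin n)))
      (ContinuousLinearMap.snd ℝ ℝ (EuclideanSpace ℝ (Fin n)))
    + p.1 ^ k • (scForm κ p + c p.1 • radForm n)

theorem normalForm_apply (h : BoundaryMetric n Y) (F : ℝ → ℝ) (k : ℕ) (κ : ScBilinField n Y)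
    (c : ℝ → ℝ) (p : ℝ × Y) (v w : ScSpace n) :
    normalForm h F k κ c p v w = (1 + F p.1) * (v.1 * w.1) + bdryForm h p.2 v.2 w.2
        + p.1 ^ k * (scForm κ p v w + c p.1 * (v.1 * w.1)) := by
  have h1 : normalForm h F k κ c p v w
      = (1 + F p.1) * radForm n v w + bdryForm h p.2 v.2 w.2
        + p.1 ^ k * (scForm κ p v w + c p.1 * radForm n v w) := rfl
  rw [h1, radForm_apply]

namespace Collar

variable (C : Collar n X Y)

theorem injective_mfderiv_toFun {s : ℝ} (hs : s ∈ Ioo (0 : ℝ) 1) (θ : Y) :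
    Function.Injective (show ScSpace n → EuclideanSpace ℝ (Fin (n + 1)) from
      mfderiv (𝓘(ℝ, ℝ).prod (𝓡 n)) (𝓡∂ (n + 1)) C.toFun (s, θ)) := by
  have h1 := C.mdifferentiableAt_toFun hs θ
  have ht := C.toFun_mem_target ⟨hs.1.le, hs.2⟩ θ
  have h2 : MDifferentiableAt (𝓡∂ (n + 1)) (𝓘(ℝ, ℝ).prod (𝓡 n)) C.invFun (C.toFun (s, θ)) :=
    (C.smooth_symm.contMDiffAt (C.isOpen_target.mem_nhds ht)).mdifferentiableAt (by simp)
  have h3 := mfderiv_comp (s, θ) h2 h1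
  have h4 : C.invFun ∘ C.toFun =ᶠ[𝓝 (s, θ)] id := by
    filter_upwards [prod_mem_nhds (Ico_mem_nhds hs.1 hs.2) (univ_mem (f := 𝓝 θ))] with q hq
    exact C.left_inv' (C.mem_source hq.1 q.2)
  rw [h4.mfderiv_eq, mfderiv_id] at h3
  intro v w hvw
  have h5 := congrArg (fun L : ScSpace n →L[ℝ] ScSpace n => L v) h3
  have h6 := congrArg (fun L : ScSpace n →L[ℝ] ScSpace n => L w) h3
  have h7 : v = (show EuclideanSpace ℝ (Fin (n + 1)) → ScSpace n from
    mfderiv (𝓡∂ (n + 1)) (𝓘(ℝ, ℝ).prod (𝓡 n)) C.invFun (C.toFun (s, θ))) _ := h5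
  have h8 : w = (show EuclideanSpace ℝ (Fin (n + 1)) → ScSpace n from
    mfderiv (𝓡∂ (n + 1)) (𝓘(ℝ, ℝ).prod (𝓡 n)) C.invFun (C.toFun (s, θ))) _ := h6
  rw [h7, h8]
  exact congrArg (show EuclideanSpace ℝ (Fin (n + 1)) → ScSpace n from
    mfderiv (𝓡∂ (n + 1)) (𝓘(ℝ, ℝ).prod (𝓡 n)) C.invFun (C.toFun (s, θ))) hvw

theorem scVector_ne_zero {s : ℝ} (hs : s ∈ Ioo (0 : ℝ) 1) (θ : Y) {v : ScSpace n} (hv : v ≠ 0) :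
    C.scVector (s, θ) v ≠ 0 := by
  intro h0
  have h1 : ((-(s ^ 2) * v.1, s • v.2) : ScSpace n) = 0 :=
    C.injective_mfderiv_toFun hs θ (h0.trans
      (map_zero (mfderiv (𝓘(ℝ, ℝ).prod (𝓡 n)) (𝓡∂ (n + 1)) C.toFun (s, θ))).symm)
  have h2 := congrArg Prod.fst h1
  have h3 := congrArg Prod.snd h1
  have hs0 : s ≠ 0 := hs.1.ne'
  refine hv (Prod.ext ?_ ?_)
  · simpa [hs0] using h2
  · simpa [hs0] using h3

end Collar

/-- For ρ > 0 the form is g itself, evaluated on scattering vectors. At ρ = 0 it reduces to dr² + h,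
because F(0) = 0 and k ≥ 1. Nondegeneracy up to the boundary makes the inverse matrix smooth there.
-/
theorem IsNormalForm.form_pos {C : Collar n X Y} {h : BoundaryMetric n Y} {g : BilinField n X}
    {F : ℝ → ℝ} {k : ℕ} {κ : ScBilinField n Y} {c : ℝ → ℝ} (hg : IsRiemannianInside g)
    (H : IsNormalForm C h g F k κ c) {p : ℝ × Y} (hp : p ∈ (cylinder Y).carrier) :
    ∀ v, v ≠ 0 → 0 < normalForm h F k κ c p v v := by
  intro v hv
  rcases eq_or_lt_of_le hp.1.1 with h0 | h0
  · rw [normalForm_apply, ← h0, H.radial_zero, zero_pow (Nat.one_le_iff_ne_zero.1 H.pos)]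
    have h1 : 0 ≤ bdryForm h p.2 v.2 v.2 := by
      by_cases h2 : v.2 = 0
      · rw [h2]; simp
      · exact (h.pos _ _ h2).le
    by_cases h2 : v.2 = 0
    · have h3 : v.1 ≠ 0 := fun h3 => hv (Prod.ext h3 h2)
      have := mul_self_pos.2 h3
      linarith
    · have h3 : 0 < bdryForm h p.2 v.2 v.2 := h.pos _ _ h2
      have := mul_self_nonneg v.1
      linarith
  · have h1 := H.eq p.1 ⟨h0, hp.1.2⟩ p.2 v v
    rw [normalForm_apply]
    refine lt_of_lt_of_eq ?_ h1
    exact hg.pos _ (C.toFun_mem_interior ⟨h0, hp.1.2⟩ p.2) _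
      (C.scVector_ne_zero ⟨h0, hp.1.2⟩ p.2 hv)

end Chart
end AsympConic

end

noncomputable section
namespace AsympConic

set_option linter.unusedSectionVars false

/-! ## The gradient and the Laplacian of the phase on the collar -/

section Collar

variable {n : ℕ} {X Y : Type*}
  [TopologicalSpace X] [ChartedSpace (EuclideanHalfSpace (n + 1)) X]
  [IsManifold (𝓡∂ (n + 1)) ∞ X]
  [TopologicalSpace Y] [ChartedSpace (EuclideanSpace ℝ (Fin n)) Y] [IsManifold (𝓡 n) ∞ Y]

/-- The matrix of the metric in the scattering frame of a chart. -/
def scMatrix (h : BoundaryMetric n Y) (F : ℝ → ℝ) (k : ℕ) (κ : ScBilinField n Y) (c : ℝ → ℝ)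
    (θ₀ : Y) (p : ScSpace n) : Matrix (ScIdx n) (ScIdx n) ℝ :=
  gram ((normalForm h F k κ c (cylChart n θ₀ p)).bilinearComp (cylDer n θ₀ p) (cylDer n θ₀ p))
    (scBasis n)

variable {C : Collar n X Y} {h : BoundaryMetric n Y} {g : BilinField n X}
  {F : ℝ → ℝ} {k : ℕ} {κ : ScBilinField n Y} {c : ℝ → ℝ} {θ₀ : Y} {p : ScSpace n}

theorem scMatrix_apply (i j : ScIdx n) : scMatrix h F k κ c θ₀ p i j
    = modelMatrix F (bdryMatrix h θ₀) p i j + p.1 ^ k * (scForm κ (cylChart n θ₀ p)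
        (cylDer n θ₀ p (scBasis n i)) (cylDer n θ₀ p (scBasis n j))
        + c p.1 * (radCoeff i * radCoeff j)) := by
  have h1 : scMatrix h F k κ c θ₀ p i j = normalForm h F k κ c (cylChart n θ₀ p)
    (cylDer n θ₀ p (scBasis n i)) (cylDer n θ₀ p (scBasis n j)) := rfl
  have hr : ∀ i, (cylDer n θ₀ p (scBasis n i)).1 = radCoeff i := by
    rintro (i | i)
    · rw [scBasis_inl]; rfl
    · rw [scBasis_inr]; rfl
  rw [h1, normalForm_apply, hr, hr]
  have h2 : (1 + F (cylChart n θ₀ p).1) * (radCoeff i * radCoeff j)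
      + bdryForm h (cylChart n θ₀ p).2 (cylDer n θ₀ p (scBasis n i)).2
        (cylDer n θ₀ p (scBasis n j)).2 = modelMatrix F (bdryMatrix h θ₀) p i j := by
    rcases i with i | i <;> rcases j with j | j <;>
      simp only [scBasis_inl, scBasis_inr, cylDer_apply, map_zero, radCoeff, modelMatrix,
        Sum.elim_inl, Sum.elim_inr, Matrix.fromBlocks_apply₁₁, Matrix.fromBlocks_apply₁₂,
        Matrix.fromBlocks_apply₂₁, Matrix.fromBlocks_apply₂₂, mul_zero, mul_one,
        zero_add, add_zero, Matrix.zero_apply, Matrix.of_apply, zero_apply]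
    · rfl
    · rfl
  rw [h2]
  rfl

theorem contDiffOn_modelMatrix (hF : ContDiffOn ℝ ∞ F (Ico 0 1)) (h : BoundaryMetric n Y)
    (θ₀ : Y) (i j : ScIdx n) :
    ContDiffOn ℝ ∞ (fun p => modelMatrix F (bdryMatrix h θ₀) p i j) (cylDom n θ₀) := by
  rcases i with i | i <;> rcases j with j | j
  · exact contDiffOn_const.add (hF.comp contDiff_fst.contDiffOn fun p hp => hp.1)
  · exact contDiffOn_const
  · exact contDiffOn_const
  · exact (contDiffOn_bdryMatrix h θ₀ i j).comp contDiff_snd.contDiffOn fun p hp => hp.2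

theorem IsNormalForm.congOn (H : IsNormalForm C h g F k κ c) (θ₀ : Y) (i j : ScIdx n) :
    CongOn k (cylDom n θ₀) (fun p => scMatrix h F k κ c θ₀ p i j)
      (fun p => modelMatrix F (bdryMatrix h θ₀) p i j) := by
  have h1 := contDiffOn_modelMatrix H.smooth_radial h θ₀ i j
  have h2 := (contDiffOn_scForm H.smooth θ₀ (scBasis n i) (scBasis n j)).add
    ((H.smooth_coeff.comp (contDiff_fst (𝕜 := ℝ) (E := ℝ)
      (F := EuclideanSpace ℝ (Fin n))).contDiffOn fun p (hp : p ∈ cylDom n θ₀) => hp.1).mul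
      (contDiffOn_const (c := radCoeff i * radCoeff j)))
  have h3 : ContDiffOn ℝ ∞ (fun p : ScSpace n => p.1 ^ k) (cylDom n θ₀) :=
    (contDiff_fst.pow k).contDiffOn
  refine ⟨(h1.add (h3.mul h2)).congr fun p _ => scMatrix_apply i j, h1, _, h2,
    fun p _ => scMatrix_apply i j⟩

theorem IsNormalForm.isUnit_det (hg : IsRiemannianInside g) (H : IsNormalForm C h g F k κ c)
    (hp : p ∈ cylDom n θ₀) : IsUnit (scMatrix h F k κ c θ₀ p).det :=
  isUnit_det_gram (fun v hv => H.form_pos hg (cylChart_mem hp) (cylDer n θ₀ p v)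
    fun h0 : cylDer n θ₀ p v = 0 => hv ((bijective_cylDer hp.2).1 (h0.trans (map_zero _).symm))) (scBasis n).linearIndependent

theorem IsNormalForm.isUnit_det_model (H : IsNormalForm C h g F k κ c)
    (hp : p ∈ cylDom n θ₀) : IsUnit (modelMatrix F (bdryMatrix h θ₀) p).det :=
  isUnit_det_modelMatrix (H.radial_pos _ hp.1).ne' (isUnit_det_bdryMatrix h hp.2)

/-- The parametrization of the collar by a chart of the boundary. -/
def collarChart (C : Collar n X Y) (θ₀ : Y) (p : ScSpace n) : X := C.toFun (cylChart n θ₀ p)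

theorem contMDiffOn_collarChart (C : Collar n X Y) (θ₀ : Y) :
    ContMDiffOn 𝓘(ℝ, ScSpace n) (𝓡∂ (n + 1)) ∞ (collarChart C θ₀)
      (Ioo (0 : ℝ) 1 ×ˢ chartDom n θ₀) :=
  C.contMDiffOn_toFun.comp ((contMDiffOn_cylChart θ₀).mono
    (prod_mono Ioo_subset_Ico_self Subset.rfl)) fun _ hp => ⟨⟨hp.1.1.le, hp.1.2⟩, mem_univ _⟩

theorem isOpen_collarDom (θ₀ : Y) : IsOpen (Ioo (0 : ℝ) 1 ×ˢ chartDom n θ₀) :=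
  isOpen_Ioo.prod (isOpen_chartDom θ₀)

theorem mapsTo_collarChart (C : Collar n X Y) (θ₀ : Y) :
    MapsTo (collarChart C θ₀) (Ioo (0 : ℝ) 1 ×ˢ chartDom n θ₀) ((𝓡∂ (n + 1)).interior X) :=
  fun _ hp => C.toFun_mem_interior hp.1 _

theorem dparam_collarChart (C : Collar n X Y) (hp : p ∈ Ioo (0 : ℝ) 1 ×ˢ chartDom n θ₀)
    (v : ScSpace n) :
    dparam (collarChart C θ₀) p v
      = mfderiv (𝓘(ℝ, ℝ).prod (𝓡 n)) (𝓡∂ (n + 1)) C.toFun (cylChart n θ₀ p)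
        (show ScSpace n from cylDer n θ₀ p v) := by
  have h1 := (C.mdifferentiableAt_toFun hp.1 (cylChart n θ₀ p).2).hasMFDerivAt
  have h2 := (hasMFDerivWithinAt_cylChart (θ₀ := θ₀)
    (prod_mono Ioo_subset_Ico_self Subset.rfl hp)).hasMFDerivAt (cylDom_mem_nhds hp)
  have h3 := (HasMFDerivAt.comp (g := C.toFun) p h1 h2).mfderiv
  exact congrArg (fun L : ScSpace n →L[ℝ] EuclideanSpace ℝ (Fin (n + 1)) => L v) h3

theorem dparam_collarChart_basis (C : Collar n X Y) (hp : p ∈ Ioo (0 : ℝ) 1 ×ˢ chartDom n θ₀)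
    (i : ScIdx n) :
    dparam (collarChart C θ₀) p (scFrame p.1 i)
      = C.scVector (cylChart n θ₀ p) (cylDer n θ₀ p (scBasis n i)) := by
  rw [dparam_collarChart C hp]
  unfold Collar.scVector
  refine congrArg (show ScSpace n → EuclideanSpace ℝ (Fin (n + 1)) from
    mfderiv (𝓘(ℝ, ℝ).prod (𝓡 n)) (𝓡∂ (n + 1)) C.toFun (cylChart n θ₀ p)) ?_
  rcases i with i | i
  · rw [scBasis_inl]
    simp [cylDer_apply, scFrame, cylChart]
  · rw [scBasis_inr]
    simp [cylDer_apply, scFrame, cylChart]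

theorem bijective_dparam_collarChart (C : Collar n X Y)
    (hp : p ∈ Ioo (0 : ℝ) 1 ×ˢ chartDom n θ₀) :
    Function.Bijective (dparam (n := n) (collarChart C θ₀) p) := by
  have hinj : Function.Injective (dparam (n := n) (collarChart C θ₀) p) := by
    intro v w hvw
    rw [dparam_collarChart C hp, dparam_collarChart C hp] at hvw
    exact (bijective_cylDer hp.2).1 (C.injective_mfderiv_toFun hp.1 _ hvw)
  have hfin : Module.finrank ℝ (ScSpace n)
      = Module.finrank ℝ (EuclideanSpace ℝ (Fin (n + 1))) := by
    simp [add_comm]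
  exact ⟨hinj, (LinearMap.injective_iff_surjective_of_finrank_eq_finrank
    (f := (dparam (n := n) (collarChart C θ₀) p).toLinearMap) hfin).1 hinj⟩

theorem IsNormalForm.pullMetric_scFrame (H : IsNormalForm C h g F k κ c)
    (hp : p ∈ Ioo (0 : ℝ) 1 ×ˢ chartDom n θ₀) (i j : ScIdx n) :
    scMatrix h F k κ c θ₀ p i j
      = pullMetric g (collarChart C θ₀) p (scFrame p.1 i) (scFrame p.1 j) := by
  rw [pullMetric_apply, dparam_collarChart_basis C hp, dparam_collarChart_basis C hp]
  have h1 : scMatrix h F k κ c θ₀ p i j = normalForm h F k κ c (cylChart n θ₀ p)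
    (cylDer n θ₀ p (scBasis n i)) (cylDer n θ₀ p (scBasis n j)) := rfl
  rw [h1, normalForm_apply]
  exact (H.eq p.1 hp.1 _ _ _).symm

/-- The phase `r + (𝔪/2) log r`. -/
def Collar.phaseFun (C : Collar n X Y) (m : ℝ) (x : X) : ℝ := phaseFn m (C.bdf x)

theorem Collar.contMDiffOn_phaseFun (C : Collar n X Y) (m : ℝ) :
    ContMDiffOn (𝓡∂ (n + 1)) 𝓘(ℝ, ℝ) ∞ (C.phaseFun m) ((𝓡∂ (n + 1)).interior X) :=
  C.region_isRegular.contMDiffOn_phase m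

theorem phaseFun_collarChart (m : ℝ) (hp : p ∈ Ioo (0 : ℝ) 1 ×ˢ chartDom n θ₀) :
    (C.phaseFun m ∘ collarChart C θ₀) =ᶠ[𝓝 p] fun q => phaseFn m q.1 := by
  filter_upwards [(isOpen_collarDom θ₀).mem_nhds hp] with q hq
  exact congrArg (phaseFn m) (C.bdf_collar q.1 ⟨hq.1.1.le, hq.1.2⟩ _)

/-- The gradient of the phase in the coordinates of a chart. -/
def gradVec (m : ℝ) (M : ScSpace n → Matrix (ScIdx n) (ScIdx n) ℝ) (p : ScSpace n) : ScSpace n :=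
  ∑ l, gradCoeff m M p l • scBasis n l

variable (m : ℝ)

theorem IsNormalForm.pullMetric_grad (hg : IsRiemannianInside g) (H : IsNormalForm C h g F k κ c)
    (hp : p ∈ Ioo (0 : ℝ) 1 ×ˢ chartDom n θ₀) (z : ScSpace n) :
    pullMetric g (collarChart C θ₀) p
      (∑ l, gradCoeff m (scMatrix h F k κ c θ₀) p l • scFrame p.1 l) z
      = fderiv ℝ (C.phaseFun m ∘ collarChart C θ₀) p z := by
  rw [(phaseFun_collarChart m hp).fderiv_eq]
  refine gradCoeff_spec m hp.1.1.ne'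
    (H.isUnit_det hg (prod_mono Ioo_subset_Ico_self Subset.rfl hp))
    (fun i j => H.pullMetric_scFrame hp i j) (fun i j => ?_) z
  rw [H.pullMetric_scFrame hp, H.pullMetric_scFrame hp]
  exact hg.symm _ (mapsTo_collarChart C θ₀ hp) _ _

theorem mdifferentiableAt_collarChart (C : Collar n X Y)
    (hp : p ∈ Ioo (0 : ℝ) 1 ×ˢ chartDom n θ₀) :
    MDifferentiableAt 𝓘(ℝ, ScSpace n) (𝓡∂ (n + 1)) (collarChart C θ₀) p :=
  ((contMDiffOn_collarChart C θ₀).contMDiffAt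
    ((isOpen_collarDom θ₀).mem_nhds hp)).mdifferentiableAt (by simp)

theorem IsNormalForm.gradField_eq (hg : IsRiemannianInside g) (H : IsNormalForm C h g F k κ c)
    (hp : p ∈ Ioo (0 : ℝ) 1 ×ˢ chartDom n θ₀) :
    gradField g (C.phaseFun m) (collarChart C θ₀ p)
      = C.scVector (cylChart n θ₀ p)
        (cylDer n θ₀ p (gradVec m (scMatrix h F k κ c θ₀) p)) := by
  have h1 := gradField_param hg (f := C.phaseFun m)
    (mdifferentiableAt_of_interior (C.contMDiffOn_phaseFun m) (mapsTo_collarChart C θ₀ hp))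
    (mdifferentiableAt_collarChart C hp) (mapsTo_collarChart C θ₀ hp)
    (bijective_dparam_collarChart C hp) (H.pullMetric_grad m hg hp)
  rw [← h1, map_sum]
  have h2 : ∀ v : ScSpace n, C.scVector (cylChart n θ₀ p) v
      = (show ScSpace n →L[ℝ] EuclideanSpace ℝ (Fin (n + 1)) from
        mfderiv (𝓘(ℝ, ℝ).prod (𝓡 n)) (𝓡∂ (n + 1)) C.toFun (cylChart n θ₀ p))
        ((ContinuousLinearMap.prodMap ((-(p.1 ^ 2)) • ContinuousLinearMap.id ℝ ℝ)
          (p.1 • ContinuousLinearMap.id ℝ (EuclideanSpace ℝ (Fin n)))) v) := fun v => rfl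
  rw [h2, gradVec, map_sum, map_sum]
  refine (Finset.sum_congr rfl fun l _ => ?_).trans
    (map_sum (show ScSpace n →L[ℝ] EuclideanSpace ℝ (Fin (n + 1)) from
        mfderiv (𝓘(ℝ, ℝ).prod (𝓡 n)) (𝓡∂ (n + 1)) C.toFun (cylChart n θ₀ p)) _ _).symm
  rw [map_smul, dparam_collarChart_basis C hp, h2, map_smul, map_smul]
  exact (map_smul (show ScSpace n →L[ℝ] EuclideanSpace ℝ (Fin (n + 1)) from
        mfderiv (𝓘(ℝ, ℝ).prod (𝓡 n)) (𝓡∂ (n + 1)) C.toFun (cylChart n θ₀ p)) _ _).symm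

theorem IsNormalForm.dfun_gradField (hg : IsRiemannianInside g) (H : IsNormalForm C h g F k κ c)
    (hp : p ∈ Ioo (0 : ℝ) 1 ×ˢ chartDom n θ₀) :
    dfun (n := n) (C.phaseFun m) (collarChart C θ₀ p)
        (gradField g (C.phaseFun m) (collarChart C θ₀ p))
      = (1 + m / 2 * p.1) * gradCoeff m (scMatrix h F k κ c θ₀) p (Sum.inl ()) := by
  have h0 := mdifferentiableAt_of_interior (C.contMDiffOn_phaseFun m) (mapsTo_collarChart C θ₀ hp)
  have h1 := gradField_param hg (f := C.phaseFun m) h0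
    (mdifferentiableAt_collarChart C hp) (mapsTo_collarChart C θ₀ hp)
    (bijective_dparam_collarChart C hp) (H.pullMetric_grad m hg hp)
  rw [← h1, ← fderiv_comp_param h0 (mdifferentiableAt_collarChart C hp),
    (phaseFun_collarChart m hp).fderiv_eq, map_sum, Fintype.sum_sum_type]
  simp [fderiv_phaseFn_scFrame m hp.1.1.ne', radCoeff]
  ring

/-- Chart-independence, applied to the collar parametrization with the scattering frame at the point
as basis. -/
theorem IsNormalForm.laplacian_eq (hg : IsRiemannianInside g) (H : IsNormalForm C h g F k κ c)
    (hp : p ∈ Ioo (0 : ℝ) 1 ×ˢ chartDom n θ₀) :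
    laplacian g (fun x => (C.phaseFun m x : ℂ)) (collarChart C θ₀ p)
      = ((p.1 * scLap m (cylDom n θ₀) (scMatrix h F k κ c θ₀)
        (gradCoeff m (scMatrix h F k κ c θ₀)) p : ℝ) : ℂ) := by
  obtain ⟨b, hb⟩ := exists_scFrame_basis (n := n) hp.1.1.ne'
  rw [laplacian_ofReal_param hg (C.contMDiffOn_phaseFun m) (isOpen_collarDom θ₀)
    (contMDiffOn_collarChart C θ₀) (mapsTo_collarChart C θ₀) hp (bijective_dparam_collarChart C hp)
    (H.pullMetric_grad m hg hp) b]
  congr 1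
  have hG : DifferentiableAt ℝ (pullMetric g (collarChart C θ₀)) p :=
    ((contDiffOn_pullMetric hg (isOpen_collarDom θ₀) (contMDiffOn_collarChart C θ₀)
      (mapsTo_collarChart C θ₀)).contDiffAt
      ((isOpen_collarDom θ₀).mem_nhds hp)).differentiableAt (by simp)
  rw [← traceForm_phase m hp.1.1.ne' hG (cylDom_mem_nhds hp)
    (by filter_upwards [(isOpen_collarDom θ₀).mem_nhds hp] with q hq i j
        exact H.pullMetric_scFrame hq i j) hb]
  congr 2
  ext v w
  unfold hessForm
  congr 2
  refine Filter.EventuallyEq.fderiv_eq ?_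
  filter_upwards [eventually_eventually_nhds.2 (phaseFun_collarChart (C := C) m hp)] with q hq
  exact congrArg (fun L : ScSpace n →L[ℝ] ℝ => L w) (Filter.EventuallyEq.fderiv_eq hq)

end Collar
end AsympConic

end

noncomputable section
namespace AsympConic

set_option linter.unusedSectionVars false

/-! ## From charts of the cylinder to weighted spaces -/

section Local

variable {n : ℕ} {Y : Type*}
  [TopologicalSpace Y] [ChartedSpace (EuclideanSpace ℝ (Fin n)) Y] [IsManifold (𝓡 n) ∞ Y]

/-- The chart of the cylinder. -/
def cylCoord (n : ℕ) {Y : Type*} [TopologicalSpace Y] [ChartedSpace (EuclideanSpace ℝ (Fin n)) Y]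
    (θ₀ : Y) (p : ℝ × Y) : ScSpace n := (p.1, extChartAt (𝓡 n) θ₀ p.2)

/-- The part of the cylinder over the domain of a chart. -/
def cylSource (n : ℕ) {Y : Type*} [TopologicalSpace Y] [ChartedSpace (EuclideanSpace ℝ (Fin n)) Y]
    (θ₀ : Y) : Set (ℝ × Y) := univ ×ˢ (extChartAt (𝓡 n) θ₀).source

theorem isOpen_cylSource (θ₀ : Y) : IsOpen (cylSource n θ₀) :=
  isOpen_univ.prod (isOpen_extChartAt_source θ₀)

theorem mem_cylSource (p : ℝ × Y) : p ∈ cylSource n p.2 :=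
  ⟨mem_univ _, mem_extChartAt_source p.2⟩

theorem cylChart_cylCoord {θ₀ : Y} {p : ℝ × Y} (hp : p ∈ cylSource n θ₀) :
    cylChart n θ₀ (cylCoord n θ₀ p) = p :=
  Prod.ext rfl ((extChartAt (𝓡 n) θ₀).left_inv hp.2)

theorem cylCoord_mem {θ₀ : Y} {p : ℝ × Y} (hp : p ∈ (cylinder Y).carrier)
    (hp' : p ∈ cylSource n θ₀) : cylCoord n θ₀ p ∈ cylDom n θ₀ :=
  ⟨hp.1, (extChartAt (𝓡 n) θ₀).map_source hp'.2⟩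

theorem cylCoord_mem_inner {θ₀ : Y} {p : ℝ × Y} (hp : p ∈ (cylinder Y).inner)
    (hp' : p ∈ cylSource n θ₀) : cylCoord n θ₀ p ∈ Ioo (0 : ℝ) 1 ×ˢ chartDom n θ₀ :=
  ⟨hp.1, (extChartAt (𝓡 n) θ₀).map_source hp'.2⟩

theorem contMDiffOn_cylCoord (θ₀ : Y) : ContMDiffOn (𝓘(ℝ, ℝ).prod (𝓡 n)) 𝓘(ℝ, ScSpace n) ∞
    (cylCoord n θ₀) (cylSource n θ₀) :=
  contMDiffOn_fst.prodMk_space ((contMDiffOn_extChartAt (I := 𝓡 n) (x := θ₀)).comp contMDiffOn_snd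
    fun p hp => by simpa using hp.2)

theorem exists_contMDiffOn_of_chart {F : Type*} [NormedAddCommGroup F] [NormedSpace ℝ F]
    {f : ℝ × Y → F} {k : ℕ} (h : ∀ θ₀ : Y, ∃ b : ScSpace n → F, ContDiffOn ℝ ∞ b (cylDom n θ₀) ∧
      ∀ p ∈ Ioo (0 : ℝ) 1 ×ˢ chartDom n θ₀, f (cylChart n θ₀ p) = p.1 ^ k • b p) :
    ∃ a : ℝ × Y → F, ContMDiffOn (𝓘(ℝ, ℝ).prod (𝓡 n)) 𝓘(ℝ, F) ∞ a (cylinder Y).carrier ∧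
      ∀ p ∈ (cylinder Y).inner, f p = p.1 ^ k • a p := by
  refine exists_contMDiffOn_of_local (cylinder_isRegular n Y) cylinder_subset_closure
    fun x _ => ⟨cylSource n x.2, isOpen_cylSource x.2, mem_cylSource x, ?_⟩
  obtain ⟨b, hb, e⟩ := h x.2
  refine ⟨fun p => b (cylCoord n x.2 p), ?_, fun p hp => ?_⟩
  · exact hb.contMDiffOn.comp ((contMDiffOn_cylCoord x.2).mono inter_subset_right)
      fun p hp => cylCoord_mem hp.1 hp.2
  · have := e _ (cylCoord_mem_inner hp.1 hp.2)
    rwa [cylChart_cylCoord hp.2] at this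

/-- The value of a field on the cylinder, as an element of the model space. -/
def fieldAt (V : (p : ℝ × Y) → TangentSpace (𝓘(ℝ, ℝ).prod (𝓡 n)) p) (p : ℝ × Y) : ScSpace n := V p

/-- A field on the cylinder which is `ρ^k` times a b-vector field in every chart. -/
theorem exists_isBVectorField_of_chart
    {V : (p : ℝ × Y) → TangentSpace (𝓘(ℝ, ℝ).prod (𝓡 n)) p} {k : ℕ}
    (h : ∀ θ₀ : Y, ∃ (f : ScSpace n → ℝ) (v : ScSpace n → EuclideanSpace ℝ (Fin n)),
      ContDiffOn ℝ ∞ f (cylDom n θ₀) ∧ ContDiffOn ℝ ∞ v (cylDom n θ₀) ∧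
      ∀ p ∈ Ioo (0 : ℝ) 1 ×ˢ chartDom n θ₀,
        fieldAt V (cylChart n θ₀ p) = p.1 ^ k • cylDer n θ₀ p (p.1 * f p, v p)) :
    ∃ W : (p : ℝ × Y) → TangentSpace (𝓘(ℝ, ℝ).prod (𝓡 n)) p,
      IsBVectorField (𝓘(ℝ, ℝ).prod (𝓡 n)) (cylinder Y) W ∧
      ∀ p ∈ (cylinder Y).inner, V p = p.1 ^ k • W p := by
  choose f v hf hv e using h
  classical
  set w : Y → ScSpace n → ScSpace n := fun θ₀ p => cylDer n θ₀ p (p.1 * f θ₀ p, v θ₀ p) with hw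
  -- For ρ > 0 the field is determined by V. At ρ = 0 it is read off in the chart centred at the
  -- angular point itself.
  set W : ℝ × Y → ScSpace n := fun p =>
    if 0 < p.1 then (p.1 ^ k)⁻¹ • fieldAt V p else w p.2 (cylCoord n p.2 p) with hW
  have hWpos : ∀ θ₀, ∀ p ∈ Ioo (0 : ℝ) 1 ×ˢ chartDom n θ₀, W (cylChart n θ₀ p) = w θ₀ p := by
    intro θ₀ p hp
    have h0 : 0 < (cylChart n θ₀ p).1 := hp.1.1
    have h1 : p.1 ^ k ≠ 0 := pow_ne_zero k hp.1.1.ne'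
    simp only [hW, h0, if_true]
    rw [e θ₀ p hp, smul_smul]
    change ((p.1 ^ k)⁻¹ * p.1 ^ k) • _ = _
    rw [inv_mul_cancel₀ h1, one_smul]
  have hWloc : ∀ θ₀, ∀ p ∈ cylDom n θ₀, W (cylChart n θ₀ p) = w θ₀ p := by
    intro θ₀ p hp
    rcases eq_or_lt_of_le hp.1.1 with h0 | h0
    -- Boundary values obtained from two charts agree as limits s ↓ 0 of the same interior values.
    -- Both limits are taken with the angular point fixed, so chart derivatives enter only as
    -- constants.
    · set θ := (cylChart n θ₀ p).2 with hθ
      have hy : extChartAt (𝓡 n) θ θ ∈ chartDom n θ := mem_extChartAt_target θ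
      have hc : ∀ (θ₁ : Y) (y : EuclideanSpace ℝ (Fin n)), y ∈ chartDom n θ₁ →
          Tendsto (fun s : ℝ => w θ₁ (s, y)) (𝓝[>] 0) (𝓝 (w θ₁ (0, y))) := by
        intro θ₁ y hy
        have hmem : ((0 : ℝ), y) ∈ cylDom n θ₁ := ⟨⟨le_rfl, one_pos⟩, hy⟩
        have hlim : Tendsto (fun s : ℝ => ((s, y) : ScSpace n)) (𝓝[>] 0)
            (𝓝[cylDom n θ₁] (0, y)) := by
          refine tendsto_nhdsWithin_iff.2 ⟨?_, ?_⟩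
          · exact ((continuous_id.prodMk continuous_const).tendsto (0 : ℝ)).mono_left
              nhdsWithin_le_nhds
          · filter_upwards [Ioo_mem_nhdsGT (zero_lt_one (α := ℝ))] with s hs
            exact ⟨⟨hs.1.le, hs.2⟩, hy⟩
        have h1 := ((hf θ₁).continuousOn _ hmem).tendsto.comp hlim
        have h2 := ((hv θ₁).continuousOn _ hmem).tendsto.comp hlim
        have h3 : Tendsto (fun s : ℝ => s) (𝓝[>] (0 : ℝ)) (𝓝 0) := nhdsWithin_le_nhds
        exact ((cylDer n θ₁ (0, y)).continuous.tendsto _).comp ((h3.mul h1).prodMk_nhds h2)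
      have h1 := hc θ₀ p.2 hp.2
      have h2 := hc θ _ hy
      have h3 : (fun s : ℝ => w θ₀ (s, p.2)) =ᶠ[𝓝[>] 0]
          fun s => w θ (s, extChartAt (𝓡 n) θ θ) := by
        filter_upwards [Ioo_mem_nhdsGT (zero_lt_one (α := ℝ))] with s hs
        rw [← hWpos θ₀ (s, p.2) ⟨hs, hp.2⟩, ← hWpos θ (s, _) ⟨hs, hy⟩]
        congr 1
        exact Prod.ext rfl (extChartAt_to_inv (I := 𝓡 n) θ).symm
      have h4 := tendsto_nhds_unique h1 (h2.congr' h3.symm)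
      have h5 : p = (0, p.2) := Prod.ext h0.symm rfl
      have h6 : ¬ 0 < (cylChart n θ₀ p).1 := not_lt.2 h0.ge
      simp only [hW, h6, if_false]
      rw [h5, h4, ← h5]
      exact congrArg (fun t => w θ (t, extChartAt (𝓡 n) θ θ)) h0.symm
    · exact hWpos θ₀ p ⟨⟨h0, hp.1.2⟩, hp.2⟩
  have hfst : ∀ θ₀ p, (w θ₀ p).1 = p.1 * f θ₀ p := fun θ₀ p => rfl
  -- The tangency coefficient is the ρ-component divided by ρ, glued as a weighted function of order
  -- 1.
  obtain ⟨a, ha, ea⟩ := exists_contMDiffOn_of_chart (n := n) (f := fun p => (W p).1) (k := 1)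
    fun θ₀ => ⟨f θ₀, hf θ₀, fun p hp => by
      rw [hWpos θ₀ p hp, hfst, pow_one, smul_eq_mul]⟩
  refine ⟨W, ⟨fun x hx => ?_, a, ha, fun p hp => ?_⟩, fun p hp => ?_⟩
  · have h1 : ContMDiffOn (𝓘(ℝ, ℝ).prod (𝓡 n)) (𝓘(ℝ, ℝ).prod (𝓡 n)).tangent ∞
        (fun p => (⟨p, W p⟩ : TangentBundle (𝓘(ℝ, ℝ).prod (𝓡 n)) (ℝ × Y)))
        ((cylinder Y).carrier ∩ cylSource n x.2) := by
      have h2 : ContDiffOn ℝ ∞ (fun p : ScSpace n => ((p.1 * f x.2 p, v x.2 p) : ScSpace n))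
          (cylDom n x.2) := (contDiff_fst.contDiffOn.mul (hf x.2)).prodMk (hv x.2)
      have h0 : ContMDiffOn (𝓘(ℝ, ℝ).prod (𝓡 n)) 𝓘(ℝ, ScSpace n) ∞
          (cylCoord n x.2) ((cylinder Y).carrier ∩ cylSource n x.2) :=
        (contMDiffOn_cylCoord x.2).mono inter_subset_right
      have hm : MapsTo (cylCoord n x.2) ((cylinder Y).carrier ∩ cylSource n x.2)
          (cylDom n x.2) := fun p hp => cylCoord_mem hp.1 hp.2
      have h3 := contMDiffOn_pushforward (contMDiffOn_cylChart (n := n) x.2)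
        (uniqueDiffOn_cylDom x.2).uniqueMDiffOn
        (contMDiffOn_vectorSpace_section h0 (h2.contMDiffOn.comp h0 hm)) hm
      refine h3.congr fun p hp => totalSpace_mk_congr (cylChart_cylCoord hp.2).symm ?_
      have h4 := hWloc x.2 _ (hm hp)
      rw [cylChart_cylCoord hp.2] at h4
      refine Eq.trans h4 ?_
      exact (congrArg (fun L : ScSpace n →L[ℝ] ScSpace n =>
        L ((cylCoord n x.2 p).1 * f x.2 (cylCoord n x.2 p), v x.2 (cylCoord n x.2 p)))
        (mfderivWithin_cylChart (hm hp))).symm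
    exact (contMDiffWithinAt_inter ((isOpen_cylSource x.2).mem_nhds (mem_cylSource x))).1
      (h1 x ⟨hx, mem_cylSource x⟩)
  · refine (mfderivWithin_bdf_cylinder hp _).trans ?_
    rcases eq_or_lt_of_le hp.1.1 with h0 | h0
    · have h1 := hWloc p.2 _ (cylCoord_mem hp (mem_cylSource p))
      rw [cylChart_cylCoord (mem_cylSource p)] at h1
      have h2 : (W p).1 = p.1 * f p.2 (cylCoord n p.2 p) := by rw [h1]; rfl
      refine h2.trans ?_
      change p.1 * _ = p.1 * _
      rw [← h0, zero_mul, zero_mul]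
    · refine (ea p ⟨⟨h0, hp.1.2⟩, hp.2⟩).trans ?_
      rw [pow_one]
      rfl
  · have h1 : p.1 ^ k ≠ 0 := pow_ne_zero k hp.1.1.ne'
    have h2 : W p = (p.1 ^ k)⁻¹ • fieldAt V p := by
      have : 0 < p.1 := hp.1.1
      simp only [hW, this, if_true]
    have h3 : p.1 ^ k • W p = fieldAt V p := by
      rw [h2, smul_smul, mul_inv_cancel₀ h1, one_smul]
    exact h3.symm

end Local
end AsympConic

end

noncomputable section
namespace AsympConic

set_option linter.unusedSectionVars false

/-! ## Weighted estimates for the gradient and the Laplacian of the phase -/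

section Estimates

variable {n : ℕ} {X Y : Type*}
  [TopologicalSpace X] [ChartedSpace (EuclideanHalfSpace (n + 1)) X]
  [IsManifold (𝓡∂ (n + 1)) ∞ X]
  [TopologicalSpace Y] [ChartedSpace (EuclideanSpace ℝ (Fin n)) Y] [IsManifold (𝓡 n) ∞ Y]

/-- Normal forms modulo all powers `ρ^k`, `k ≤ l`, with the same radial part. -/
def HasNormalForms (C : Collar n X Y) (h : BoundaryMetric n Y) (g : BilinField n X)
    (F : ℝ → ℝ) (l : ℕ∞) : Prop :=
  ∀ k : ℕ, 1 ≤ k → (k : ℕ∞) ≤ l → ∃ (κ : ScBilinField n Y) (c : ℝ → ℝ), IsNormalForm C h g F k κ c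

variable {C : Collar n X Y} {h : BoundaryMetric n Y} {g : BilinField n X}
  {F : ℝ → ℝ} {l : ℕ∞}

/-- The squared length of the differential of the phase. -/
def Collar.phaseNorm (C : Collar n X Y) (g : BilinField n X) (m : ℝ) (x : X) : ℝ :=
  dfun (n := n) (C.phaseFun m) x (gradField g (C.phaseFun m) x)

/-- |dφ|² = (1 + 𝔪ρ/2)²(M⁻¹)_{rr}, and M⁻¹ is congruent to the inverse of the model matrix. For
infinite `l` every k may use its own normal form, but F is the same for all of them. -/
theorem HasNormalForms.phaseNorm (hg : IsRiemannianInside g) (H : HasNormalForms C h g F l)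
    (hl : 1 ≤ l) (m : ℝ) :
    MemWeightedSmooth (𝓘(ℝ, ℝ).prod (𝓡 n)) (cylinder Y) l
      (fun p => C.phaseNorm g m (C.toFun p) - (1 + m / 2 * p.1) ^ 2 / (1 + F p.1)) := by
  refine MemWeightedSmooth.of_le_of_pos (cylinder_isRegular n Y) hl fun k hk hkl => ?_
  obtain ⟨κ, c, N⟩ := H k hk hkl
  refine exists_contMDiffOn_of_chart (n := n) fun θ₀ => ?_
  obtain ⟨-, -, b, hb, e⟩ := CongOn.gradCoeff (fun i j => N.congOn θ₀ i j)
    (fun p hp => N.isUnit_det hg hp) (fun p hp => N.isUnit_det_model hp) m (Sum.inl ())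
  have hq : ContDiff ℝ ∞ (fun p : ScSpace n => 1 + m / 2 * p.1) := by fun_prop
  refine ⟨fun p => (1 + m / 2 * p.1) * b p, hq.contDiffOn.mul hb, fun p hp => ?_⟩
  have hp' : p ∈ cylDom n θ₀ := prod_mono Ioo_subset_Ico_self Subset.rfl hp
  have h1 := N.dfun_gradField m hg hp
  have h2 := e p hp'
  beta_reduce at h2
  have hF := (N.radial_pos _ hp'.1).ne'
  rw [gradCoeff_modelMatrix m hF (isUnit_det_bdryMatrix h hp'.2)] at h2
  beta_reduce
  have h3 : C.phaseNorm g m (C.toFun (cylChart n θ₀ p))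
      = (1 + m / 2 * p.1) * gradCoeff m (scMatrix h F k κ c θ₀) p (Sum.inl ()) := h1
  rw [h3, h2]
  simp only [cylChart, radCoeff, Sum.elim_inl, smul_eq_mul]
  ring

/-- The radial part of the Laplacian of the phase. -/
def radialLaplacian (n : ℕ) (m : ℝ) (F : ℝ → ℝ) (s : ℝ) : ℝ :=
  s * (m / 2 * s / (1 + F s)
    - 1 / 2 * s * derivWithin F (Ico 0 1) s * (1 + m / 2 * s) / (1 + F s) ^ 2
    - n * ((1 + m / 2 * s) / (1 + F s)))

theorem HasNormalForms.laplacian (hg : IsRiemannianInside g) (H : HasNormalForms C h g F l)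
    (hl : 1 ≤ l) (m : ℝ) :
    MemWeightedSmooth (𝓘(ℝ, ℝ).prod (𝓡 n)) (cylinder Y) (1 + l)
      (fun p => laplacian g (fun x => (C.phaseFun m x : ℂ)) (C.toFun p)
        - (radialLaplacian n m F p.1 : ℂ)) := by
  -- △φ is ρ·`scLap`; the congruence is applied after division by ρ, and the factor is restored
  -- afterwards. This accounts for the weight 1 + l.
  have key : MemWeightedSmooth (𝓘(ℝ, ℝ).prod (𝓡 n)) (cylinder Y) l
      (fun p => p.1⁻¹ • (AsympConic.laplacian g (fun x => (C.phaseFun m x : ℂ)) (C.toFun p)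
        - (radialLaplacian n m F p.1 : ℂ))) := by
    refine MemWeightedSmooth.of_le_of_pos (cylinder_isRegular n Y) hl fun k hk hkl => ?_
    obtain ⟨κ, c, N⟩ := H k hk hkl
    refine exists_contMDiffOn_of_chart (n := n) fun θ₀ => ?_
    have hc := fun i j => N.congOn θ₀ i j
    have hM := fun p (hp : p ∈ cylDom n θ₀) => N.isUnit_det hg hp
    have hM' := fun p (hp : p ∈ cylDom n θ₀) => N.isUnit_det_model hp
    obtain ⟨-, -, b, hb, e⟩ := CongOn.scLap (uniqueDiffOn_cylDom θ₀) hc hM hM'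
      (CongOn.gradCoeff hc hM hM' m) m
    refine ⟨fun p => (b p : ℂ), Complex.ofRealCLM.contDiff.comp_contDiffOn hb, fun p hp => ?_⟩
    have hp' : p ∈ cylDom n θ₀ := prod_mono Ioo_subset_Ico_self Subset.rfl hp
    have h1 := N.laplacian_eq m hg hp
    have h2 := e p hp'
    have h4 := scLap_modelMatrix m N.smooth_radial (isOpen_chartDom θ₀)
      (contDiffOn_bdryMatrix h θ₀) hp' (N.radial_pos _ hp'.1).ne'
      (isUnit_det_bdryMatrix h hp'.2) (bdryMatrix_symm h θ₀ p.2)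
    have h3 : AsympConic.laplacian g (fun x => (C.phaseFun m x : ℂ))
        (C.toFun (cylChart n θ₀ p)) = _ := h1
    have h5 : ((cylChart n θ₀ p).1 : ℝ) = p.1 := rfl
    have h6 : scLap m (cylDom n θ₀) (modelMatrix F (bdryMatrix h θ₀))
        (gradCoeff m (modelMatrix F (bdryMatrix h θ₀))) p = p.1⁻¹ * radialLaplacian n m F p.1 := by
      rw [radialLaplacian, inv_mul_cancel_left₀ hp.1.1.ne']
      exact h4
    rw [h3, h5, ← Complex.ofReal_sub, Complex.real_smul, Complex.real_smul, ← Complex.ofReal_mul,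
      ← Complex.ofReal_mul, mul_sub, inv_mul_cancel_left₀ hp.1.1.ne', h2, h6]
    congr 1
    ring
  have := key.pow_smul (cylinder_isRegular n Y) 1
  rw [Nat.cast_one] at this
  refine this.congr fun p hp => ?_
  have h0 : p.1 ≠ 0 := hp.1.1.ne'
  change _ = p.1 ^ 1 • (p.1⁻¹ • _)
  rw [pow_one, smul_smul, mul_inv_cancel₀ h0, one_smul]

/-- The value of `C.scVector`, as an element of the model space. -/
def Collar.scVec (C : Collar n X Y) (p : ℝ × Y) (v : ScSpace n) : EuclideanSpace ℝ (Fin (n + 1)) :=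
  C.scVector p v

/-- The gradient of the phase in the scattering frame. -/
def Collar.scGrad (C : Collar n X Y) (g : BilinField n X) (m : ℝ) (p : ℝ × Y) : ScSpace n :=
  Classical.epsilon fun v => C.scVec p v = gradField g (C.phaseFun m) (C.toFun p)

theorem Collar.injective_scVec (C : Collar n X Y) {s : ℝ} (hs : s ∈ Ioo (0 : ℝ) 1) (θ : Y) :
    Function.Injective (C.scVec (s, θ)) := by
  intro v w hvw
  have h1 := C.injective_mfderiv_toFun hs θ hvw
  have h2 := congrArg Prod.fst h1
  have h3 := congrArg Prod.snd h1
  have hs0 : s ≠ 0 := hs.1.ne'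
  refine Prod.ext ?_ ?_
  · simpa [hs0] using h2
  · simpa [hs0] using h3

theorem HasNormalForms.scGrad_eq (hg : IsRiemannianInside g) {k : ℕ} {κ : ScBilinField n Y}
    {c : ℝ → ℝ} (N : IsNormalForm C h g F k κ c) (m : ℝ) {θ₀ : Y} {p : ScSpace n}
    (hp : p ∈ Ioo (0 : ℝ) 1 ×ˢ chartDom n θ₀) :
    C.scGrad g m (cylChart n θ₀ p)
      = cylDer n θ₀ p (gradVec m (scMatrix h F k κ c θ₀) p) := by
  have h1 : C.scVec (cylChart n θ₀ p) (cylDer n θ₀ p (gradVec m (scMatrix h F k κ c θ₀) p))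
      = gradField g (C.phaseFun m) (C.toFun (cylChart n θ₀ p)) := (N.gradField_eq m hg hp).symm
  have h2 : C.scVec (cylChart n θ₀ p) (C.scGrad g m (cylChart n θ₀ p))
      = gradField g (C.phaseFun m) (C.toFun (cylChart n θ₀ p)) :=
    Classical.epsilon_spec (p := fun v => C.scVec (cylChart n θ₀ p) v
      = gradField g (C.phaseFun m) (C.toFun (cylChart n θ₀ p))) ⟨_, h1⟩
  exact C.injective_scVec hp.1 _ (h2.trans h1.symm)

theorem scVec_scGrad (hg : IsRiemannianInside g) (H : HasNormalForms C h g F l)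
    (hl : 1 ≤ l) (m : ℝ) {p : ℝ × Y} (hp : p ∈ (cylinder Y).inner) :
    C.scVec p (C.scGrad g m p) = gradField g (C.phaseFun m) (C.toFun p) := by
  obtain ⟨κ, c, N⟩ := H 1 le_rfl (by exact_mod_cast hl)
  have h1 := N.gradField_eq m hg (cylCoord_mem_inner hp (mem_cylSource (n := n) p))
  rw [cylChart_cylCoord (mem_cylSource p)] at h1
  have e : C.toFun p = collarChart C p.2 (cylCoord n p.2 p) := by
    rw [collarChart, cylChart_cylCoord (mem_cylSource p)]
  have h2 : ∃ v, C.scVec p v = gradField g (C.phaseFun m) (C.toFun p) := by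
    refine ⟨_, Eq.trans h1.symm ?_⟩
    rw [e]
  exact Classical.epsilon_spec h2

/-- The deviation of the gradient of the phase from its radial part. -/
def gradRemainder (C : Collar n X Y) (g : BilinField n X) (m : ℝ) (F : ℝ → ℝ) (p : ℝ × Y) :
    TangentSpace (𝓘(ℝ, ℝ).prod (𝓡 n)) p :=
  ((-(p.1 ^ 2) * ((C.scGrad g m p).1 - (1 + m / 2 * p.1) / (1 + F p.1)),
    p.1 • (C.scGrad g m p).2) : ScSpace n)

theorem gradVec_fst (m : ℝ) (M : ScSpace n → Matrix (ScIdx n) (ScIdx n) ℝ) (p : ScSpace n) :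
    (gradVec m M p).1 = gradCoeff m M p (Sum.inl ()) := by
  rw [gradVec, Fintype.sum_sum_type, Prod.fst_add, Prod.fst_sum, Prod.fst_sum]
  simp [scBasis_inl, scBasis_inr]

theorem gradVec_snd (m : ℝ) (M : ScSpace n → Matrix (ScIdx n) (ScIdx n) ℝ) (p : ScSpace n) :
    (gradVec m M p).2 = ∑ j, gradCoeff m M p (Sum.inr j) • EuclideanSpace.single j (1 : ℝ) := by
  rw [gradVec, Fintype.sum_sum_type, Prod.snd_add, Prod.snd_sum, Prod.snd_sum]
  simp [scBasis_inl, scBasis_inr]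

/-- A scattering vector is ρ times a b-vector. Thus an error O(ρᵏ) in the scattering components of
∇φ is a b-vector field of weight 1 + k. -/
theorem HasNormalForms.memWeightedField (hg : IsRiemannianInside g)
    (H : HasNormalForms C h g F l) (hl : 1 ≤ l) (m : ℝ) :
    MemWeightedField (𝓘(ℝ, ℝ).prod (𝓡 n)) (cylinder Y) (1 + l) (gradRemainder C g m F) := by
  intro k' hk'
  -- Normal forms exist only for k ≥ 1. The requested weights k' = 0, 1 are served by k = 1, and the
  -- surplus ρ^j goes into the coefficients.
  obtain ⟨k, j, hk, hkl, hkj⟩ : ∃ k j : ℕ, 1 ≤ k ∧ (k : ℕ∞) ≤ l ∧ 1 + k = k' + j := by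
    rcases k' with _ | _ | k
    · exact ⟨1, 2, le_rfl, by exact_mod_cast hl, by norm_num⟩
    · exact ⟨1, 1, le_rfl, by exact_mod_cast hl, by norm_num⟩
    · refine ⟨k + 1, 0, by simp, ?_, by ring⟩
      have h1 : (1 : ℕ∞) + ((k + 1 : ℕ) : ℕ∞) ≤ 1 + l := by
        refine le_trans (le_of_eq ?_) hk'
        push_cast
        ring
      exact (ENat.add_le_add_iff_left ENat.one_ne_top).1 h1
  obtain ⟨κ, c, N⟩ := H k hk hkl
  refine exists_isBVectorField_of_chart (k := k') fun θ₀ => ?_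
  choose b hb e using fun i => (CongOn.gradCoeff (fun i j => N.congOn θ₀ i j)
    (fun p hp => N.isUnit_det hg hp) (fun p hp => N.isUnit_det_model hp) m i).2.2
  have hj : ContDiffOn ℝ ∞ (fun p : ScSpace n => p.1 ^ j) (cylDom n θ₀) :=
    (contDiff_fst.pow j).contDiffOn
  refine ⟨fun p => -(p.1 ^ j * b (Sum.inl ()) p),
    fun p => ∑ i, (p.1 ^ j * b (Sum.inr i) p) • EuclideanSpace.single i (1 : ℝ),
    (hj.mul (hb _)).neg, ContDiffOn.sum fun i _ => (hj.mul (hb _)).smul contDiffOn_const,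
    fun p hp => ?_⟩
  have hp' : p ∈ cylDom n θ₀ := prod_mono Ioo_subset_Ico_self Subset.rfl hp
  have hF := (N.radial_pos _ hp'.1).ne'
  have e' : ∀ i, gradCoeff m (scMatrix h F k κ c θ₀) p i
      = (1 + m / 2 * p.1) / (1 + F p.1) * radCoeff i + p.1 ^ k * b i p := fun i => by
    have h0 := e i p hp'
    beta_reduce at h0
    rw [h0, gradCoeff_modelMatrix m hF (isUnit_det_bdryMatrix h hp'.2)]
  have h1 := HasNormalForms.scGrad_eq hg N m hp
  have hpow : p.1 ^ k' * p.1 ^ j = p.1 * p.1 ^ k := by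
    rw [← pow_add, ← hkj, pow_add, pow_one]
  have h2 : fieldAt (gradRemainder C g m F) (cylChart n θ₀ p)
      = (-(p.1 ^ 2) * ((C.scGrad g m (cylChart n θ₀ p)).1 - (1 + m / 2 * p.1) / (1 + F p.1)),
        p.1 • (C.scGrad g m (cylChart n θ₀ p)).2) := rfl
  rw [h2, h1, cylDer_apply, cylDer_apply, gradVec_fst, gradVec_snd]
  refine Prod.ext ?_ ?_
  · change -(p.1 ^ 2) * (gradCoeff m (scMatrix h F k κ c θ₀) p (Sum.inl ()) - _)
      = p.1 ^ k' * (p.1 * -(p.1 ^ j * b (Sum.inl ()) p))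
    rw [e']
    simp only [radCoeff, Sum.elim_inl]
    linear_combination (p.1 * b (Sum.inl ()) p) * hpow
  · change p.1 • chartDer n θ₀ p.2 _ = p.1 ^ k' • chartDer n θ₀ p.2 _
    rw [← map_smul, ← map_smul, Finset.smul_sum, Finset.smul_sum]
    refine congrArg _ (Finset.sum_congr rfl fun i _ => ?_)
    rw [e', smul_smul, smul_smul]
    simp only [radCoeff, Sum.elim_inr]
    congr 1
    linear_combination (-b (Sum.inr i) p) * hpow

/-- The gradient of the phase on the collar. -/
theorem gradField_eq_push (hg : IsRiemannianInside g) (H : HasNormalForms C h g F l)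
    (hl : 1 ≤ l) (m : ℝ) {s : ℝ} (hs : s ∈ Ioo (0 : ℝ) 1) (θ : Y) :
    gradField g (C.phaseFun m) (C.toFun (s, θ))
      = C.push (fun p => radialLift n Y (fun t => -(t ^ 2) * ((1 + m / 2 * t) / (1 + F t))) p
        + gradRemainder C g m F p) (C.toFun (s, θ)) := by
  rw [C.push_toFun hs, ← scVec_scGrad hg H hl m (p := (s, θ)) ⟨hs, mem_univ _⟩]
  unfold Collar.scVec Collar.scVector
  refine congrArg (show ScSpace n → EuclideanSpace ℝ (Fin (n + 1)) from
    mfderiv (𝓘(ℝ, ℝ).prod (𝓡 n)) (𝓡∂ (n + 1)) C.toFun (s, θ)) ?_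
  refine Prod.ext ?_ ?_
  · change -(s ^ 2) * (C.scGrad g m (s, θ)).1 = -(s ^ 2) * ((1 + m / 2 * s) / (1 + F s))
      + -(s ^ 2) * ((C.scGrad g m (s, θ)).1 - (1 + m / 2 * s) / (1 + F s))
    ring
  · exact (zero_add _).symm

end Estimates
end AsympConic

end

noncomputable section
namespace AsympConic

set_option linter.unusedSectionVars false

/-! ## Division by the boundary-defining function -/

section Division

theorem hasDerivAt_of_contDiffOn_Ico {f : ℝ → ℝ} (hf : ContDiffOn ℝ ∞ f (Ico 0 1)) {s : ℝ}
    (hs : s ∈ Ioo (0 : ℝ) 1) : HasDerivAt f (derivWithin f (Ico 0 1) s) s :=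
  ((hf.differentiableOn (by simp) s ⟨hs.1.le, hs.2⟩).hasDerivWithinAt).hasDerivAt
    (Ico_mem_nhds hs.1 hs.2)

theorem contDiffOn_derivWithin_Ico {f : ℝ → ℝ} (hf : ContDiffOn ℝ ∞ f (Ico 0 1)) :
    ContDiffOn ℝ ∞ (derivWithin f (Ico 0 1)) (Ico 0 1) :=
  hf.derivWithin (uniqueDiffOn_Ico 0 1) (by simp)

theorem tendsto_nhdsGT_of_continuousOn_Ico {f : ℝ → ℝ} (hf : ContinuousOn f (Ico 0 1)) :
    Tendsto f (𝓝[>] 0) (𝓝 (f 0)) := by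
  have h := (hf 0 ⟨le_rfl, one_pos⟩).tendsto
  rw [nhdsWithin_Ico_eq_nhdsGE one_pos] at h
  exact h.mono_left (nhdsWithin_mono _ Ioi_subset_Ici_self)

theorem continuousOn_Ico_of_hasDerivAt {u v : ℝ → ℝ} (h : ∀ s ∈ Ioo (0 : ℝ) 1, HasDerivAt u (v s) s)
    (h0 : Tendsto u (𝓝[>] 0) (𝓝 (u 0))) : ContinuousOn u (Ico 0 1) := by
  intro s hs
  rcases eq_or_lt_of_le hs.1 with rfl | h1
  · rw [ContinuousWithinAt, nhdsWithin_Ico_eq_nhdsGE one_pos]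
    rw [← Ioi_insert, nhdsWithin_insert, tendsto_sup]
    exact ⟨tendsto_pure_nhds _ _, h0⟩
  · exact (h s ⟨h1, hs.2⟩).continuousAt.continuousWithinAt

/-- Regularity up to `0` of solutions of `s u' + (n + 1) u = f`. -/
theorem contDiffOn_of_euler (N : ℕ) : ∀ (n : ℕ) (f u : ℝ → ℝ), ContDiffOn ℝ ∞ f (Ico 0 1) →
    ContinuousOn u (Ico 0 1) →
    (∀ s ∈ Ioo (0 : ℝ) 1, HasDerivAt u ((f s - (n + 1) * u s) / s) s) →
    ContDiffOn ℝ N u (Ico 0 1) := by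
  induction N with
  | zero => intro n f u _ hu _; simpa using hu
  | succ N ih =>
    intro n f u hf hu hd
    set f' := derivWithin f (Ico 0 1) with hf'
    -- `v` is u′. Its value at 0 is forced by setting s = 0 in the differentiated equation s v′ +
    -- (n+2)v = f′.
    set v : ℝ → ℝ := fun s => if s = 0 then f' 0 / (n + 2) else (f s - (n + 1) * u s) / s with hv
    have hv0 : ∀ s, s ≠ 0 → v s = (f s - (n + 1) * u s) / s := fun s hs => by simp [hv, hs]
    have hdu : ∀ s ∈ Ioo (0 : ℝ) 1, HasDerivAt u (v s) s := fun s hs => by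
      rw [hv0 s hs.1.ne']; exact hd s hs
    have hdf := fun s (hs : s ∈ Ioo (0 : ℝ) 1) => hasDerivAt_of_contDiffOn_Ico hf hs
    -- Differentiation turns the equation into one of the same kind with n + 1 and f′, to which the
    -- induction hypothesis applies. This is why n is quantified inside the induction.
    have hdv : ∀ s ∈ Ioo (0 : ℝ) 1,
        HasDerivAt v ((f' s - (((n + 1 : ℕ) : ℝ) + 1) * v s) / s) s := by
      intro s hs
      have hs0 := hs.1.ne'
      have e : v =ᶠ[𝓝 s] fun t => (f t - (n + 1) * u t) / t := by
        filter_upwards [isOpen_ne.mem_nhds hs0] with t ht using hv0 t ht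
      refine HasDerivAt.congr_of_eventuallyEq ?_ e
      refine (((hdf s hs).sub ((hdu s hs).const_mul _)).div (hasDerivAt_id s) hs0).congr_deriv ?_
      have h1 : f s - (n + 1) * u s = s * v s := by rw [hv0 s hs0]; field_simp
      simp only [id, mul_one, Pi.sub_apply, ← hf']
      rw [h1]
      push_cast
      field_simp
      ring
    have hlim : Tendsto v (𝓝[>] 0) (𝓝 (v 0)) := by
      have hv00 : v 0 = f' 0 / (n + 2) := by simp [hv]
      have hIoo : Ioo (0 : ℝ) 1 ∈ 𝓝[>] (0 : ℝ) := Ioo_mem_nhdsGT one_pos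
      have hn2 : ((n : ℝ) + 2) ≠ 0 := by positivity
      -- The integrating factor s^{n+1} is inserted before l'Hôpital: by the equation, the
      -- derivative of s^{n+1}(f − (n+1)u) is s^{n+1}f′, so the unknown u′ drops out.
      have h1 : Tendsto (fun s : ℝ => (s ^ (n + 1) * (f s - (n + 1) * u s)) / s ^ (n + 2))
          (𝓝[>] 0) (𝓝 (f' 0 / (n + 2))) := by
        refine HasDerivAt.lhopital_zero_nhdsGT (f' := fun s => s ^ (n + 1) * f' s)
          (g' := fun s => ((n : ℝ) + 2) * s ^ (n + 1)) ?_ ?_ ?_ ?_ ?_ ?_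
        · filter_upwards [hIoo] with s hs
          refine ((hasDerivAt_pow (n + 1) s).mul
            ((hdf s hs).sub ((hdu s hs).const_mul ((n : ℝ) + 1)))).congr_deriv ?_
          rw [hv0 s hs.1.ne']
          have := hs.1.ne'
          simp only [Nat.add_sub_cancel, Pi.sub_apply, ← hf']
          push_cast
          field_simp
          ring
        · filter_upwards with s
          refine (hasDerivAt_pow (n + 2) s).congr_deriv ?_
          push_cast
          rfl
        · filter_upwards [hIoo] with s hs
          exact mul_ne_zero hn2 (pow_ne_zero _ hs.1.ne')
        · have h2 : Tendsto (fun s : ℝ => s ^ (n + 1)) (𝓝[>] 0) (𝓝 0) := by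
            have := ((continuous_pow (n + 1)).tendsto (0 : ℝ)).mono_left
              (nhdsWithin_le_nhds (s := Ioi 0))
            simpa using this
          have h3 := (tendsto_nhdsGT_of_continuousOn_Ico hf.continuousOn).sub
            ((tendsto_nhdsGT_of_continuousOn_Ico hu).const_mul ((n : ℝ) + 1))
          simpa using h2.mul h3
        · have := ((continuous_pow (n + 2)).tendsto (0 : ℝ)).mono_left
            (nhdsWithin_le_nhds (s := Ioi 0))
          simpa using this
        · have h2 := (tendsto_nhdsGT_of_continuousOn_Ico
            (contDiffOn_derivWithin_Ico hf).continuousOn).div_const ((n : ℝ) + 2)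
          refine h2.congr' ?_
          filter_upwards [hIoo] with s hs
          have := pow_ne_zero (n + 1) hs.1.ne'
          field_simp
          rfl
      rw [hv00]
      refine h1.congr' ?_
      filter_upwards [hIoo] with s hs
      have := hs.1.ne'
      rw [hv0 s this]
      field_simp
      ring
    have hcv := continuousOn_Ico_of_hasDerivAt hdv hlim
    have hvN := ih (n + 1) f' v (contDiffOn_derivWithin_Ico hf) hcv hdv
    have hdw : ∀ s ∈ Ico (0 : ℝ) 1, HasDerivWithinAt u (v s) (Ico 0 1) s := by
      intro s hs
      rcases eq_or_lt_of_le hs.1 with rfl | h1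
      · refine (hasDerivWithinAt_Ici_of_tendsto_deriv (s := Ioo 0 1)
          (fun t ht => (hdu t ht).differentiableAt.differentiableWithinAt)
          ((hu 0 hs).mono Ioo_subset_Ico_self) (Ioo_mem_nhdsGT one_pos) ?_).mono
          Ico_subset_Ici_self
        refine hlim.congr' ?_
        filter_upwards [Ioo_mem_nhdsGT (zero_lt_one (α := ℝ))] with t ht
        exact (hdu t ht).deriv.symm
      · exact (hdu s ⟨h1, hs.2⟩).hasDerivWithinAt
    rw [Nat.cast_succ, contDiffOn_succ_iff_derivWithin (uniqueDiffOn_Ico 0 1)]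
    refine ⟨fun s hs => (hdw s hs).differentiableWithinAt, by simp, ?_⟩
    exact hvN.congr fun s hs => (hdw s hs).derivWithin (uniqueDiffOn_Ico 0 1 s hs)

/-- Hadamard's lemma on `[0,1)`. -/
theorem exists_contDiffOn_div {a : ℝ → ℝ} (ha : ContDiffOn ℝ ∞ a (Ico 0 1)) :
    ∃ b : ℝ → ℝ, ContDiffOn ℝ ∞ b (Ico 0 1) ∧ ∀ s ∈ Ico (0 : ℝ) 1, a s = a 0 + s * b s := by
  set a' := derivWithin a (Ico 0 1) with ha'
  set b : ℝ → ℝ := fun s => if s = 0 then a' 0 else (a s - a 0) / s with hb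
  have hb0 : ∀ s, s ≠ 0 → b s = (a s - a 0) / s := fun s hs => by simp [hb, hs]
  -- The quotient solves s b′ + b = a′, the case n = 0 of the Euler equation.
  have hdb : ∀ s ∈ Ioo (0 : ℝ) 1, HasDerivAt b ((a' s - (((0 : ℕ) : ℝ) + 1) * b s) / s) s := by
    intro s hs
    have hs0 := hs.1.ne'
    have e : b =ᶠ[𝓝 s] fun t => (a t - a 0) / t := by
      filter_upwards [isOpen_ne.mem_nhds hs0] with t ht using hb0 t ht
    refine HasDerivAt.congr_of_eventuallyEq ?_ e
    refine (((hasDerivAt_of_contDiffOn_Ico ha hs).sub_const _).div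
      (hasDerivAt_id s) hs0).congr_deriv ?_
    rw [hb0 s hs0]
    simp only [id]
    push_cast
    field_simp
    ring
  have hcb : ContinuousOn b (Ico 0 1) := by
    refine continuousOn_Ico_of_hasDerivAt hdb ?_
    have h1 := (ha.differentiableOn (by simp) 0 ⟨le_rfl, one_pos⟩).hasDerivWithinAt
    rw [hasDerivWithinAt_iff_tendsto_slope] at h1
    have h2 : 𝓝[>] (0 : ℝ) ≤ 𝓝[Ico 0 1 \ {0}] 0 := by
      rw [← nhdsWithin_Ioo_eq_nhdsGT (zero_lt_one (α := ℝ))]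
      exact nhdsWithin_mono _ fun s hs => ⟨⟨hs.1.le, hs.2⟩, hs.1.ne'⟩
    have hb00 : b 0 = a' 0 := by simp [hb]
    rw [hb00]
    refine (h1.mono_left h2).congr' ?_
    filter_upwards [self_mem_nhdsWithin] with s hs
    rw [hb0 s (ne_of_gt hs), slope_def_field, sub_zero]
  refine ⟨b, ?_, fun s hs => ?_⟩
  · rw [contDiffOn_infty]
    exact fun N => contDiffOn_of_euler N 0 a' b (contDiffOn_derivWithin_Ico ha) hcb hdb
  · by_cases h : s = 0
    · simp [h]
    · rw [hb0 s h]
      field_simp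
      ring

end Division
end AsympConic

end

noncomputable section
namespace AsympConic

set_option linter.unusedSectionVars false

/-! ## Existence of normal forms, and the mass -/

section NormalForms

/-- The cutoff factor vanishes identically for s < δ/3, so the singularity of s⁻ᵏ at 0 is never met.
-/
theorem contDiff_cutoff_mul {δ : ℝ} (hδ : 0 < δ) (k : ℕ) :
    ContDiffOn ℝ ∞ (fun s : ℝ => (1 - Real.smoothTransition (2 - 3 * s / δ)) * (s ^ k)⁻¹)
      (Ico 0 1) := by
  intro s hs
  by_cases h : s < δ / 3
  · have e : (fun s : ℝ => (1 - Real.smoothTransition (2 - 3 * s / δ)) * (s ^ k)⁻¹)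
        =ᶠ[𝓝 s] fun _ => 0 := by
      filter_upwards [isOpen_Iio.mem_nhds (show s ∈ Iio (δ / 3) from h)] with t ht
      have ht' : t < δ / 3 := ht
      have : 1 ≤ 2 - 3 * t / δ := by
        have : 3 * t / δ ≤ 1 := by rw [div_le_one hδ]; linarith
        linarith
      rw [Real.smoothTransition.one_of_one_le this, sub_self, zero_mul]
    exact (contDiffAt_const.congr_of_eventuallyEq e).contDiffWithinAt
  · have hs0 : s ≠ 0 := by
      have := not_lt.1 h
      have : 0 < δ / 3 := by positivity
      linarith
    have h1 : ContDiff ℝ ∞ (fun s : ℝ => 1 - Real.smoothTransition (2 - 3 * s / δ)) :=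
      contDiff_const.sub (Real.smoothTransition.contDiff.comp (by fun_prop))
    exact (h1.contDiffAt.mul ((contDiffAt_id.pow k).inv (pow_ne_zero k hs0))).contDiffWithinAt

/-- The properties of the radial part of the perturbation of the metric. -/
structure IsRadialPart (F : ℝ → ℝ) (a : ℕ∞) : Prop where
  smooth : ContDiffOn ℝ ∞ F (Ico 0 1)
  zero : F 0 = 0
  pos : ∀ s ∈ Ico (0 : ℝ) 1, 0 < 1 + F s
  mem : MemWeightedSmooth 𝓘(ℝ, ℝ) radialRegion (1 + a) F

variable {n : ℕ} {X Y : Type*}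
  [TopologicalSpace X] [ChartedSpace (EuclideanHalfSpace (n + 1)) X]
  [IsManifold (𝓡∂ (n + 1)) ∞ X]
  [TopologicalSpace Y] [ChartedSpace (EuclideanSpace ℝ (Fin n)) Y] [IsManifold (𝓡 n) ∞ Y]
  {C : Collar n X Y} {h : BoundaryMetric n Y} {g : BilinField n X}

/-- The given radial coefficient F₀ need not satisfy 1 + F₀ > 0 away from the boundary, since only
the full metric is positive there. It is therefore cut off to F = ψF₀, supported where |F₀| < 1/2.
The discarded part vanishes near ρ = 0 and is put into the remainder at every order. -/
theorem exists_hasNormalForms {a a₀ : ℕ∞} (hc : IsAsympConic C h g a a₀) :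
    ∃ F, IsRadialPart F a ∧ HasNormalForms C h g F (1 + a₀) := by
  obtain ⟨F₀, κ₀, hF, hκ, e⟩ := hc
  obtain ⟨b, hb, eb⟩ := hF 1 (by simp)
  have hb' : ContDiffOn ℝ ∞ b (Ico 0 1) := contMDiffOn_iff_contDiffOn.1 hb
  have hsb : ContDiffOn ℝ ∞ (fun s => s * b s) (Ico 0 1) := contDiffOn_id.mul hb'
  obtain ⟨δ, hδ, hlt⟩ : ∃ δ > 0, ∀ s ∈ Ico (0 : ℝ) 1, s < δ → |s * b s| < 1 / 2 := by
    have h1 := hsb.continuousOn 0 ⟨le_rfl, one_pos⟩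
    obtain ⟨δ, hδ, h2⟩ := Metric.continuousWithinAt_iff.1 h1 (1 / 2) (by norm_num)
    refine ⟨δ, hδ, fun s hs hsδ => ?_⟩
    have h3 := h2 hs (by rw [Real.dist_eq, sub_zero, abs_of_nonneg hs.1]; exact hsδ)
    simpa [Real.dist_eq] using h3
  -- ψ is 1 for s ≤ δ/3 and 0 for s ≥ 2δ/3.
  set ψ : ℝ → ℝ := fun s => Real.smoothTransition (2 - 3 * s / δ) with hψ
  have hψs : ContDiff ℝ ∞ ψ := Real.smoothTransition.contDiff.comp (by fun_prop)
  have hpos : ∀ s ∈ Ico (0 : ℝ) 1, 0 < 1 + ψ s * (s * b s) := by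
    intro s hs
    have h0 : 0 ≤ ψ s := Real.smoothTransition.nonneg _
    have h1 : ψ s ≤ 1 := Real.smoothTransition.le_one _
    by_cases h : s < δ
    · have h2 := (abs_lt.1 (hlt s hs h)).1
      nlinarith
    · have : 2 - 3 * s / δ ≤ 0 := by
        have : 2 ≤ 3 * s / δ := by rw [le_div_iff₀ hδ]; linarith [not_lt.1 h]
        linarith
      have h2 : ψ s = 0 := Real.smoothTransition.zero_of_nonpos this
      rw [h2]
      norm_num
  have hF₀ : ∀ s ∈ Ioo (0 : ℝ) 1, F₀ s = s * b s := fun s hs => by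
    have := eb s hs
    rw [pow_one] at this
    exact this
  refine ⟨fun s => ψ s * (s * b s), ⟨hψs.contDiffOn.mul hsb, by simp, hpos, ?_⟩,
    fun k hk hkl => ?_⟩
  · refine (hF.mul_left (hψs.contMDiff.contMDiffOn)).congr fun s hs => ?_
    rw [hF₀ s hs]
  · obtain ⟨κ, hκs, eκ⟩ := hκ k hkl
    refine ⟨κ, fun s => (1 - ψ s) * (s ^ k)⁻¹ * (s * b s), hψs.contDiffOn.mul hsb, by simp, hpos,
      hk, hκs, (contDiff_cutoff_mul hδ k).mul hsb, fun s hs θ v w => ?_⟩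
    have h1 := e s hs θ v w
    have h2 : κ₀ (s, θ) v w = s ^ k * scForm κ (s, θ) v w := by
      rw [eκ (s, θ) ⟨hs, mem_univ _⟩]
      rfl
    have h3 : bilinAt g (C.toFun (s, θ)) (C.scVector (s, θ) v) (C.scVector (s, θ) w)
      = v.1 * w.1 + bdryForm h θ v.2 w.2 + F₀ s * (v.1 * w.1) + s ^ k * scForm κ (s, θ) v w :=
        h1.trans (by rw [h2]; rfl)
    rw [h3, hF₀ s hs]
    have := pow_ne_zero k hs.1.ne'
    field_simp
    ring

/-- The function r is the phase with mass 0, and △ of half the square of r − r(x) is −|dr|² at x;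
the general formula for the length of the phase thus also gives the coefficient of ∂_r². -/
theorem Collar.coeffRR_laplacian (hg : IsRiemannianInside g) {x : X}
    (hx : x ∈ (𝓡∂ (n + 1)).interior X) :
    C.coeffRR (laplacian g) x = ((-C.phaseNorm g 0 x : ℝ) : ℂ) := by
  have e : C.r = C.phaseFun 0 := by
    funext z
    simp [Collar.r, Collar.phaseFun, phaseFn]
  unfold Collar.coeffRR
  rw [e]
  exact laplacian_sq_half hg (C.contMDiffOn_phaseFun 0) hx

/-- The coefficient is −1/(1+F) + O(ρ²), so that (coefficient + 1)/ρ tends to b(0). The angular part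
of the metric must be O(ρ²) for this, hence 2 ≤ l. A boundary point is needed for the limit to say
anything. -/
theorem Collar.IsMass.eq [Nonempty Y] {𝔪 : ℝ} (hm : C.IsMass g 𝔪) (hg : IsRiemannianInside g)
    {F b : ℝ → ℝ} {l a : ℕ∞} (H : HasNormalForms C h g F l) (hl : 2 ≤ l) (hF : IsRadialPart F a)
    (hb : ContinuousOn b (Ico 0 1)) (e : ∀ s ∈ Ioo (0 : ℝ) 1, F s = s * b s) : b 0 = 𝔪 := by
  obtain ⟨θ⟩ := ‹Nonempty Y›
  obtain ⟨A, hA, eA⟩ := H.phaseNorm hg (le_trans (by norm_num) hl) 0 2 (by exact_mod_cast hl)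
  have hAc : ContinuousOn (fun s : ℝ => A (s, θ)) (Ico 0 1) :=
    hA.continuousOn.comp (by fun_prop) fun s hs => ⟨hs, mem_univ _⟩
  have h1 : Tendsto (fun s : ℝ => b s / (1 + F s) - s * A (s, θ)) (𝓝[>] 0) (𝓝 (b 0)) := by
    have hc : ContinuousOn (fun s : ℝ => b s / (1 + F s) - s * A (s, θ)) (Ico 0 1) :=
      (hb.div (continuousOn_const.add hF.smooth.continuousOn) fun s hs => (hF.pos s hs).ne').sub
        (continuousOn_id.mul hAc)
    have := tendsto_nhdsGT_of_continuousOn_Ico hc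
    simpa [hF.zero] using this
  have h2 : Tendsto (fun s : ℝ => (((b s / (1 + F s) - s * A (s, θ) : ℝ)) : ℂ)) (𝓝[>] 0)
      (𝓝 (b 0 : ℂ)) := (Complex.continuous_ofReal.tendsto _).comp h1
  have h3 : Tendsto (fun s : ℝ => (((b s / (1 + F s) - s * A (s, θ) : ℝ)) : ℂ)) (𝓝[>] 0)
      (𝓝 (𝔪 : ℂ)) := by
    refine (hm θ).congr' ?_
    filter_upwards [Ioo_mem_nhdsGT (zero_lt_one (α := ℝ))] with s hs
    have h4 := eA (s, θ) ⟨hs, mem_univ _⟩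
    have h5 : C.phaseNorm g 0 (C.toFun (s, θ)) = 1 / (1 + F s) + s ^ 2 * A (s, θ) := by
      have h6 : C.phaseNorm g 0 (C.toFun (s, θ)) - (1 + 0 / 2 * s) ^ 2 / (1 + F s)
        = s ^ 2 * A (s, θ) := h4
      linear_combination h6
    rw [Collar.coeffRR_laplacian hg (C.toFun_mem_interior hs θ), h5]
    have hF' := (hF.pos s ⟨hs.1.le, hs.2⟩).ne'
    have hs0 := hs.1.ne'
    rw [← Complex.ofReal_one, ← Complex.ofReal_add, ← Complex.ofReal_div]
    congr 1
    have h7 := e s hs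
    have h8 : 1 - 1 / (1 + F s) = s * b s / (1 + F s) := by
      rw [← h7]; field_simp; ring
    field_simp at h8 ⊢
    linear_combination h7
  exact_mod_cast tendsto_nhds_unique h2 h3

end NormalForms
end AsympConic

end

noncomputable section
namespace AsympConic

set_option linter.unusedSectionVars false

/-! ## Radial parts of the coefficients -/

section Radial

theorem MemWeightedSmooth.radial_mul {l : ℕ∞} {c f : ℝ → ℝ}
    (hf : MemWeightedSmooth 𝓘(ℝ, ℝ) radialRegion l f) (hc : ContDiffOn ℝ ∞ c (Ico 0 1)) :
    MemWeightedSmooth 𝓘(ℝ, ℝ) radialRegion l (fun s => c s * f s) :=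
  hf.mul_left (contMDiffOn_iff_contDiffOn.2 hc)

theorem MemWeightedSmooth.radial_pow_mul {l : ℕ∞} {f : ℝ → ℝ}
    (hf : MemWeightedSmooth 𝓘(ℝ, ℝ) radialRegion l f) (j : ℕ) :
    MemWeightedSmooth 𝓘(ℝ, ℝ) radialRegion (j + l) (fun s => s ^ j * f s) :=
  hf.pow_smul radialRegion_isRegular j

namespace IsRadialPart

variable {F : ℝ → ℝ} {a : ℕ∞}

theorem contDiffOn_inv (hF : IsRadialPart F a) : ContDiffOn ℝ ∞ (fun s => (1 + F s)⁻¹) (Ico 0 1) :=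
  (contDiffOn_const.add hF.smooth).inv fun s hs => (hF.pos s hs).ne'

/-- `F` is divisible by `s`. -/
theorem exists_eq_mul (hF : IsRadialPart F a) :
    ∃ b : ℝ → ℝ, ContDiffOn ℝ ∞ b (Ico 0 1) ∧ ∀ s ∈ Ioo (0 : ℝ) 1, F s = s * b s := by
  obtain ⟨b, hb, e⟩ := hF.mem 1 (by simp)
  refine ⟨b, contMDiffOn_iff_contDiffOn.1 hb, fun s hs => ?_⟩
  have := e s hs
  rwa [pow_one] at this

/-- If F = sᵏb then sF′ = sᵏ(kb + sb′): the operator s∂_s preserves weights. -/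
theorem mul_derivWithin_mem (hF : IsRadialPart F a) :
    MemWeightedSmooth 𝓘(ℝ, ℝ) radialRegion (1 + a)
      (fun s => s * derivWithin F (Ico 0 1) s) := by
  intro k hk
  obtain ⟨b, hb, e⟩ := hF.mem k hk
  have hb' : ContDiffOn ℝ ∞ b (Ico 0 1) := contMDiffOn_iff_contDiffOn.1 hb
  refine ⟨fun s => k * b s + s * derivWithin b (Ico 0 1) s, contMDiffOn_iff_contDiffOn.2
    ((contDiffOn_const.mul hb').add (contDiffOn_id.mul (contDiffOn_derivWithin_Ico hb'))),
    fun s hs => ?_⟩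
  have hs' : s ∈ Ioo (0 : ℝ) 1 := hs
  have h1 : F =ᶠ[𝓝 s] fun t => t ^ k * b t := by
    filter_upwards [Ioo_mem_nhds hs'.1 hs'.2] with t ht using e t ht
  have h2 := ((hasDerivAt_pow k s).mul (hasDerivAt_of_contDiffOn_Ico hb' hs')).congr_of_eventuallyEq h1
  have h3 := (hasDerivAt_of_contDiffOn_Ico hF.smooth hs').unique h2
  beta_reduce
  rw [h3]
  change s * (k * s ^ (k - 1) * b s + s ^ k * derivWithin b (Ico 0 1) s)
    = s ^ k * (k * b s + s * derivWithin b (Ico 0 1) s)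
  rcases Nat.eq_zero_or_pos k with rfl | hk0
  · simp
  · obtain ⟨j, rfl⟩ := Nat.exists_eq_succ_of_ne_zero hk0.ne'
    rw [Nat.succ_sub_one, pow_succ]
    ring

/-- If a ≥ 1 then F = O(s²) and the mass vanishes; if a = 0 the weight is 1 and there is nothing to
gain. In both cases 𝔪s decays like F. -/
theorem mass_mem (hF : IsRadialPart F a) {m : ℝ}
    (hm : ∀ b : ℝ → ℝ, ContDiffOn ℝ ∞ b (Ico 0 1) → (∀ s ∈ Ioo (0 : ℝ) 1, F s = s * b s) →
      b 0 = m) :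
    MemWeightedSmooth 𝓘(ℝ, ℝ) radialRegion (1 + a) (fun s => m * s) := by
  by_cases ha : 1 ≤ a
  · obtain ⟨b, hb, e⟩ := hF.mem 2 (by
      rw [show ((2 : ℕ) : ℕ∞) = 1 + 1 by norm_num]; gcongr)
    have h1 := hm (fun s => s * b s) (contDiffOn_id.mul (contMDiffOn_iff_contDiffOn.1 hb))
      fun s hs => (e s hs).trans (by change s ^ 2 * b s = _; ring)
    have h2 : m = 0 := by rw [← h1, zero_mul]
    exact (MemWeightedSmooth.zero _).congr fun s _ => by rw [h2, zero_mul]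
  · have h0 : a = 0 := Order.lt_one_iff.1 (not_le.1 ha)
    subst h0
    have h1 := (MemWeightedSmooth.of_contMDiffOn (D := radialRegion) (I := 𝓘(ℝ, ℝ))
      (contMDiffOn_const (c := m))).radial_pow_mul 1
    rw [Nat.cast_one] at h1
    exact h1.congr fun s _ => by ring

/-- After adding ns, the bracket multiplied by s is a smooth combination of 𝔪s, sF′ and F: the
coefficients are (1−n)/(2(1+F)), −(1+𝔪s/2)/(2(1+F)²) and n/(1+F). All three lie in ρ^{1+a}. -/
theorem laplacian_mem (hF : IsRadialPart F a) {m : ℝ}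
    (hm : MemWeightedSmooth 𝓘(ℝ, ℝ) radialRegion (1 + a) (fun s => m * s)) (n : ℕ) :
    MemWeightedSmooth 𝓘(ℝ, ℝ) radialRegion (2 + a)
      (fun s => radialLaplacian n m F s + n * s) := by
  have hi := hF.contDiffOn_inv
  have hq : ContDiffOn ℝ ∞ (fun s : ℝ => 1 + m / 2 * s) (Ico 0 1) := by fun_prop
  have h1 := (hm.radial_mul ((contDiffOn_const (c := (1 - n : ℝ) / 2)).mul hi)).add
    ((hF.mul_derivWithin_mem.radial_mul
      ((contDiffOn_const (c := (-(1 / 2) : ℝ))).mul (hq.mul (hi.pow 2)))).add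
    (hF.mem.radial_mul ((contDiffOn_const (c := (n : ℝ))).mul hi)))
  have h2 := h1.radial_pow_mul 1
  rw [Nat.cast_one, ← add_assoc, one_add_one_eq_two] at h2
  refine h2.congr fun s hs => ?_
  have hs' : s ∈ Ioo (0 : ℝ) 1 := hs
  have := (hF.pos s ⟨hs'.1.le, hs'.2⟩).ne'
  rw [radialLaplacian]
  field_simp
  ring

/-- The expression equals s²(𝔪s − 2F)/(1+F). -/
theorem gradient_mem (hF : IsRadialPart F a) {m : ℝ}
    (hm : MemWeightedSmooth 𝓘(ℝ, ℝ) radialRegion (1 + a) (fun s => m * s)) :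
    MemWeightedSmooth 𝓘(ℝ, ℝ) radialRegion (1 + (2 + a))
      (fun s => -(2 * s ^ 2) + 2 * s ^ 2 * ((1 + m / 2 * s) / (1 + F s))) := by
  have hi := hF.contDiffOn_inv
  have h1 := (hm.radial_mul hi).add
    (hF.mem.radial_mul ((contDiffOn_const (c := (-2 : ℝ))).mul hi))
  have h2 := h1.radial_pow_mul 2
  rw [Nat.cast_ofNat, add_left_comm] at h2
  refine h2.congr fun s hs => ?_
  have hs' : s ∈ Ioo (0 : ℝ) 1 := hs
  have := (hF.pos s ⟨hs'.1.le, hs'.2⟩).ne'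
  field_simp
  ring

/-- With q = 1 + 𝔪s/2, the expression is (1−q)² − q²F/(1+F), and (1−q)² = (𝔪s/4)·𝔪s. -/
theorem norm_mem (hF : IsRadialPart F a) {m : ℝ}
    (hm : MemWeightedSmooth 𝓘(ℝ, ℝ) radialRegion (1 + a) (fun s => m * s)) :
    MemWeightedSmooth 𝓘(ℝ, ℝ) radialRegion (1 + a)
      (fun s => 1 + (1 + m / 2 * s) ^ 2 / (1 + F s) - 2 * (1 + m / 2 * s)) := by
  have hi := hF.contDiffOn_inv
  have hq : ContDiffOn ℝ ∞ (fun s : ℝ => -(1 + m / 2 * s) ^ 2) (Ico 0 1) := by fun_prop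
  have hl : ContDiffOn ℝ ∞ (fun s : ℝ => m / 4 * s) (Ico 0 1) := by fun_prop
  refine ((hm.radial_mul hl).add (hF.mem.radial_mul (hq.mul hi))).congr fun s hs => ?_
  have hs' : s ∈ Ioo (0 : ℝ) 1 := hs
  have := (hF.pos s ⟨hs'.1.le, hs'.2⟩).ne'
  field_simp
  ring

/-- The numerator over 1 + F is 𝔪s + 𝔪²s²/4 − F. For a ≥ 1 its terms have weight 1 + a = 2 + (a−1).
For a = 0, where a − 1 truncates to 0, weight 2 comes from the cancellation of 𝔪s against the
leading term of F; this is what fixes the exponent of r in the conjugation. -/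
theorem norm_sub_one_mem (hF : IsRadialPart F a) {m : ℝ}
    (hb : ∀ b : ℝ → ℝ, ContDiffOn ℝ ∞ b (Ico 0 1) → (∀ s ∈ Ioo (0 : ℝ) 1, F s = s * b s) →
      b 0 = m) :
    MemWeightedSmooth 𝓘(ℝ, ℝ) radialRegion (2 + (a - 1))
      (fun s => (1 + m / 2 * s) ^ 2 / (1 + F s) - 1) := by
  have hi := hF.contDiffOn_inv
  by_cases ha : 1 ≤ a
  · have hl : ContDiffOn ℝ ∞ (fun s : ℝ => 1 + m / 4 * s) (Ico 0 1) := by fun_prop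
    have h1 := ((hF.mass_mem hb).radial_mul (hl.mul hi)).add
      (hF.mem.radial_mul ((contDiffOn_const (c := (-1 : ℝ))).mul hi))
    have e : 2 + (a - 1) = 1 + a := by
      rw [← one_add_one_eq_two, add_assoc, add_tsub_cancel_of_le ha]
    rw [e]
    refine h1.congr fun s hs => ?_
    have hs' : s ∈ Ioo (0 : ℝ) 1 := hs
    have := (hF.pos s ⟨hs'.1.le, hs'.2⟩).ne'
    field_simp
    ring
  · have h0 : a = 0 := Order.lt_one_iff.1 (not_le.1 ha)
    subst h0
    obtain ⟨b, hbs, e⟩ := hF.exists_eq_mul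
    obtain ⟨b', hbs', e'⟩ := exists_contDiffOn_div hbs
    rw [hb b hbs e] at e'
    have h1 : ContDiffOn ℝ ∞ (fun s => (m ^ 2 / 4 - b' s) * (1 + F s)⁻¹) (Ico 0 1) :=
      (contDiffOn_const.sub hbs').mul hi
    have h2 := (MemWeightedSmooth.of_contMDiffOn (D := radialRegion)
      (contMDiffOn_iff_contDiffOn.2 h1)).radial_pow_mul 2
    rw [zero_tsub]
    refine h2.congr fun s hs => ?_
    have hs' : s ∈ Ioo (0 : ℝ) 1 := hs
    have := (hF.pos s ⟨hs'.1.le, hs'.2⟩).ne'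
    have h3 : F s = s * (m + s * b' s) := by rw [e s hs', ← e' s ⟨hs'.1.le, hs'.2⟩]
    field_simp
    rw [h3]
    ring

end IsRadialPart

end Radial
end AsympConic

end

noncomputable section
namespace AsympConic

set_option linter.unusedSectionVars false

/-! ## Membership of the coefficients -/

section Fields

variable {E H M : Type*} [NormedAddCommGroup E] [NormedSpace ℝ E]
  [TopologicalSpace H] [TopologicalSpace M] [ChartedSpace H M] {I : ModelWithCorners ℝ E H}
  [IsManifold I ∞ M] {D : Region M} {l : ℕ∞} {V W : (x : M) → TangentSpace I x}

theorem IsBVectorField.smul {c : M → ℝ} (hc : ContMDiffOn I 𝓘(ℝ, ℝ) ∞ c D.carrier)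
    (hV : IsBVectorField I D V) : IsBVectorField I D (fun x => c x • V x) := by
  obtain ⟨f, hf, e⟩ := hV.tangent
  refine ⟨ContMDiffOn.smul_section hc hV.smooth, _, hc.mul hf, fun x hx => ?_⟩
  refine (map_smul (mfderivWithin I 𝓘(ℝ, ℝ) D.bdf D.carrier x) (c x) (V x)).trans ?_
  refine (congrArg (fun t : ℝ => c x * t) (e x hx)).trans ?_
  exact mul_left_comm _ _ _

theorem MemWeightedField.add (hV : MemWeightedField I D l V) (hW : MemWeightedField I D l W) :
    MemWeightedField I D l (fun x => V x + W x) := by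
  intro k hk
  obtain ⟨V', hV', e⟩ := hV k hk
  obtain ⟨W', hW', e'⟩ := hW k hk
  exact ⟨_, hV'.add hW', fun x hx => by beta_reduce; rw [e x hx, e' x hx, smul_add]⟩

theorem MemWeightedField.const_smul (hV : MemWeightedField I D l V) (c : ℝ) :
    MemWeightedField I D l (fun x => c • V x) := by
  intro k hk
  obtain ⟨V', hV', e⟩ := hV k hk
  exact ⟨_, hV'.smul (contMDiffOn_const (c := c)),
    fun x hx => by beta_reduce; rw [e x hx, smul_comm]⟩

theorem MemWeightedSmooth.smul_field {f : M → ℝ} (hf : MemWeightedSmooth I D l f)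
    (hV : IsBVectorField I D V) : MemWeightedField I D l (fun x => f x • V x) := by
  intro k hk
  obtain ⟨a, ha, e⟩ := hf k hk
  exact ⟨_, hV.smul ha, fun x hx => by beta_reduce; rw [e x hx, smul_assoc]⟩

end Fields

/-! ### Cutoffs and the transport field -/

section Coefficients

variable {n : ℕ} {X Y : Type*}
  [TopologicalSpace X] [ChartedSpace (EuclideanHalfSpace (n + 1)) X]
  [IsManifold (𝓡∂ (n + 1)) ∞ X]
  [TopologicalSpace Y] [ChartedSpace (EuclideanSpace ℝ (Fin n)) Y] [IsManifold (𝓡 n) ∞ Y]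
  {C : Collar n X Y} {h : BoundaryMetric n Y} {g : BilinField n X}

/-- A cutoff vanishes to infinite order at the boundary. -/
theorem Collar.IsCutoff.mem_top {χ : X → ℝ} (hχ : C.IsCutoff χ) (l : ℕ∞) :
    MemWeightedSmooth (𝓘(ℝ, ℝ).prod (𝓡 n)) (cylinder Y) l (fun p => χ (C.toFun p)) := by
  intro k _
  refine ⟨fun p => (p.1 ^ k)⁻¹ * χ (C.toFun p), fun p hp => ?_, fun p hp => ?_⟩
  · have hχC : ContMDiffOn (𝓘(ℝ, ℝ).prod (𝓡 n)) 𝓘(ℝ, ℝ) ∞ (fun p => χ (C.toFun p))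
        (cylinder Y).carrier := hχ.smooth.comp_contMDiffOn C.contMDiffOn_toFun
    rcases eq_or_lt_of_le hp.1.1 with h0 | h0
    -- The support of χ is closed and contained in the interior, so χ vanishes near each boundary
    -- point and dividing by ρᵏ is harmless.
    · have h1 : C.toFun p ∉ tsupport χ := fun h => by
        have h2 := C.bdf_pos_iff.2 (hχ.support_subset h)
        rw [show p = (p.1, p.2) from rfl, C.bdf_collar _ hp.1, ← h0] at h2
        exact lt_irrefl _ h2
      have h2 : ∀ᶠ q in 𝓝[(cylinder Y).carrier] p, C.toFun q ∈ (tsupport χ)ᶜ :=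
        (C.contMDiffOn_toFun.continuousOn p hp).tendsto
          ((isClosed_tsupport χ).isOpen_compl.mem_nhds h1)
      have h3 : ∀ q, C.toFun q ∈ (tsupport χ)ᶜ → (q.1 ^ k)⁻¹ * χ (C.toFun q) = 0 := fun q hq => by
        rw [image_eq_zero_of_notMem_tsupport hq, mul_zero]
      exact (contMDiffWithinAt_const (c := (0 : ℝ))).congr_of_eventuallyEq
        (h2.mono fun q hq => h3 q hq) (h3 p h1)
    · have h1 : ContMDiffAt (𝓘(ℝ, ℝ).prod (𝓡 n)) 𝓘(ℝ, ℝ) ∞ (fun q : ℝ × Y => (q.1 ^ k)⁻¹) p :=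
        (((contDiffAt_id.pow k).inv (pow_ne_zero k h0.ne')).contMDiffAt).comp p contMDiffAt_fst
      exact h1.contMDiffWithinAt.mul (hχC p hp)
  · have : p.1 ≠ 0 := hp.1.1.ne'
    change χ (C.toFun p) = p.1 ^ k * ((p.1 ^ k)⁻¹ * χ (C.toFun p))
    field_simp

/-- Without boundary all conditions on the collar are vacuous. The case is treated separately
because the mass hypothesis then does not determine 𝔪. -/
theorem Collar.memFunSum_of_isEmpty [IsEmpty Y] (w a b : ℕ∞) {f : X → ℂ}
    (hf : ContMDiffOn (𝓡∂ (n + 1)) 𝓘(ℝ, ℂ) ∞ f ((𝓡∂ (n + 1)).interior X)) :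
    C.MemFunSum w a b f :=
  C.memFunSum_of_collar hf (MemWeightedSmooth.zero _) (MemWeightedSmooth.zero _)
    fun _ _ θ => isEmptyElim θ

theorem contMDiffOn_ofReal {f : X → ℝ} {S : Set X}
    (hf : ContMDiffOn (𝓡∂ (n + 1)) 𝓘(ℝ, ℝ) ∞ f S) :
    ContMDiffOn (𝓡∂ (n + 1)) 𝓘(ℝ, ℂ) ∞ (fun x => (f x : ℂ)) S :=
  Complex.ofRealCLM.contDiff.contMDiff.comp_contMDiffOn hf

theorem Collar.contMDiffOn_phaseNorm (C : Collar n X Y) (hg : IsRiemannianInside g) (m : ℝ) :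
    ContMDiffOn (𝓡∂ (n + 1)) 𝓘(ℝ, ℝ) ∞ (C.phaseNorm g m) ((𝓡∂ (n + 1)).interior X) :=
  contMDiffOn_mfderiv_apply isOpen_interior_manifold (C.contMDiffOn_phaseFun m)
    (contMDiffOn_gradField hg (C.contMDiffOn_phaseFun m))

/-- The vector field `∂_r` on the collar. -/
def Collar.radialField (C : Collar n X Y) : (x : X) → TangentSpace (𝓡∂ (n + 1)) x :=
  C.push (radialLift n Y fun t => -t ^ 2)

theorem Collar.radialDeriv_eq (C : Collar n X Y) {u : X → ℂ}
    (hu : SmoothInside (𝓡∂ (n + 1)) C.region u) {x : X} (hx : x ∈ C.target)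
    (hx' : x ∈ (𝓡∂ (n + 1)).interior X) :
    C.radialDeriv u x = applyField (𝓡∂ (n + 1)) C.radialField u x := by
  obtain ⟨s, hs, θ, rfl⟩ := C.interior_eq_iUnion hx hx'
  have hinv : C.invFun (C.toFun (s, θ)) = (s, θ) :=
    C.left_inv' (C.mem_source ⟨hs.1.le, hs.2⟩ θ)
  rw [Collar.radialField, C.applyField_push hu hs,
    applyField_radialLift (Collar.SmoothInside.comp_toFun hu) hs, Collar.radialDeriv, hinv]
  push_cast
  rfl

/-- The field of the transport equation, `2(1-χ)∂_r - 2∇φ`. -/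
def Collar.transportField (C : Collar n X Y) (g : BilinField n X) (m : ℝ) (χ : X → ℝ) (x : X) :
    TangentSpace (𝓡∂ (n + 1)) x :=
  (1 - χ x) • (2 : ℝ) • C.radialField x + (-2 : ℝ) • gradField g (C.phaseFun m) x

theorem Collar.contMDiffOn_transportField (C : Collar n X Y) (hg : IsRiemannianInside g) (m : ℝ)
    {χ : X → ℝ} (hχ : C.IsCutoff χ) :
    ContMDiffOn (𝓡∂ (n + 1)) (𝓡∂ (n + 1)).tangent ∞
      (fun x => (⟨x, C.transportField g m χ x⟩ : TangentBundle (𝓡∂ (n + 1)) X))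
      ((𝓡∂ (n + 1)).interior X) := by
  have h1 : ContMDiffOn (𝓡∂ (n + 1)) (𝓡∂ (n + 1)).tangent ∞
      (fun x => (⟨x, C.radialField x⟩ : TangentBundle (𝓡∂ (n + 1)) X)) C.target :=
    C.contMDiffOn_push Subset.rfl (fun x hx => C.invFun_mem hx)
      (contMDiffOn_radialLift (contDiff_id.pow 2).neg.contMDiff.contMDiffOn)
  have h2 : ContMDiffOn (𝓡∂ (n + 1)) 𝓘(ℝ, ℝ) ∞ (fun x => 1 - χ x) C.target :=
    (contMDiff_const.sub hχ.smooth).contMDiffOn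
  have h3 := ContMDiffOn.smul_section_of_tsupport h2 C.isOpen_target hχ.support_one_sub
    (h1.const_smul_section (a := (2 : ℝ)))
  exact h3.contMDiffOn.add_section
    ((contMDiffOn_gradField hg (C.contMDiffOn_phaseFun m)).const_smul_section (a := (-2 : ℝ)))

/-- On the collar `radialDeriv` is the derivative along `radialField`. Off it neither is meaningful,
and both are multiplied by 1 − χ = 0. -/
theorem Collar.applyField_transportField (C : Collar n X Y) (m : ℝ) {χ : X → ℝ}
    (hχ : C.IsCutoff χ) {u : X → ℂ} (hu : SmoothInside (𝓡∂ (n + 1)) C.region u) {x : X}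
    (hx : x ∈ (𝓡∂ (n + 1)).interior X) :
    applyField (𝓡∂ (n + 1)) (C.transportField g m χ) u x
      = 2 * (1 - χ x) * C.radialDeriv u x - 2 * dfun u x (gradField g (C.phaseFun m) x) := by
  have h1 : applyField (𝓡∂ (n + 1)) (C.transportField g m χ) u x
      = (1 - χ x) • (2 : ℝ) • applyField (𝓡∂ (n + 1)) C.radialField u x
        + (-2 : ℝ) • dfun u x (gradField g (C.phaseFun m) x) := by
    unfold applyField Collar.transportField
    refine (map_add (mfderiv (𝓡∂ (n + 1)) 𝓘(ℝ, ℂ) u x) _ _).trans ?_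
    refine congrArg₂ (· + ·) ?_ (map_smul (mfderiv (𝓡∂ (n + 1)) 𝓘(ℝ, ℂ) u x) _ _)
    refine (map_smul (mfderiv (𝓡∂ (n + 1)) 𝓘(ℝ, ℂ) u x) _ _).trans ?_
    exact congrArg _ (map_smul (mfderiv (𝓡∂ (n + 1)) 𝓘(ℝ, ℂ) u x) _ _)
  rw [h1]
  by_cases hxt : x ∈ C.target
  · rw [C.radialDeriv_eq hu hxt hx]
    simp only [Complex.real_smul]
    push_cast
    ring
  · have h2 : 1 - χ x = 0 :=
      image_eq_zero_of_notMem_tsupport (f := fun x => 1 - χ x) fun h => hxt (hχ.support_one_sub h)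
    have h3 : (1 : ℂ) - χ x = 0 := by exact_mod_cast h2
    rw [h2, h3]
    simp only [Complex.real_smul]
    push_cast
    ring

end Coefficients
end AsympConic

end

noncomputable section
namespace AsympConic

set_option linter.unusedSectionVars false

/-! ### Weights of △φ + nρ, of the transport field and of |dφ|² -/

section Membership

variable {n : ℕ} {X Y : Type*}
  [TopologicalSpace X] [ChartedSpace (EuclideanHalfSpace (n + 1)) X]
  [IsManifold (𝓡∂ (n + 1)) ∞ X]
  [TopologicalSpace Y] [ChartedSpace (EuclideanSpace ℝ (Fin n)) Y] [IsManifold (𝓡 n) ∞ Y]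
  {C : Collar n X Y} {h : BoundaryMetric n Y} {g : BilinField n X}
  {F : ℝ → ℝ} {a a₀ : ℕ∞} {m : ℝ}

/-- The leading term −nρ of △φ, the mean curvature of the cone, is compensated by the first-order
term iσ(d−1)/r of the family. What remains is the radial part from the model plus the angular
remainder. -/
theorem memFunSum_laplacian_phase (hg : IsRiemannianInside g) (hF : IsRadialPart F a)
    (H : HasNormalForms C h g F (1 + a₀))
    (hm : Nonempty Y → MemWeightedSmooth 𝓘(ℝ, ℝ) radialRegion (1 + a) (fun s => m * s)) :
    C.MemFunSum 2 a a₀ (fun x => laplacian g (fun z => (C.phaseFun m z : ℂ)) x + n * C.bdf x) := by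
  have hs : ContMDiffOn (𝓡∂ (n + 1)) 𝓘(ℝ, ℂ) ∞
      (fun x => laplacian g (fun z => (C.phaseFun m z : ℂ)) x + n * C.bdf x)
      ((𝓡∂ (n + 1)).interior X) := by
    refine (contMDiffOn_laplacian hg (C.contMDiffOn_phaseFun m)).add ?_
    exact ((contDiff_const.mul contDiff_id).contMDiff (f := fun z : ℂ => n * z)).comp_contMDiffOn
      (contMDiffOn_ofReal C.bdf_smooth.contMDiffOn)
  rcases isEmpty_or_nonempty Y with hY | hY
  · exact Collar.memFunSum_of_isEmpty _ _ _ hs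
  have h1 := H.laplacian hg (l := 1 + a₀) le_self_add m
  rw [← add_assoc, one_add_one_eq_two] at h1
  refine C.memFunSum_of_collar hs (hF.laplacian_mem (hm hY) n).ofReal h1 fun s hs θ => ?_
  rw [C.bdf_collar s ⟨hs.1.le, hs.2⟩]
  push_cast
  ring

theorem memDiffSum_transportField (hg : IsRiemannianInside g) (hF : IsRadialPart F a)
    (H : HasNormalForms C h g F (1 + a₀))
    (hm : Nonempty Y → MemWeightedSmooth 𝓘(ℝ, ℝ) radialRegion (1 + a) (fun s => m * s))
    {χ : X → ℝ} (hχ : C.IsCutoff χ) :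
    C.MemDiffSum 1 2 a a₀ (applyField (𝓡∂ (n + 1)) (C.transportField g m χ)) := by
  have hs := C.contMDiffOn_transportField hg m hχ
  have htwo : IsBVectorField (𝓘(ℝ, ℝ).prod (𝓡 n)) (cylinder Y)
      (radialLift n Y fun s => s * 1) := by
    refine ⟨contMDiffOn_radialLift (contMDiffOn_id.mul contMDiffOn_const), fun _ => 1,
      contMDiffOn_const, fun p hp => ?_⟩
    exact mfderivWithin_bdf_cylinder hp _
  -- The part −2χ∂_r = 2ρχ·(ρ∂_ρ) of the transport field; it vanishes to infinite order at the
  -- boundary.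
  have hχ' : MemWeightedField (𝓘(ℝ, ℝ).prod (𝓡 n)) (cylinder Y) (2 + a₀)
      (fun p => (2 * p.1 * χ (C.toFun p)) • radialLift n Y (fun s => s * 1) p) :=
    ((hχ.mem_top _).mul_left (contMDiffOn_const.mul contMDiffOn_fst)).smul_field htwo
  rcases isEmpty_or_nonempty Y with hY | hY
  · exact C.memDiffSum_applyField hs (MemWeightedSmooth.zero _) hχ'
      fun x hx => isEmptyElim (C.invFun x).2
  have h1 := H.memWeightedField hg (l := 1 + a₀) le_self_add m
  rw [← add_assoc, one_add_one_eq_two] at h1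
  refine C.memDiffSum_applyField hs (hF.gradient_mem (hm hY)) (hχ'.add (h1.const_smul (-2)))
    fun x hx hx' => ?_
  obtain ⟨s, hs, θ, rfl⟩ := C.interior_eq_iUnion hx hx'
  rw [Collar.transportField, gradField_eq_push hg H le_self_add m hs θ, Collar.radialField,
    C.push_toFun hs, C.push_toFun hs, C.push_toFun hs]
  set T : (ℝ × EuclideanSpace ℝ (Fin n)) →L[ℝ] EuclideanSpace ℝ (Fin (n + 1)) :=
    mfderiv (𝓘(ℝ, ℝ).prod (𝓡 n)) (𝓡∂ (n + 1)) C.toFun (s, θ) with hT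
  obtain ⟨G, hG⟩ : ∃ G : ℝ × EuclideanSpace ℝ (Fin n), G = gradRemainder C g m F (s, θ) :=
    ⟨_, rfl⟩
  rw [← hG]
  change (1 - χ (C.toFun (s, θ))) • (2 : ℝ) • T ((-s ^ 2, 0) : ℝ × EuclideanSpace ℝ (Fin n))
    + (-2 : ℝ) • T (((-(s ^ 2) * ((1 + m / 2 * s) / (1 + F s)), 0) : ℝ × EuclideanSpace ℝ (Fin n))
      + G)
    = T (((-(2 * s ^ 2) + 2 * s ^ 2 * ((1 + m / 2 * s) / (1 + F s)), 0) :
        ℝ × EuclideanSpace ℝ (Fin n))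
      + ((2 * s * χ (C.toFun (s, θ))) • ((s * 1, 0) : ℝ × EuclideanSpace ℝ (Fin n))
      + (-2 : ℝ) • G))
  rw [← map_smul, ← map_smul, ← map_smul, ← map_add]
  refine congrArg T (Prod.ext ?_ ?_)
  · simp only [Prod.fst_add, Prod.smul_fst, smul_eq_mul]
    ring
  · simp only [Prod.snd_add, Prod.smul_snd, smul_zero, zero_add]

/-- Near the boundary, where χ = 0, this is 1 + |dφ|² − 2∂_rφ. It vanishes to first order because
|dφ|² and ∂_rφ both tend to 1. -/
theorem memFunSum_phaseNorm (hg : IsRiemannianInside g) (hF : IsRadialPart F a)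
    (H : HasNormalForms C h g F (1 + a₀))
    (hm : Nonempty Y → MemWeightedSmooth 𝓘(ℝ, ℝ) radialRegion (1 + a) (fun s => m * s))
    {χ : X → ℝ} (hχ : C.IsCutoff χ) :
    C.MemFunSum 1 a a₀ (fun x =>
      ((1 + C.phaseNorm g m x - 2 * (1 - χ x) * (1 + m / 2 * C.bdf x) : ℝ) : ℂ)) := by
  have hs : ContMDiffOn (𝓡∂ (n + 1)) 𝓘(ℝ, ℝ) ∞
      (fun x => 1 + C.phaseNorm g m x - 2 * (1 - χ x) * (1 + m / 2 * C.bdf x))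
      ((𝓡∂ (n + 1)).interior X) :=
    (contMDiffOn_const.add (C.contMDiffOn_phaseNorm hg m)).sub
      ((contMDiffOn_const.mul (contMDiffOn_const.sub hχ.smooth.contMDiffOn)).mul
        (contMDiffOn_const.add (contMDiffOn_const.mul C.bdf_smooth.contMDiffOn)))
  rcases isEmpty_or_nonempty Y with hY | hY
  · exact Collar.memFunSum_of_isEmpty _ _ _ (contMDiffOn_ofReal hs)
  have h1 := H.phaseNorm hg (l := 1 + a₀) le_self_add m
  have h2 := (hχ.mem_top (1 + a₀)).mul_left (c := fun p : ℝ × Y => 2 * (1 + m / 2 * p.1))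
    (contMDiffOn_const.mul (contMDiffOn_const.add (contMDiffOn_const.mul contMDiffOn_fst)))
  refine C.memFunSum_of_collar (contMDiffOn_ofReal hs) (hF.norm_mem (hm hY)).ofReal
    (h1.add h2).ofReal fun s hs θ => ?_
  rw [C.bdf_collar s ⟨hs.1.le, hs.2⟩]
  push_cast
  ring

/-- The angular remainder has weight 1 + a₀ = 2 + (a₀ − 1) since a₀ ≥ 1. The radial part relies on
the exact value of the mass and not merely on the decay of 𝔪ρ. -/
theorem memFunSum_phaseNorm_sub_one (hg : IsRiemannianInside g) (hF : IsRadialPart F a)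
    (ha₀ : 1 ≤ a₀) (H : HasNormalForms C h g F (1 + a₀))
    (hm : Nonempty Y → ∀ b : ℝ → ℝ, ContDiffOn ℝ ∞ b (Ico 0 1) →
      (∀ s ∈ Ioo (0 : ℝ) 1, F s = s * b s) → b 0 = m) :
    C.MemFunSum 2 (a - 1) (a₀ - 1) (fun x => ((C.phaseNorm g m x - 1 : ℝ) : ℂ)) := by
  have hs : ContMDiffOn (𝓡∂ (n + 1)) 𝓘(ℝ, ℝ) ∞ (fun x => C.phaseNorm g m x - 1)
      ((𝓡∂ (n + 1)).interior X) := (C.contMDiffOn_phaseNorm hg m).sub contMDiffOn_const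
  rcases isEmpty_or_nonempty Y with hY | hY
  · exact Collar.memFunSum_of_isEmpty _ _ _ (contMDiffOn_ofReal hs)
  have h1 := H.phaseNorm hg (l := 1 + a₀) le_self_add m
  have e : 1 + a₀ = 2 + (a₀ - 1) := by
    rw [← one_add_one_eq_two, add_assoc, add_tsub_cancel_of_le ha₀]
  rw [e] at h1
  refine C.memFunSum_of_collar (contMDiffOn_ofReal hs) (hF.norm_sub_one_mem (hm hY)).ofReal
    h1.ofReal fun s hs θ => ?_
  push_cast
  ring

end Membership
end AsympConic

end

noncomputable section
namespace AsympConic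

set_option linter.unusedSectionVars false

/-! ## Conjugation by the phase -/

section Families

variable {n : ℕ} {X Y : Type*}
  [TopologicalSpace X] [ChartedSpace (EuclideanHalfSpace (n + 1)) X]
  [IsManifold (𝓡∂ (n + 1)) ∞ X]
  [TopologicalSpace Y] [ChartedSpace (EuclideanSpace ℝ (Fin n)) Y] [IsManifold (𝓡 n) ∞ Y]
  {C : Collar n X Y} {h : BoundaryMetric n Y} {g : BilinField n X}

theorem laplacian_congr (g : BilinField n X) {u v : X → ℂ}
    (huv : ∀ z ∈ (𝓡∂ (n + 1)).interior X, v z = u z) {x : X}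
    (hx : x ∈ (𝓡∂ (n + 1)).interior X) : laplacian g v x = laplacian g u x := by
  obtain ⟨Ω, h1, h2, -, -, h3, -⟩ := exists_isOpen_chart hx
  simp only [laplacian]
  set y := extChartAt (𝓡∂ (n + 1)) x x with hy
  set Φ : EuclideanSpace ℝ (Fin (n + 1)) → X := ⇑(extChartAt (𝓡∂ (n + 1)) x).symm with hΦ
  have e : ∀ z ∈ Ω, (fun z => v (Φ z)) =ᶠ[𝓝 z] fun z => u (Φ z) := fun z hz => by
    filter_upwards [h1.mem_nhds hz] with w hw using huv _ (h3 hw)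
  have e1 : ∀ k, ∀ z ∈ Ω, pd k (fun z => v (Φ z)) z = pd k (fun z => u (Φ z)) z := fun k z hz =>
    congrArg (fun L : EuclideanSpace ℝ (Fin (n + 1)) →L[ℝ] ℂ => L (EuclideanSpace.single k 1))
      (e z hz).fderiv_eq
  have e2 : ∀ i j, pd i (pd j (fun z => v (Φ z))) y = pd i (pd j (fun z => u (Φ z))) y := by
    intro i j
    have e3 : pd j (fun z => v (Φ z)) =ᶠ[𝓝 y] pd j (fun z => u (Φ z)) := by
      filter_upwards [h1.mem_nhds h2] with z hz using e1 j z hz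
    exact congrArg (fun L : EuclideanSpace ℝ (Fin (n + 1)) →L[ℝ] ℂ =>
      L (EuclideanSpace.single i 1)) e3.fderiv_eq
  simp only [e2, e1 _ y h2]

/-- Since r = 1/ρ > 0 in the interior, the complex power is exp of a multiple of log r = −log ρ. At
the boundary the two sides are unrelated, which is why the lemmas below ask for equality in the
interior only. -/
theorem Collar.phase_eq (C : Collar n X Y) (m σ : ℝ) {x : X} (hx : x ∈ (𝓡∂ (n + 1)).interior X) :
    C.phase m σ x = Complex.exp (Complex.I * σ * C.phaseFun m x) := by
  have hpos : 0 < C.bdf x := C.bdf_pos_iff.2 hx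
  have h0 : ((C.bdf x)⁻¹ : ℝ) ≠ 0 := (inv_pos.2 hpos).ne'
  rw [Collar.phase, Collar.r, Complex.cpow_def_of_ne_zero (by exact_mod_cast h0),
    ← Complex.ofReal_log (inv_pos.2 hpos).le, Real.log_inv, ← Complex.exp_add, Collar.phaseFun,
    phaseFn]
  congr 1
  push_cast
  ring

theorem Collar.phase_neg_mul (C : Collar n X Y) (m σ : ℝ) {x : X}
    (hx : x ∈ (𝓡∂ (n + 1)).interior X) (c : ℂ) :
    C.phase m (-σ) x * (Complex.exp (Complex.I * σ * C.phaseFun m x) * c) = c := by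
  rw [C.phase_eq m _ hx, ← mul_assoc, ← Complex.exp_add]
  push_cast
  rw [show Complex.I * -(σ : ℂ) * C.phaseFun m x + Complex.I * σ * C.phaseFun m x = 0 by ring,
    Complex.exp_zero, one_mul]

theorem Collar.smoothInside_phaseFun (C : Collar n X Y) (m : ℝ) :
    SmoothInside (𝓡∂ (n + 1)) C.region (fun x => (C.phaseFun m x : ℂ)) :=
  C.region_isRegular.smoothInside_phase m

/-- The chain rule with ∂_rφ = −ρ²(−ρ⁻² − 𝔪/(2ρ)) = 1 + 𝔪ρ/2. -/
theorem Collar.radialDeriv_exp_mul (C : Collar n X Y) (m σ : ℝ) {u v : X → ℂ}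
    (hu : SmoothInside (𝓡∂ (n + 1)) C.region u)
    (hv : ∀ z ∈ (𝓡∂ (n + 1)).interior X,
      v z = Complex.exp (Complex.I * σ * C.phaseFun m z) * u z)
    {x : X} (hx : x ∈ C.target) (hx' : x ∈ (𝓡∂ (n + 1)).interior X) :
    C.radialDeriv v x = Complex.exp (Complex.I * σ * C.phaseFun m x)
      * (C.radialDeriv u x + Complex.I * σ * (1 + m / 2 * C.bdf x) * u x) := by
  obtain ⟨s, hs, θ, rfl⟩ := C.interior_eq_iUnion hx hx'
  have hinv : C.invFun (C.toFun (s, θ)) = (s, θ) :=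
    C.left_inv' (C.mem_source ⟨hs.1.le, hs.2⟩ θ)
  have hφ : ∀ t ∈ Ioo (0 : ℝ) 1, C.phaseFun m (C.toFun (t, θ)) = phaseFn m t := fun t ht => by
    rw [Collar.phaseFun, C.bdf_collar t ⟨ht.1.le, ht.2⟩]
  have hs0 : s ≠ 0 := hs.1.ne'
  have hud : HasDerivAt (fun t : ℝ => u (C.toFun (t, θ)))
      (deriv (fun t : ℝ => u (C.toFun (t, θ))) s) s := by
    have h1 := (Collar.SmoothInside.comp_toFun_radial hu θ).mdifferentiableAt
      radialRegion_isRegular (x := s) hs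
    exact (mdifferentiableAt_iff_differentiableAt.1 h1).hasDerivAt
  have hexp := ((((hasDerivAt_phaseFn m hs0).ofReal_comp).const_mul (Complex.I * σ)).cexp).mul hud
  have e : (fun t : ℝ => v (C.toFun (t, θ))) =ᶠ[𝓝 s]
      fun t => Complex.exp (Complex.I * σ * phaseFn m t) * u (C.toFun (t, θ)) := by
    filter_upwards [Ioo_mem_nhds hs.1 hs.2] with t ht
    rw [hv _ (C.toFun_mem_interior ht θ), hφ t ht]
  have h2 := (hexp.congr_of_eventuallyEq e).deriv
  rw [Collar.radialDeriv, Collar.radialDeriv, hinv]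
  have h3 : deriv (fun t : ℝ => v (C.toFun (t, θ))) s = _ := h2
  rw [h3, hφ s hs, C.bdf_collar s ⟨hs.1.le, hs.2⟩]
  have hs0' : (s : ℂ) ≠ 0 := by exact_mod_cast hs0
  push_cast
  field_simp
  ring

theorem Collar.one_sub_cutoff_mul_radialDeriv (C : Collar n X Y) (m σ : ℝ) {χ : X → ℝ}
    (hχ : C.IsCutoff χ) {u v : X → ℂ} (hu : SmoothInside (𝓡∂ (n + 1)) C.region u)
    (hv : ∀ z ∈ (𝓡∂ (n + 1)).interior X,
      v z = Complex.exp (Complex.I * σ * C.phaseFun m z) * u z)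
    {x : X} (hx : x ∈ (𝓡∂ (n + 1)).interior X) :
    (1 - χ x) * C.radialDeriv v x = Complex.exp (Complex.I * σ * C.phaseFun m x)
      * ((1 - χ x) * (C.radialDeriv u x + Complex.I * σ * (1 + m / 2 * C.bdf x) * u x)) := by
  by_cases hxt : x ∈ C.target
  · rw [C.radialDeriv_exp_mul m σ hu hv hxt hx]
    ring
  · have h2 : 1 - χ x = 0 :=
      image_eq_zero_of_notMem_tsupport (f := fun x => 1 - χ x) fun h => hxt (hχ.support_one_sub h)
    have h3 : (1 : ℂ) - χ x = 0 := by exact_mod_cast h2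
    rw [h3]
    ring

theorem Collar.MemDiffSum.exp_mul {w a b : ℕ∞} {A : Op X} (hA : C.MemDiffSum 1 w a b A) (m σ : ℝ)
    {u v : X → ℂ} (hu : SmoothInside (𝓡∂ (n + 1)) C.region u)
    (hv : ∀ z ∈ (𝓡∂ (n + 1)).interior X,
      v z = Complex.exp (Complex.I * σ * C.phaseFun m z) * u z)
    {x : X} (hx : x ∈ (𝓡∂ (n + 1)).interior X) :
    A v x = Complex.exp (Complex.I * σ * C.phaseFun m x)
      * (A u x + Complex.I * σ * commFun A (fun z => (C.phaseFun m z : ℂ)) x * u x) := by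
  have hφ := C.smoothInside_phaseFun m
  rw [hA.1.congr_arg C.region_isRegular ((hφ.exp_mul (Complex.I * σ)).mul hu) hv hx]
  exact hA.1.exp_mul C.region_isRegular hφ hu (Complex.I * σ) hx

theorem Collar.laplacian_phase_mul (C : Collar n X Y) (hg : IsRiemannianInside g) (m σ : ℝ)
    {u v : X → ℂ} (hu : SmoothInside (𝓡∂ (n + 1)) C.region u)
    (hv : ∀ z ∈ (𝓡∂ (n + 1)).interior X,
      v z = Complex.exp (Complex.I * σ * C.phaseFun m z) * u z)
    {x : X} (hx : x ∈ (𝓡∂ (n + 1)).interior X) :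
    laplacian g v x = Complex.exp (Complex.I * σ * C.phaseFun m x) * (laplacian g u x
      + Complex.I * σ * (u x * laplacian g (fun z => (C.phaseFun m z : ℂ)) x
        - 2 * dfun u x (gradField g (C.phaseFun m) x))
      + σ ^ 2 * C.phaseNorm g m x * u x) := by
  rw [laplacian_congr g hv hx]
  exact laplacian_exp_mul hg (C.contMDiffOn_phaseFun m) hu hx σ

/-- One unit of the common weight is moved into the two individual weights. This is how R, of weight
2, enters P₂, of weight 1, with 1 + ℶ₃ and 1 + ℶ₄. -/
theorem Collar.MemFunSum.lower {w a b : ℕ∞} {f : X → ℂ} (hf : C.MemFunSum (1 + w) a b f) :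
    C.MemFunSum w (1 + a) (1 + b) f := by
  obtain ⟨h, f₁, f₂, h₁, h₂, e⟩ := hf
  have e' : ∀ c : ℕ∞, 1 + w + c = w + (1 + c) := fun c => by rw [add_comm 1 w, add_assoc]
  rw [e'] at h₁ h₂
  exact ⟨h.mono le_add_self, f₁, f₂, h₁, h₂, e⟩

/-- Cutoffs exist. -/
theorem Collar.exists_isCutoff [CompactSpace X] (C : Collar n X Y) : ∃ χ, C.IsCutoff χ := by
  -- By compactness ρ ≥ ε > 0 off the collar. The cutoff below is 0 for ρ ≤ ε/4 and 1 for ρ ≥ ε/2,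
  -- so 1 − χ is supported in the collar.
  obtain ⟨ε, hε, hle⟩ := C.isOpen_target.isClosed_compl.isCompact.exists_forall_le'
    C.bdf_smooth.continuous.continuousOn (a := 0) fun x hx =>
      C.bdf_pos_iff.2 ((C.mem_target_or_interior x).resolve_left hx)
  refine ⟨fun x => Real.smoothTransition (4 / ε * C.bdf x - 1), ?_, ?_, ?_⟩
  · exact (Real.smoothTransition.contDiff.comp
      (show ContDiff ℝ ∞ fun t : ℝ => 4 / ε * t - 1 by fun_prop)).contMDiff.comp C.bdf_smooth
  · have hcl : IsClosed {x | ε / 4 ≤ C.bdf x} :=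
      isClosed_le continuous_const C.bdf_smooth.continuous
    refine (closure_minimal (fun x hx => ?_) hcl).trans fun x hx =>
      C.bdf_pos_iff.1 (lt_of_lt_of_le (by positivity) hx)
    by_contra hlt
    refine hx (Real.smoothTransition.zero_of_nonpos ?_)
    have h1 : C.bdf x < ε / 4 := not_le.1 hlt
    have : 4 / ε * C.bdf x ≤ 4 / ε * (ε / 4) := by gcongr
    field_simp at this ⊢
    linarith
  · have hcl : IsClosed {x | C.bdf x ≤ ε / 2} :=
      isClosed_le C.bdf_smooth.continuous continuous_const
    refine (closure_minimal (fun x hx => ?_) hcl).trans fun x hx => ?_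
    · by_contra hlt
      refine hx ?_
      have h1 : ε / 2 < C.bdf x := not_le.1 hlt
      have : 4 / ε * (ε / 2) ≤ 4 / ε * C.bdf x := by gcongr
      have h2 : 1 ≤ 4 / ε * C.bdf x - 1 := by
        have : 4 / ε * (ε / 2) = 2 := by field_simp; norm_num
        linarith
      beta_reduce
      rw [Real.smoothTransition.one_of_one_le h2, sub_self]
    · by_contra hxt
      have h1 := hle x hxt
      have h2 : C.bdf x ≤ ε / 2 := hx
      linarith

end Families
end AsympConic

end

noncomputable section
namespace AsympConic

set_option linter.unusedSectionVars false

/-! ### The two directions of the proposition -/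

section Admissible

variable {n : ℕ} {X Y : Type*}
  [TopologicalSpace X] [ChartedSpace (EuclideanHalfSpace (n + 1)) X]
  [IsManifold (𝓡∂ (n + 1)) ∞ X]
  [TopologicalSpace Y] [ChartedSpace (EuclideanSpace ℝ (Fin n)) Y] [IsManifold (𝓡 n) ∞ Y]
  {C : Collar n X Y} {h : BoundaryMetric n Y} {g : BilinField n X}
  {F : ℝ → ℝ} {a a₀ : ℕ∞} {m : ℝ}

/-- Conjugation of an admissible family. -/
theorem Collar.IsAdmissible.exists_checkConj_eq (hg : IsRiemannianInside g)
    (hF : IsRadialPart F a) (H : HasNormalForms C h g F (1 + a₀))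
    (hm : Nonempty Y → MemWeightedSmooth 𝓘(ℝ, ℝ) radialRegion (1 + a) (fun s => m * s))
    {L : Op X} {P : ℝ → Op X} {b₁ b₂ b₃ b₄ : ℕ∞}
    (hP : C.IsAdmissible g L P a a₀ b₁ b₂ b₃ b₄) :
    ∃ (P₁ : Op X) (P₂ : X → ℂ),
      C.MemDiffSum 1 2 (min a b₁) (min a₀ b₂) P₁ ∧
      C.MemFunSum 1 (min a (min b₁ (1 + b₃))) (min a₀ (min b₂ (1 + b₄))) P₂ ∧
      ∀ σ : ℝ, 0 ≤ σ → C.OpEq (C.checkConj m σ (P σ)) fun u x =>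
        (laplacian g u x + L u x) - σ ^ 2 * u x + σ * P₁ u x + σ ^ 2 * P₂ x * u x := by
  obtain ⟨hL, χ, Q, R, hχ, hQ, hR, hP⟩ := hP
  set φ : X → ℂ := fun z => (C.phaseFun m z : ℂ) with hφ
  have hL' : C.MemFunSum 2 a a₀ (commFun L φ) :=
    Collar.MemDiffSum.commFun_phase (w := 2) (by
      rwa [show (1 : ℕ∞) + 2 = 3 by norm_num]) m
  have hQ' : C.MemFunSum 1 b₁ b₂ (commFun Q φ) :=
    Collar.MemDiffSum.commFun_phase (w := 1) (by
      rwa [show (1 : ℕ∞) + 1 = 2 by norm_num]) m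
  have hR' : C.MemFunSum 1 (1 + b₃) (1 + b₄) R :=
    Collar.MemFunSum.lower (w := 1) (by rwa [show (1 : ℕ∞) + 1 = 2 by norm_num])
  have hlap := memFunSum_laplacian_phase (C := C) hg hF H hm
  have hW := memDiffSum_transportField hg hF H hm hχ
  have hN := memFunSum_phaseNorm hg hF H hm hχ
  -- The coefficients of σ and σ² after conjugation. The 1 in the second compensates the −σ² split
  -- off in the conclusion, and −2(1−χ)(1 + 𝔪ρ/2) comes from 2iσ(1−χ)∂_r acting on the phase.
  refine ⟨fun u x => Complex.I * (applyField (𝓡∂ (n + 1)) (C.transportField g m χ) u x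
      + (laplacian g φ x + n * C.bdf x) * u x + commFun L φ x * u x) + Q u x,
    fun x => ((1 + C.phaseNorm g m x - 2 * (1 - χ x) * (1 + m / 2 * C.bdf x) : ℝ) : ℂ)
      + Complex.I * commFun Q φ x + R x, ?_, ?_, fun σ hσ u hu x hx => ?_⟩
  · refine Collar.MemDiffSum.add (Collar.MemDiffSum.const_mul ?_ _)
      (Collar.MemDiffSum.mono hQ (min_le_right _ _) (min_le_right _ _))
    refine Collar.MemDiffSum.mono ?_ (min_le_left _ _) (min_le_left _ _)
    exact Collar.MemDiffSum.add (Collar.MemDiffSum.add hW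
      (Collar.MemFunSum.memDiffSum hlap 1)) (Collar.MemFunSum.memDiffSum hL' 1)
  · refine Collar.MemFunSum.add (Collar.MemFunSum.add ?_ (Collar.MemFunSum.const_mul ?_ _)) ?_
    · exact Collar.MemFunSum.mono hN (min_le_left _ _) (min_le_left _ _)
    · exact Collar.MemFunSum.mono hQ' ((min_le_right _ _).trans (min_le_left _ _))
        ((min_le_right _ _).trans (min_le_left _ _))
    · exact Collar.MemFunSum.mono hR' ((min_le_right _ _).trans (min_le_right _ _))
        ((min_le_right _ _).trans (min_le_right _ _))
  · have hx' : x ∈ (𝓡∂ (n + 1)).interior X := hx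
    have hv : ∀ z ∈ (𝓡∂ (n + 1)).interior X, C.phase m σ z * u z
        = Complex.exp (Complex.I * σ * C.phaseFun m z) * u z := fun z hz => by
      rw [C.phase_eq m σ hz]
    have hvs : SmoothInside (𝓡∂ (n + 1)) C.region (fun z => C.phase m σ z * u z) :=
      (((C.smoothInside_phaseFun m).exp_mul (Complex.I * σ)).mul hu).congr hv
    have h1 := hP σ hσ _ hvs x hx
    have h2 := C.one_sub_cutoff_mul_radialDeriv m σ hχ hu hv hx'
    have hr : Complex.I * σ * n / C.r x = Complex.I * σ * n * C.bdf x := by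
      rw [Collar.r, Complex.ofReal_inv, div_inv_eq_mul]
    have h3 : P σ (fun z => C.phase m σ z * u z) x
        = Complex.exp (Complex.I * σ * C.phaseFun m x)
          * ((laplacian g u x + L u x) - σ ^ 2 * u x
            + σ * (Complex.I * (applyField (𝓡∂ (n + 1)) (C.transportField g m χ) u x
              + (laplacian g φ x + n * C.bdf x) * u x + commFun L φ x * u x) + Q u x)
            + σ ^ 2 * (((1 + C.phaseNorm g m x
              - 2 * (1 - χ x) * (1 + m / 2 * C.bdf x) : ℝ) : ℂ)
              + Complex.I * commFun Q φ x + R x) * u x) := by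
      refine h1.trans ?_
      beta_reduce
      rw [mul_assoc (2 * Complex.I * (σ : ℂ)), h2, C.laplacian_phase_mul hg m σ hu hv hx', hr,
        hL.exp_mul m σ hu hv hx', hQ.exp_mul m σ hu hv hx', hv x hx',
        C.applyField_transportField m hχ hu hx']
      push_cast
      linear_combination (2 * (1 - χ x) * (1 + m / 2 * C.bdf x) * u x * (σ : ℂ) ^ 2 *
        Complex.exp (Complex.I * σ * C.phaseFun m x)) * Complex.I_sq
    rw [Collar.checkConj, h3]
    exact C.phase_neg_mul m σ hx' _

/-- The family obtained by conjugating a stationary operator is admissible. -/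
theorem Collar.isAdmissible_hatConj [CompactSpace X] (hg : IsRiemannianInside g)
    (hF : IsRadialPart F a) (ha₀ : 1 ≤ a₀) (H : HasNormalForms C h g F (1 + a₀))
    (hm : Nonempty Y → ∀ b : ℝ → ℝ, ContDiffOn ℝ ∞ b (Ico 0 1) →
      (∀ s ∈ Ioo (0 : ℝ) 1, F s = s * b s) → b 0 = m)
    {L : Op X} (hL : C.MemDiffSum 1 3 a a₀ L) :
    C.IsAdmissible g L
      (fun σ => C.hatConj m σ fun u x => (laplacian g u x + L u x) - σ ^ 2 * u x)
      a a₀ a a₀ (a - 1) (a₀ - 1) := by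
  obtain ⟨χ, hχ⟩ := C.exists_isCutoff
  have hm' := fun hY => hF.mass_mem (hm hY)
  set φ : X → ℂ := fun z => (C.phaseFun m z : ℂ) with hφ
  have hL' : C.MemFunSum 2 a a₀ (commFun L φ) :=
    Collar.MemDiffSum.commFun_phase (w := 2) (by
      rwa [show (1 : ℕ∞) + 2 = 3 by norm_num]) m
  have hlap := memFunSum_laplacian_phase (C := C) hg hF H hm'
  have hW := memDiffSum_transportField hg hF H hm' hχ
  -- Q is what the σ-linear part of the conjugated operator leaves after 2iσ(1−χ)∂_r and iσn/r are
  -- subtracted. In the σ²-part, |dφ|² from the Laplacian meets the −σ² of the stationary operator.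
  refine ⟨hL, χ, fun u x => -Complex.I * (applyField (𝓡∂ (n + 1)) (C.transportField g m χ) u x
      + (laplacian g φ x + n * C.bdf x) * u x + commFun L φ x * u x),
    fun x => ((C.phaseNorm g m x - 1 : ℝ) : ℂ), hχ, ?_,
    memFunSum_phaseNorm_sub_one hg hF ha₀ H hm, fun σ _ u hu x hx => ?_⟩
  · exact Collar.MemDiffSum.const_mul (Collar.MemDiffSum.add (Collar.MemDiffSum.add hW
      (Collar.MemFunSum.memDiffSum hlap 1)) (Collar.MemFunSum.memDiffSum hL' 1)) _
  · have hx' : x ∈ (𝓡∂ (n + 1)).interior X := hx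
    have hv : ∀ z ∈ (𝓡∂ (n + 1)).interior X, C.phase m (-σ) z * u z
        = Complex.exp (Complex.I * (-σ : ℝ) * C.phaseFun m z) * u z := fun z hz => by
      rw [C.phase_eq m (-σ) hz]
    have hr : Complex.I * σ * n / C.r x = Complex.I * σ * n * C.bdf x := by
      rw [Collar.r, Complex.ofReal_inv, div_inv_eq_mul]
    have hc := C.phase_neg_mul m (-σ) hx' (laplacian g u x
      + 2 * Complex.I * σ * (1 - χ x) * C.radialDeriv u x
        + Complex.I * σ * n / C.r x * u x + L u x
        + σ * (-Complex.I * (applyField (𝓡∂ (n + 1)) (C.transportField g m χ) u x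
          + (laplacian g φ x + n * C.bdf x) * u x + commFun L φ x * u x))
        + σ ^ 2 * ((C.phaseNorm g m x - 1 : ℝ) : ℂ) * u x)
    rw [neg_neg] at hc
    refine Eq.trans ?_ hc
    unfold Collar.hatConj
    beta_reduce
    rw [C.laplacian_phase_mul hg m (-σ) hu hv hx', hL.exp_mul m (-σ) hu hv hx',
      hv x hx', hr, C.applyField_transportField m hχ hu hx']
    push_cast
    ring

end Admissible
end AsympConic

end

theorem mainTheorem9 {n : ℕ} {X Y : Type*}
    [TopologicalSpace X] [T2Space X] [CompactSpace X] [ConnectedSpace X]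
    [ChartedSpace (EuclideanHalfSpace (n + 1)) X] [IsManifold (𝓡∂ (n + 1)) ∞ X]
    [TopologicalSpace Y] [T2Space Y] [CompactSpace Y]
    [ChartedSpace (EuclideanSpace ℝ (Fin n)) Y] [IsManifold (𝓡 n) ∞ Y]
    (C : AsympConic.Collar n X Y) (h : AsympConic.BoundaryMetric n Y)
    (g : AsympConic.BilinField n X) (hg : AsympConic.IsRiemannianInside g)
    (gimel gimel₀ : ℕ∞) (hgimel₀ : 1 ≤ gimel₀) (hle : gimel ≤ gimel₀)
    (hconic : AsympConic.IsAsympConic C h g gimel gimel₀)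
    (𝔪 : ℝ) (hmass : C.IsMass g 𝔪) :
    (∀ (L : AsympConic.Op X) (P : ℝ → AsympConic.Op X) (b₁ b₂ b₃ b₄ : ℕ∞),
      C.IsAdmissible g L P gimel gimel₀ b₁ b₂ b₃ b₄ →
      ∃ (P₁ : AsympConic.Op X) (P₂ : X → ℂ),
        C.MemDiffSum 1 2 (min gimel b₁) (min gimel₀ b₂) P₁ ∧
        C.MemFunSum 1 (min gimel (min b₁ (1 + b₃))) (min gimel₀ (min b₂ (1 + b₄))) P₂ ∧
        ∀ σ : ℝ, 0 ≤ σ → C.OpEq (C.checkConj 𝔪 σ (P σ)) fun u x =>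
          (AsympConic.laplacian g u x + L u x) - σ ^ 2 * u x
            + σ * P₁ u x + σ ^ 2 * P₂ x * u x) ∧
    (∀ L : AsympConic.Op X, C.MemDiffSum 1 3 gimel gimel₀ L →
      C.IsAdmissible g L
        (fun σ => C.hatConj 𝔪 σ fun u x =>
          (AsympConic.laplacian g u x + L u x) - σ ^ 2 * u x)
        gimel gimel₀ gimel gimel₀ (gimel - 1) (gimel₀ - 1)) := by
  obtain ⟨F, hF, H⟩ := AsympConic.exists_hasNormalForms hconic
  -- gimel₀ ≥ 1 supplies the bound 2 ≤ 1 + gimel₀ that identifies the mass with the first Taylor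
  -- coefficient of F. The first direction needs only the resulting decay of 𝔪ρ, the second the
  -- identity itself.
  have hm : Nonempty Y → ∀ b : ℝ → ℝ, ContDiffOn ℝ ∞ b (Ico 0 1) →
      (∀ s ∈ Ioo (0 : ℝ) 1, F s = s * b s) → b 0 = 𝔪 := fun _ b hb e =>
    hmass.eq hg H (by rw [← one_add_one_eq_two]; gcongr) hF hb.continuousOn e
  exact ⟨fun L P b₁ b₂ b₃ b₄ hP =>
      hP.exists_checkConj_eq hg hF H fun hY => hF.mass_mem (hm hY),
    fun L hL => AsympConic.Collar.isAdmissible_hatConj hg hF hgimel₀ H hm hL⟩
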